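/- **Setting.** A labeled directed graph $G=(V,E,L)$ is a finite directed graph (loops allowed) with a vertex labeling $L:V\to\Sigma$. A walk is a finite or infinite sequence of vertices in which consecutive vertices are joined by an edge; it is a path if its vertices are pairwise distinct. A finite or infinite string is *repeated* in $G$ if it is the label sequence of two distinct walks of $G$. $G$ has *repeated strings of unbounded length* if for every $n$ it has a finite repeated string of length $>n$. The problem LRSP asks for the following. If $G$ has an infinite repeated string, return strings $R$ and $S\neq\varepsilon$ such that $RS^\omega$ is an infinite repeated string. Otherwise, if $G$ has repeated strings of unbounded length, return nonempty $R,S$ such that $R^mS$ is repeated for all $m\ge 1$. Otherwise, return a longest finite repeated string ($\varepsilon$ if no string is repeated). The answer also says which of the three cases holds. The labeled self-product $G\otimes G=(V',E',L')$ has $V'=\{(u,v)\in V\times V: L(u)=L(v)\}$, an edge from $(u,v)$ to $(u',v')$ iff $(u,u'),(v,v')\in E$, and $L'(u,v)=L(u)$. Let $V'_{\mathrm{cyc}}$ be the set of vertices of $G\otimes G$ that lie on a cycle (loops included), $V'_{\mathrm{diff}}=\{(u,v)\in V':u\ne v\}$, and $V'_{\mathrm{ndet}}$ the set of all $(v,v)$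 such that $v$ has two distinct out-neighbors in $G$ with the same label. Reachability includes the empty path. **Algorithm.** 1. If some $q\in V'_{\mathrm{diff}}$ reaches some $q'\in V'_{\mathrm{cyc}}$, choose such a pair, a path $p$ from $q$ to $q'$ and a cycle $c$ through $q'$; return "infinite" with $R$ the string spelled by $p$ without its last vertex $q'$, and $S$ the string spelled by $c$ started at $q'$ (each vertex of $c$ once). 2. Otherwise, if some $(u,u)\in V'_{\mathrm{cyc}}$ reaches some $(v,v)\in V'_{\mathrm{ndet}}$, choose such a pair, a cycle $c$ through $(u,u)$, a path $p$ from $(u,u)$ to $(v,v)$, and an out-neighbor $x$ of $v$ in $G$ such that another out-neighbor of $v$ has the same label; return "unbounded" with $R$ the string spelled by $c$ started at $(u,u)$ (each vertex once), and $S$ the string spelled by $p$ followed by the letter $L(x)$. 3. Otherwise, remove $V'_{\mathrm{cyc}}$ from $G\otimes G$ and return "finite" with the string spelled by a longest path of the remaining graph among those visiting a vertex of $V'_{\mathrm{diff}}$ ($\varepsilon$ if $V'_{\mathrm{diff}}=\emptyset$). **Theorem.** For every finite labeled directed graph $G$: (a) The check in phase 1 succeeds iff $G$ has an infinite repeated string.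 If $G$ has no infinite repeated string, the check in phase 2 succeeds iff $G$ has repeated strings of unbounded length. The graph obtained from $G\otimes G$ by removing $V'_{\mathrm{cyc}}$ is acyclic. The algorithm has an outcome, and every outcome (for all choices it leaves open) is a correct answer to LRSP on $G$. (b) The algorithm can be implemented to run in linear time if $G\otimes G$ is given: there is a fixed word-RAM program that, from a list of the vertices of $G\otimes G$ (with their labels and two components) and a list of its edges, in any order, computes an outcome of the algorithm in $O(|V'|+|E'|+1)$ steps. (c) There is a fixed word-RAM program that, from a list of the labeled vertices and a list of the edges of a graph $G$ in which every vertex has an in-neighbor or an out-neighbor, computes an outcome of the algorithm in $O(|E|^2+1)$ steps. In (b) and (c), labels are natural numbers. The only requirement on the word size is that a word can hold the labels and all numbers up to a constant times $|V'|+|E'|+1$ in (b), and $|E|^2+1$ in (c). Every arithmetic operation ($+$, truncated $-$, $\times$), comparison and memory access takes one step, and no computed value may exceed the word size. -/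

import Mathlib

/-! ### Labeled directed graphs, walks and repeated strings -/

/-- A directed graph (loops allowed) with a label on every vertex. -/
structure LabeledDigraph (V A : Type*) extends Digraph V where
  label : V → A

namespace LabeledDigraph

variable {V V₁ V₂ A : Type*}

/-- A finite walk, as the list of its vertices. -/
def IsWalk (G : LabeledDigraph V A) (p : List V) : Prop :=
  p.IsChain G.Adj

/-- An infinite walk. -/
def IsInfiniteWalk (G : LabeledDigraph V A) (p : ℕ → V) : Prop :=
  ∀ i, G.Adj (p i) (p (i + 1))

/-- The finite string `S` has two distinct occurrences in `G`. -/
def IsRepeated (G : LabeledDigraph V A) (S : List A) : Prop :=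
  ∃ p q : List V, G.IsWalk p ∧ G.IsWalk q ∧ p ≠ q ∧ p.map G.label = S ∧ q.map G.label = S

/-- The infinite string `w` has two distinct occurrences in `G`. -/
def IsInfiniteRepeated (G : LabeledDigraph V A) (w : ℕ → A) : Prop :=
  ∃ p q : ℕ → V, G.IsInfiniteWalk p ∧ G.IsInfiniteWalk q ∧ p ≠ q ∧
    (∀ i, G.label (p i) = w i) ∧ (∀ i, G.label (q i) = w i)

/-- `G` has an infinite repeated string. -/
def HasInfiniteRepeat (G : LabeledDigraph V A) : Prop :=
  ∃ w : ℕ → A, G.IsInfiniteRepeated w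

/-- `G` has (finite) repeated strings of unbounded length. -/
def HasUnboundedRepeats (G : LabeledDigraph V A) : Prop :=
  ∀ n : ℕ, ∃ S : List A, G.IsRepeated S ∧ n < S.length

/-- A path from `a` to `b`: a walk with pairwise distinct vertices. The one-vertex list `[a]` is
the empty path (no edge) from `a` to `a`. -/
def IsPathFromTo (G : LabeledDigraph V A) (p : List V) (a b : V) : Prop :=
  G.IsWalk p ∧ p.Nodup ∧ p.head? = some a ∧ p.getLast? = some b

/-- A cycle starting and ending in `a`, given by its distinct vertices in order, `a` first; the
closing edge goes from the last vertex of the list back to `a`. A loop is the cycle `[a]`. -/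
def IsCycleAt (G : LabeledDigraph V A) (c : List V) (a : V) : Prop :=
  ∃ b, G.IsPathFromTo c a b ∧ G.Adj b a

/-- `b` is reachable from `a`, possibly by the empty path. -/
def Reaches (G : LabeledDigraph V A) (a b : V) : Prop :=
  Relation.ReflTransGen G.Adj a b

/-- The vertices that lie on a cycle (loops included). -/
def cyclicVertices (G : LabeledDigraph V A) : Set V :=
  {a | Relation.TransGen G.Adj a a}

/-- The labeled direct product. -/
def prod (G₁ : LabeledDigraph V₁ A) (G₂ : LabeledDigraph V₂ A) :
    LabeledDigraph {q : V₁ × V₂ // G₁.label q.1 = G₂.label q.2} A where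
  Adj q r := G₁.Adj q.1.1 r.1.1 ∧ G₂.Adj q.1.2 r.1.2
  label q := G₁.label q.1.1

/-- The vertices of the labeled self-product. -/
abbrev SelfVertex (G : LabeledDigraph V A) : Type _ :=
  {q : V × V // G.label q.1 = G.label q.2}

/-- The labeled self-product `G ⊗ G`. -/
abbrev self (G : LabeledDigraph V A) : LabeledDigraph G.SelfVertex A :=
  G.prod G

/-- The vertex `(v, v)` of `G ⊗ G`. -/
def diag (G : LabeledDigraph V A) (v : V) : G.SelfVertex :=
  ⟨(v, v), rfl⟩

/-- The vertices of `G ⊗ G` that lie on a cycle of `G ⊗ G`. -/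
def Vcyc (G : LabeledDigraph V A) : Set G.SelfVertex :=
  G.self.cyclicVertices

/-- The vertices `(u, v)` of `G ⊗ G` with `u ≠ v`. -/
def Vdiff (G : LabeledDigraph V A) : Set G.SelfVertex :=
  {q | q.1.1 ≠ q.1.2}

/-- `x` is an out-neighbor of `v`, and `v` has another out-neighbor with the same label. -/
def HasTwin (G : LabeledDigraph V A) (v x : V) : Prop :=
  G.Adj v x ∧ ∃ y, G.Adj v y ∧ y ≠ x ∧ G.label y = G.label x

/-- The vertices `(v, v)` of `G ⊗ G` with `v` non-deterministic in `G`. -/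
def Vndet (G : LabeledDigraph V A) : Set G.SelfVertex :=
  {q | ∃ v x, q = G.diag v ∧ G.HasTwin v x}

end LabeledDigraph

/-! ### The problem and the three-phase algorithm -/

/-- Answers to the longest repeated string problem: `infinite R S` stands for `R S^ω`,
`unbounded R S` for the family `R^m S`, `m ≥ 1`, and `finite S` for the string `S`. -/
inductive LRSPAnswer (A : Type*) where
  | infinite (R S : List A)
  | unbounded (R S : List A)
  | finite (S : List A)

/-- The infinite string `R S^ω`. -/
def ultimatelyPeriodic {A : Type*} (R S : List A) (hS : S ≠ []) : ℕ → A := fun i =>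
  if h : i < R.length then R[i]
  else S[(i - R.length) % S.length]'(Nat.mod_lt _ (List.length_pos_iff.mpr hS))

namespace LabeledDigraph

variable {V A : Type*}

/-- The answer is correct for `G`: an infinite repeated string if there is one; otherwise a family
of repeated strings of unbounded length if repeated strings have unbounded length; otherwise a
longest repeated string (the empty string if no string is repeated). -/
def SolvesLRSP (G : LabeledDigraph V A) : LRSPAnswer A → Prop
  | .infinite R S => ∃ hS : S ≠ [], G.IsInfiniteRepeated (ultimatelyPeriodic R S hS)
  | .unbounded R S =>
      ¬ G.HasInfiniteRepeat ∧ G.HasUnboundedRepeats ∧ R ≠ [] ∧ S ≠ [] ∧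
      ∀ m : ℕ, 1 ≤ m → G.IsRepeated ((List.replicate m R).flatten ++ S)
  | .finite S =>
      ¬ G.HasInfiniteRepeat ∧ ¬ G.HasUnboundedRepeats ∧
      (G.IsRepeated S ∨ ((∀ T, ¬ G.IsRepeated T) ∧ S = [])) ∧
      ∀ T, G.IsRepeated T → T.length ≤ S.length

/-- The check of the first phase succeeds. -/
def PhaseOne (G : LabeledDigraph V A) : Prop :=
  ∃ q ∈ G.Vdiff, ∃ q' ∈ G.Vcyc, G.self.Reaches q q'

/-- The check of the second phase succeeds. -/
def PhaseTwo (G : LabeledDigraph V A) : Prop :=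
  ∃ u : V, G.diag u ∈ G.Vcyc ∧ ∃ q' ∈ G.Vndet, G.self.Reaches (G.diag u) q'

/-- The edges of `G ⊗ G` left after removing the vertices on cycles. -/
def dagAdj (G : LabeledDigraph V A) (q r : G.SelfVertex) : Prop :=
  G.self.Adj q r ∧ q ∉ G.Vcyc ∧ r ∉ G.Vcyc

/-- A path of `G ⊗ G` without its vertices on cycles that visits a vertex `(u, v)`, `u ≠ v`. -/
def IsDagPath (G : LabeledDigraph V A) (p : List G.SelfVertex) : Prop :=
  G.self.IsWalk p ∧ p.Nodup ∧ (∀ q ∈ p, q ∉ G.Vcyc) ∧ ∃ q ∈ p, q ∈ G.Vdiff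

/-- The possible outcomes of the three-phase algorithm on `G`, over all the choices of vertices,
paths and cycles that it leaves open. The path from `q` to `q'` in the first phase contributes its
labels without that of `q'`, which is the first letter of the cycle. -/
inductive AlgorithmOutput (G : LabeledDigraph V A) : LRSPAnswer A → Prop
  | infinite (q q' : G.SelfVertex) (p c : List G.SelfVertex)
      (hq : q ∈ G.Vdiff) (hq' : q' ∈ G.Vcyc)
      (hp : G.self.IsPathFromTo p q q') (hc : G.self.IsCycleAt c q') :
      AlgorithmOutput G (.infinite (p.dropLast.map G.self.label) (c.map G.self.label))
  | unbounded (u v x : V) (p c : List G.SelfVertex)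
      (h1 : ¬ G.PhaseOne)
      (hu : G.diag u ∈ G.Vcyc) (hv : G.diag v ∈ G.Vndet) (hx : G.HasTwin v x)
      (hp : G.self.IsPathFromTo p (G.diag u) (G.diag v)) (hc : G.self.IsCycleAt c (G.diag u)) :
      AlgorithmOutput G (.unbounded (c.map G.self.label) (p.map G.self.label ++ [G.label x]))
  | finite (p : List G.SelfVertex)
      (h1 : ¬ G.PhaseOne) (h2 : ¬ G.PhaseTwo)
      (hp : G.IsDagPath p) (hmax : ∀ p', G.IsDagPath p' → p'.length ≤ p.length) :
      AlgorithmOutput G (.finite (p.map G.self.label))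
  | empty (h1 : ¬ G.PhaseOne) (h2 : ¬ G.PhaseTwo) (hdiff : G.Vdiff = ∅) :
      AlgorithmOutput G (.finite [])

end LabeledDigraph

/-! ### A word RAM with a step count

Programs use finitely many registers and finitely many arrays of words (an address space split into
named parts). There is a bound `W` on the values a word can hold: a program run in which a value
`≥ W` is computed does not count as a run. -/

namespace WordRAM

/-- The content of registers and arrays. -/
structure State where
  reg : ℕ → ℕ
  arr : ℕ → ℕ → ℕ

/-- Store `v` in register `x`. -/
def State.setReg (σ : State) (x v : ℕ) : State :=
  { σ with reg := Function.update σ.reg x v }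

/-- Store `v` in cell `i` of array `a`. -/
def State.setArr (σ : State) (a i v : ℕ) : State :=
  { σ with arr := Function.update σ.arr a (Function.update (σ.arr a) i v) }

/-- Expressions over words. -/
inductive Term where
  | const (k : ℕ)
  | reg (x : ℕ)
  | read (a : ℕ) (i : Term)
  | add (e f : Term)
  | sub (e f : Term)
  | mul (e f : Term)
  | lt (e f : Term)
  | eq (e f : Term)

namespace Term

/-- The value of an expression; subtraction is truncated, comparisons return 0 or 1. -/
def val (σ : State) : Term → ℕ
  | const k => k
  | reg x => σ.reg x
  | read a i => σ.arr a (i.val σ)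
  | add e f => e.val σ + f.val σ
  | sub e f => e.val σ - f.val σ
  | mul e f => e.val σ * f.val σ
  | lt e f => if e.val σ < f.val σ then 1 else 0
  | eq e f => if e.val σ = f.val σ then 1 else 0

/-- Every value computed in evaluating the expression is less than `W`. -/
def Fits (W : ℕ) (σ : State) : Term → Prop
  | const k => k < W
  | reg x => σ.reg x < W
  | read a i => i.Fits W σ ∧ σ.arr a (i.val σ) < W
  | add e f => e.Fits W σ ∧ f.Fits W σ ∧ e.val σ + f.val σ < W
  | sub e f => e.Fits W σ ∧ f.Fits W σ
  | mul e f => e.Fits W σ ∧ f.Fits W σ ∧ e.val σ * f.val σ < W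
  | lt e f => e.Fits W σ ∧ f.Fits W σ ∧ 1 < W
  | eq e f => e.Fits W σ ∧ f.Fits W σ ∧ 1 < W

/-- Every operation, and every access to a constant, a register or a cell, takes one step. -/
def cost : Term → ℕ
  | const _ => 1
  | reg _ => 1
  | read _ i => i.cost + 1
  | add e f => e.cost + f.cost + 1
  | sub e f => e.cost + f.cost + 1
  | mul e f => e.cost + f.cost + 1
  | lt e f => e.cost + f.cost + 1
  | eq e f => e.cost + f.cost + 1

end Term

/-- Programs. -/
inductive Program where
  | skip
  | assign (x : ℕ) (e : Term)
  | write (a : ℕ) (i e : Term)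
  | seq (P Q : Program)
  | ite (e : Term) (P Q : Program)
  | loop (e : Term) (P : Program)

/-- `Runs W P σ t τ`: with words bounded by `W`, the program `P` started in state `σ` halts in
state `τ` after `t` steps. A test succeeds if its value is not 0; `loop e P` is
"while `e` do `P`". -/
inductive Runs (W : ℕ) : Program → State → ℕ → State → Prop
  | skip (σ : State) : Runs W .skip σ 1 σ
  | assign (σ : State) (x : ℕ) (e : Term) (he : e.Fits W σ) :
      Runs W (.assign x e) σ (e.cost + 1) (σ.setReg x (e.val σ))
  | write (σ : State) (a : ℕ) (i e : Term) (hi : i.Fits W σ) (he : e.Fits W σ) :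
      Runs W (.write a i e) σ (i.cost + e.cost + 1) (σ.setArr a (i.val σ) (e.val σ))
  | seq {P Q : Program} {σ τ ρ : State} {s t : ℕ}
      (hP : Runs W P σ s τ) (hQ : Runs W Q τ t ρ) :
      Runs W (.seq P Q) σ (s + t) ρ
  | ite_true {e : Term} {P : Program} (Q : Program) {σ τ : State} {t : ℕ}
      (he : e.Fits W σ) (h : e.val σ ≠ 0) (hP : Runs W P σ t τ) :
      Runs W (.ite e P Q) σ (e.cost + t + 1) τ
  | ite_false {e : Term} (P : Program) {Q : Program} {σ τ : State} {t : ℕ}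
      (he : e.Fits W σ) (h : e.val σ = 0) (hQ : Runs W Q σ t τ) :
      Runs W (.ite e P Q) σ (e.cost + t + 1) τ
  | loop_stop {e : Term} (P : Program) {σ : State}
      (he : e.Fits W σ) (h : e.val σ = 0) :
      Runs W (.loop e P) σ (e.cost + 1) σ
  | loop_step {e : Term} {P : Program} {σ τ ρ : State} {s t : ℕ}
      (he : e.Fits W σ) (h : e.val σ ≠ 0)
      (hP : Runs W P σ s τ) (hL : Runs W (.loop e P) τ t ρ) :
      Runs W (.loop e P) σ (e.cost + s + t + 1) ρ

/-- The initial state with the given words in the first registers and the given lists in the first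
arrays; everything else is 0. -/
def inputState (regs : List ℕ) (arrs : List (List ℕ)) : State where
  reg x := regs.getD x 0
  arr a i := (arrs.getD a []).getD i 0

/-- Register `r` holds the length of `l`, and array `a` starts with the entries of `l`. -/
def State.HoldsList (σ : State) (r a : ℕ) (l : List ℕ) : Prop :=
  σ.reg r = l.length ∧ ∀ (i : ℕ) (h : i < l.length), σ.arr a i = l[i]

/-- The answer written in a final state: register 0 tells its kind, and its strings stand in
arrays 0 and 1 with their lengths in registers 1 and 2. -/
def State.Holds (σ : State) : LRSPAnswer ℕ → Prop
  | .infinite R S => σ.reg 0 = 0 ∧ σ.HoldsList 1 0 R ∧ σ.HoldsList 2 1 S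
  | .unbounded R S => σ.reg 0 = 1 ∧ σ.HoldsList 1 0 R ∧ σ.HoldsList 2 1 S
  | .finite S => σ.reg 0 = 2 ∧ σ.HoldsList 1 0 S

/-- `vs` lists the vertices of `G` and `es` its edges (as pairs of positions in `vs`), each of them
exactly once and in any order. -/
structure Lists {V A : Type*} (G : LabeledDigraph V A) (vs : List V)
    (es : List (Fin vs.length × Fin vs.length)) : Prop where
  nodup_vs : vs.Nodup
  mem_vs : ∀ v, v ∈ vs
  nodup_es : es.Nodup
  mem_es : ∀ i j, (i, j) ∈ es ↔ G.Adj (vs.get i) (vs.get j)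

/-- The input "`G` is given": the numbers of vertices and edges, the labels of the vertices, and the
two ends of the edges. -/
def graphInput {V : Type*} (G : LabeledDigraph V ℕ) (vs : List V)
    (es : List (Fin vs.length × Fin vs.length)) : State :=
  inputState [vs.length, es.length]
    [vs.map G.label, es.map (fun e => (e.1 : ℕ)), es.map (fun e => (e.2 : ℕ))]

/-- The input "`G ⊗ G` is given", for a graph on the vertices `0, …, n - 1`: as `graphInput` for the
product, together with the two components of every vertex. -/
def productInput {n : ℕ} (G : LabeledDigraph (Fin n) ℕ) (vs : List G.SelfVertex)
    (es : List (Fin vs.length × Fin vs.length)) : State :=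
  inputState [vs.length, es.length]
    [vs.map G.self.label, es.map (fun e => (e.1 : ℕ)), es.map (fun e => (e.2 : ℕ)),
      vs.map (fun q => (q.1.1 : ℕ)), vs.map (fun q => (q.1.2 : ℕ))]

end WordRAM

/-!
A repeated string is the label string of a walk in the self-product `G ⊗ G` that leaves the diagonal
(`isRepeated_iff`). An infinite walk in a finite graph runs into a cycle, and a path followed by a
cycle can be walked for ever, so an infinite repeated string exists if and only if a vertex off the
diagonal reaches a cycle. If this fails, a walk from a cycle to a vertex off the diagonal starts on
the diagonal and leaves it at a non-deterministic vertex (`phaseTwo_of_reaches`), and the cycle can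
be repeated before it. If there is no such walk either, the walks that leave the diagonal avoid all
cycles (`notMem_Vcyc_of_walk`); they are paths, hence of bounded length, and the third phase finds a
longest one.

The linear-time program does not compute the set of vertices on cycles. It peels: vertices without
outgoing edges are removed one after the other, and the vertices that stay are those that reach a
cycle. For a removed vertex the peeling also yields the length of a longest walk from it and a
pointer to the second vertex of such a walk (`PeelSpec`). The same is done in the reversed graph.
* The first check succeeds if and only if the peeling leaves a vertex off the diagonal; from it one
  follows edges between remaining vertices until a vertex is seen twice, which gives a path and a
  cycle at once (`output_infinite_of_lasso`).
* If the first check fails, the second one succeeds if and only if an edge leaves the diagonal at a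
  vertex that remains in the reversed graph; following edges backwards gives the cycle and the path
  (`output_unbounded_of_lasso`).
* Otherwise the vertices off the diagonal are removed in both peelings (`Encodes.degB_eq_zero`), and
  a longest path consists of the two walks along the pointers from a vertex off the diagonal where
  the sum of the two lengths is largest (`Encodes.length_le`, `output_finite_of_walk`).

The quadratic-time program lists the pairs of vertices and the pairs of edges that make up the
self-product, with a square matrix to number the vertices. Without isolated vertices a graph has at
most twice as many vertices as edges (`length_le_two_mul`), so that this takes quadratic time.

The programs are verified with a Hoare-style predicate `HaltsWithin`. All loops have loop-free
bodies, nested loops being flattened, so that it is enough to bound the numbers of rounds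
(`HaltsWithin.loop`). That all values are words is checked for constants and for the results of
additions and multiplications only, since all cells hold words throughout (`State.Bdd`).
-/

/-! ### Walks, paths and cycles -/

namespace LabeledDigraph

variable {V A : Type*} {G : LabeledDigraph V A}

theorem IsWalk.pairwise_transGen {p : List V} (h : G.IsWalk p) :
    p.Pairwise (Relation.TransGen G.Adj) :=
  List.isChain_iff_pairwise.1 (List.IsChain.imp (fun _ _ => Relation.TransGen.single) h)

theorem IsWalk.nodup {p : List V} (h : G.IsWalk p) (hp : ∀ a ∈ p, a ∉ G.cyclicVertices) :
    p.Nodup := by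
  refine List.Pairwise.imp_of_mem ?_ h.pairwise_transGen
  rintro a b ha - hab rfl
  exact hp a ha hab

theorem IsPathFromTo.exists_cons {p : List V} {a b : V} (h : G.IsPathFromTo p a b) :
    ∃ l, p = a :: l := by
  obtain ⟨-, -, h, -⟩ := h
  cases p with
  | nil => simp at h
  | cons x l => exact ⟨l, by simpa using h⟩

theorem IsPathFromTo.dropLast_append {p : List V} {a b : V} (h : G.IsPathFromTo p a b) :
    p.dropLast ++ [b] = p :=
  List.dropLast_append_getLast? _ h.2.2.2

theorem IsPathFromTo.reaches {p : List V} {a b : V} (h : G.IsPathFromTo p a b) :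
    G.Reaches a b := by
  obtain ⟨l, rfl⟩ := h.exists_cons
  refine List.relationReflTransGen_of_exists_isChain_cons l h.1 ?_
  have := h.2.2.2
  rwa [List.getLast?_eq_some_getLast (List.cons_ne_nil _ _), Option.some.injEq] at this

theorem Reaches.exists_path {a b : V} (h : G.Reaches a b) : ∃ p, G.IsPathFromTo p a b := by
  induction h using Relation.ReflTransGen.head_induction_on with
  | refl => exact ⟨[b], List.isChain_singleton _, by simp, by simp, by simp⟩
  | @head a c hac _ ih =>
    obtain ⟨p, hp⟩ := ih
    by_cases ha : a ∈ p
    · -- a walk that returns to `a` is cut off at the return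
      obtain ⟨s, t, rfl⟩ := List.append_of_mem ha
      refine ⟨a :: t, hp.1.right_of_append, hp.2.1.of_append_right, by simp, ?_⟩
      simpa [List.getLast?_append] using hp.2.2.2
    · refine ⟨a :: p, hp.1.cons ?_, List.nodup_cons.2 ⟨ha, hp.2.1⟩, by simp, ?_⟩
      · intro y hy
        rw [hp.2.2.1] at hy
        cases hy
        exact hac
      · rw [List.getLast?_cons, hp.2.2.2]
        rfl

theorem exists_isCycleAt {a : V} (h : a ∈ G.cyclicVertices) : ∃ c, G.IsCycleAt c a := by
  obtain ⟨b, hab, hba⟩ := Relation.TransGen.tail'_iff.1 h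
  obtain ⟨p, hp⟩ := Reaches.exists_path hab
  exact ⟨p, b, hp, hba⟩

theorem IsCycleAt.mem_cyclicVertices {c : List V} {a : V} (h : G.IsCycleAt c a) :
    a ∈ G.cyclicVertices := by
  obtain ⟨b, hc, hb⟩ := h
  exact Relation.TransGen.tail' hc.reaches hb

/-! ### Walks of the self-product are pairs of walks -/

theorem exists_pairing : ∀ {p q : List V}, p.map G.label = q.map G.label →
    ∃ r : List G.SelfVertex, r.map (·.1.1) = p ∧ r.map (·.1.2) = q
  | [], [], _ => ⟨[], rfl, rfl⟩
  | [], b :: q, h => by simp at h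
  | a :: p, [], h => by simp at h
  | a :: p, b :: q, h => by
    simp only [List.map_cons, List.cons.injEq] at h
    obtain ⟨r, rfl, rfl⟩ := exists_pairing h.2
    exact ⟨⟨(a, b), h.1⟩ :: r, rfl, rfl⟩

theorem isWalk_self_iff {r : List G.SelfVertex} :
    G.self.IsWalk r ↔ G.IsWalk (r.map (·.1.1)) ∧ G.IsWalk (r.map (·.1.2)) := by
  unfold IsWalk
  rw [List.isChain_map, List.isChain_map]
  simp only [List.isChain_iff_getElem]
  exact ⟨fun h => ⟨fun i hi => (h i hi).1, fun i hi => (h i hi).2⟩,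
    fun h i hi => ⟨h.1 i hi, h.2 i hi⟩⟩

theorem map_self_label_fst (r : List G.SelfVertex) :
    (r.map (·.1.1)).map G.label = r.map G.self.label := by
  rw [List.map_map]; rfl

theorem map_self_label_snd (r : List G.SelfVertex) :
    (r.map (·.1.2)).map G.label = r.map G.self.label := by
  rw [List.map_map]
  exact List.map_congr_left fun q _ => q.2.symm

theorem map_fst_eq_map_snd_iff {r : List G.SelfVertex} :
    r.map (·.1.1) = r.map (·.1.2) ↔ ∀ q ∈ r, q ∉ G.Vdiff := by
  rw [List.map_inj_left]
  simp [Vdiff]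

/-- A repeated string is the label string of a walk of `G ⊗ G` that leaves the diagonal. -/
theorem isRepeated_iff {S : List A} : G.IsRepeated S ↔
    ∃ r, G.self.IsWalk r ∧ (∃ q ∈ r, q ∈ G.Vdiff) ∧ r.map G.self.label = S := by
  constructor
  · rintro ⟨p, q, hp, hq, hpq, rfl, hS⟩
    obtain ⟨r, rfl, rfl⟩ := exists_pairing hS.symm
    refine ⟨r, isWalk_self_iff.2 ⟨hp, hq⟩, ?_, (map_self_label_fst r).symm⟩
    by_contra! h
    exact hpq (map_fst_eq_map_snd_iff.2 h)
  · rintro ⟨r, hr, hd, rfl⟩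
    refine ⟨_, _, (isWalk_self_iff.1 hr).1, (isWalk_self_iff.1 hr).2, ?_,
      map_self_label_fst r, map_self_label_snd r⟩
    rw [Ne, map_fst_eq_map_snd_iff]
    push Not
    exact hd

theorem eq_diag_of_notMem_Vdiff {q : G.SelfVertex} (h : q ∉ G.Vdiff) : ∃ u, q = G.diag u := by
  obtain ⟨⟨u, v⟩, hq⟩ := q
  obtain rfl : u = v := by simpa [Vdiff] using h
  exact ⟨u, rfl⟩

theorem diag_notMem_Vdiff (u : V) : G.diag u ∉ G.Vdiff := by simp [Vdiff, diag]

/-- An edge of `G ⊗ G` leaves the diagonal at a non-deterministic vertex. -/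
theorem hasTwin_of_adj {v : V} {q : G.SelfVertex} (h : G.self.Adj (G.diag v) q)
    (hq : q ∈ G.Vdiff) : G.HasTwin v q.1.1 :=
  ⟨h.1, q.1.2, h.2, fun e => hq e.symm, q.2.symm⟩

/-- A vertex `(v, v)` with `v` non-deterministic has an edge that leaves the diagonal. -/
theorem exists_adj_of_mem_Vndet {q : G.SelfVertex} (h : q ∈ G.Vndet) :
    q ∉ G.Vdiff ∧ ∃ r ∈ G.Vdiff, G.self.Adj q r := by
  obtain ⟨v, x, rfl, hx, y, hy, hyx, hl⟩ := h
  exact ⟨diag_notMem_Vdiff v, ⟨(x, y), hl.symm⟩, fun e => hyx e.symm, hx, hy⟩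

/-- A walk of `G ⊗ G` from a cycle to a vertex off the diagonal passes the first check, or it
starts on the diagonal, leaves it at a non-deterministic vertex and passes the second check. -/
theorem phaseTwo_of_reaches (h1 : ¬ G.PhaseOne) {a q : G.SelfVertex} (ha : a ∈ G.Vcyc)
    (haq : G.self.Reaches a q) (hq : q ∈ G.Vdiff) : G.PhaseTwo := by
  have had : a ∉ G.Vdiff := fun h => h1 ⟨a, h, a, ha, .refl⟩
  obtain ⟨u, rfl⟩ := eq_diag_of_notMem_Vdiff had
  refine ⟨u, ha, ?_⟩
  induction haq with
  | refl => exact absurd hq had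
  | @tail b c hb hbc ih =>
    by_cases hbd : b ∈ G.Vdiff
    · exact ih hbd
    · obtain ⟨v, rfl⟩ := eq_diag_of_notMem_Vdiff hbd
      exact ⟨_, ⟨v, _, rfl, hasTwin_of_adj hbc hq⟩, hb⟩

/-- If both checks fail, the walks of `G ⊗ G` that leave the diagonal avoid all cycles. -/
theorem notMem_Vcyc_of_walk (h1 : ¬ G.PhaseOne) (h2 : ¬ G.PhaseTwo) {r : List G.SelfVertex}
    (hr : G.self.IsWalk r) (hd : ∃ q ∈ r, q ∈ G.Vdiff) : ∀ a ∈ r, a ∉ G.Vcyc := by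
  intro a har ha
  obtain ⟨q, hqr, hq⟩ := hd
  have key : G.self.Reaches a q ∨ G.self.Reaches q a := by
    obtain ⟨s, t, rfl⟩ := List.append_of_mem hqr
    have hpw := hr.pairwise_transGen
    rw [List.pairwise_append, List.pairwise_cons] at hpw
    rcases List.mem_append.1 har with h | h
    · exact .inl (hpw.2.2 a h q (by simp)).to_reflTransGen
    · rcases List.mem_cons.1 h with rfl | h
      · exact .inl .refl
      · exact .inr (hpw.2.1.1 a h).to_reflTransGen
  rcases key with h | h
  · exact h2 (phaseTwo_of_reaches h1 ha h hq)
  · exact h1 ⟨q, hq, a, ha, h⟩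

/-- If both checks fail, repeated strings are the label strings of the paths that the third phase
considers. -/
theorem exists_isDagPath_of_isRepeated (h1 : ¬ G.PhaseOne) (h2 : ¬ G.PhaseTwo) {S : List A}
    (hS : G.IsRepeated S) : ∃ p, G.IsDagPath p ∧ p.map G.self.label = S := by
  obtain ⟨r, hr, hd, rfl⟩ := isRepeated_iff.1 hS
  have := notMem_Vcyc_of_walk h1 h2 hr hd
  exact ⟨r, ⟨hr, hr.nodup this, this, hd⟩, rfl⟩

theorem IsDagPath.isRepeated {p : List G.SelfVertex} (hp : G.IsDagPath p) :
    G.IsRepeated (p.map G.self.label) :=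
  isRepeated_iff.2 ⟨p, hp.1, hp.2.2.2, rfl⟩

theorem IsDagPath.length_le [Finite V] {p : List G.SelfVertex} (hp : G.IsDagPath p) :
    p.length ≤ Nat.card G.SelfVertex := by
  classical
  have := Fintype.ofFinite G.SelfVertex
  rw [Nat.card_eq_fintype_card]
  exact hp.2.1.length_le_card

/-! ### Infinite walks -/

theorem ultimatelyPeriodic_map {B : Type*} (f : V → B) (R S : List V) (hS : S ≠ [])
    (hS' : S.map f ≠ []) (i : ℕ) :
    ultimatelyPeriodic (R.map f) (S.map f) hS' i = f (ultimatelyPeriodic R S hS i) := by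
  unfold ultimatelyPeriodic
  simp only [List.length_map, List.getElem_map]
  split <;> rfl

theorem isInfiniteWalk_ultimatelyPeriodic {R S : List V} (hS : S ≠ []) (h : G.IsWalk (R ++ S))
    (hc : G.Adj (S.getLast hS) (S.head hS)) :
    G.IsInfiniteWalk (ultimatelyPeriodic R S hS) := by
  intro i
  have hn : 0 < S.length := List.length_pos_iff.2 hS
  unfold ultimatelyPeriodic
  unfold IsWalk at h
  rw [List.isChain_iff_getElem] at h
  split_ifs with h1 h2 h2
  · have := h i (by simp; omega)
    rwa [List.getElem_append_left h1, List.getElem_append_left h2] at this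
  · have hi : i + 1 = R.length := by omega
    have := h i (by simp; omega)
    rw [List.getElem_append_left h1, List.getElem_append_right (by omega)] at this
    have e : (i + 1 - R.length) % S.length = i + 1 - R.length := Nat.mod_eq_of_lt (by omega)
    simpa only [e] using this
  · omega
  · have hj : (i - R.length) % S.length < S.length := Nat.mod_lt _ hn
    have e : i + 1 - R.length = (i - R.length) + 1 := by omega
    by_cases hw : (i - R.length) % S.length + 1 = S.length
    · have e1 : (i + 1 - R.length) % S.length = 0 := by
        rw [e, Nat.add_mod]
        rcases Nat.lt_or_ge 1 S.length with h' | h'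
        · rw [Nat.mod_eq_of_lt h', hw, Nat.mod_self]
        · have : S.length = 1 := by omega
          simp [this, Nat.mod_one]
      have e2 : (i - R.length) % S.length = S.length - 1 := by omega
      simp only [e1, e2]
      rwa [List.getLast_eq_getElem, List.head_eq_getElem] at hc
    · have e1 : (i + 1 - R.length) % S.length = (i - R.length) % S.length + 1 := by
        rw [e, Nat.add_mod, Nat.mod_eq_of_lt (a := 1) (by omega), Nat.mod_eq_of_lt (by omega)]
      have := h (R.length + (i - R.length) % S.length) (by simp; omega)
      rw [List.getElem_append_right (by omega), List.getElem_append_right (by omega)] at this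
      have e3 : R.length + (i - R.length) % S.length + 1 - R.length
        = (i - R.length) % S.length + 1 := by omega
      simp only [e3, Nat.add_sub_cancel_left] at this
      simpa only [e1] using this

/-- Two distinct infinite walks with the same labels meet a tail of a walk of `G ⊗ G` off the
diagonal; it reaches a cycle by finiteness. -/
theorem HasInfiniteRepeat.phaseOne [Finite V] (h : G.HasInfiniteRepeat) : G.PhaseOne := by
  obtain ⟨w, p, q, hp, hq, hpq, hpw, hqw⟩ := h
  obtain ⟨i, hi⟩ := Function.ne_iff.1 hpq
  let z : ℕ → G.SelfVertex := fun j => ⟨(p (i + j), q (i + j)), (hpw _).trans (hqw _).symm⟩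
  have hz : ∀ j, G.self.Adj (z j) (z (j + 1)) := fun j => ⟨hp (i + j), hq (i + j)⟩
  have hlt : ∀ j k, j < k → Relation.TransGen G.self.Adj (z j) (z k) := by
    intro j k hjk
    induction k, hjk using Nat.le_induction with
    | base => exact .single (hz j)
    | succ k _ ih => exact ih.tail (hz k)
  obtain ⟨j, k, hjk, e⟩ := Finite.exists_ne_map_eq_of_infinite z
  wlog hlt' : j < k generalizing j k
  · exact this k j hjk.symm e.symm (by omega)
  refine ⟨z 0, hi, z j, ?_, ?_⟩
  · have := hlt j k hlt'
    rwa [← e] at this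
  · rcases Nat.eq_zero_or_pos j with rfl | hj
    · exact .refl
    · exact (hlt 0 j hj).to_reflTransGen

/-! ### Every outcome of the algorithm is correct -/

theorem isInfiniteRepeated_of_path_of_cycle {q q' : G.SelfVertex} {p c : List G.SelfVertex}
    (hq : q ∈ G.Vdiff) (hp : G.self.IsPathFromTo p q q') (hc : G.self.IsCycleAt c q') :
    G.SolvesLRSP (.infinite (p.dropLast.map G.self.label) (c.map G.self.label)) := by
  obtain ⟨b, hcp, hb⟩ := hc
  obtain ⟨c, rfl⟩ := hcp.exists_cons
  have hne : q' :: c ≠ [] := List.cons_ne_nil _ _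
  have hlast : (q' :: c).getLast hne = b := by
    have := hcp.2.2.2
    rwa [List.getLast?_eq_some_getLast hne, Option.some.injEq] at this
  have hwalk : G.self.IsWalk (p.dropLast ++ q' :: c) := by
    have h1 : G.self.IsWalk (p.dropLast ++ [q']) := by rw [hp.dropLast_append]; exact hp.1
    have h2 : G.self.IsWalk ([q'] ++ c) := hcp.1
    simpa [IsWalk] using List.IsChain.append_overlap h1 h2 (by simp)
  have hinf := isInfiniteWalk_ultimatelyPeriodic hne hwalk (by rw [hlast]; exact hb)
  have h0 : ultimatelyPeriodic p.dropLast (q' :: c) hne 0 = q := by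
    obtain ⟨l, rfl⟩ := hp.exists_cons
    cases l with
    | nil =>
      have := hp.2.2.2
      simp at this
      simp [ultimatelyPeriodic, this]
    | cons y l => simp [ultimatelyPeriodic]
  refine ⟨by simp, fun i => (ultimatelyPeriodic p.dropLast (q' :: c) hne i).1.1,
    fun i => (ultimatelyPeriodic p.dropLast (q' :: c) hne i).1.2,
    fun i => (hinf i).1, fun i => (hinf i).2, ?_, ?_, ?_⟩
  · intro h
    have := congrFun h 0
    simp only [h0] at this
    exact hq this
  · intro i
    rw [ultimatelyPeriodic_map _ _ _ hne]; rfl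
  · intro i
    rw [ultimatelyPeriodic_map _ _ _ hne]
    exact (ultimatelyPeriodic p.dropLast (q' :: c) hne i).2.symm

theorem isWalk_flatten_replicate_append {a b : V} {c p : List V} (hc : G.IsCycleAt c a)
    (hp : G.IsPathFromTo p a b) (m : ℕ) :
    G.IsWalk ((List.replicate m c).flatten ++ p) ∧
      ((List.replicate m c).flatten ++ p).head? = some a := by
  obtain ⟨d, hcp, hd⟩ := hc
  induction m with
  | zero => simpa using ⟨hp.1, hp.2.2.1⟩
  | succ m ih =>
    rw [List.replicate_succ, List.flatten_cons, List.append_assoc]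
    refine ⟨hcp.1.append ih.1 ?_, ?_⟩
    · intro x hx y hy
      rw [hcp.2.2.2] at hx
      rw [ih.2] at hy
      cases hx
      cases hy
      exact hd
    · rw [List.head?_append, hcp.2.2.1]; rfl

theorem isRepeated_replicate_append {u v x : V} {p c : List G.SelfVertex} (hx : G.HasTwin v x)
    (hp : G.self.IsPathFromTo p (G.diag u) (G.diag v)) (hc : G.self.IsCycleAt c (G.diag u))
    (m : ℕ) : G.IsRepeated ((List.replicate m (c.map G.self.label)).flatten ++
      (p.map G.self.label ++ [G.label x])) := by
  obtain ⟨hvx, y, hvy, hyx, hl⟩ := hx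
  have hw := (isWalk_flatten_replicate_append hc hp m).1
  have hext : ∀ z, G.Adj v z → G.IsWalk
      (((List.replicate m c).flatten ++ p).map (·.1.1) ++ [z]) := by
    intro z hz
    refine (isWalk_self_iff.1 hw).1.append (List.isChain_singleton _) ?_
    intro s hs t ht
    rw [List.getLast?_map, List.getLast?_append, hp.2.2.2] at hs
    simp only [Option.some_or, Option.map_some, Option.mem_def, Option.some.injEq] at hs
    obtain rfl : z = t := by simpa using ht
    rw [← hs]
    exact hz
  have hlab : (List.replicate m (c.map G.self.label)).flatten ++ p.map G.self.label =
      (((List.replicate m c).flatten ++ p).map (·.1.1)).map G.label := by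
    rw [map_self_label_fst]
    simp [List.map_flatten]
  refine ⟨_, _, hext x hvx, hext y hvy, ?_, ?_, ?_⟩
  · intro h
    simp only [List.append_cancel_left_eq, List.cons.injEq, and_true] at h
    exact hyx h.symm
  · rw [List.map_append, ← hlab]; simp
  · rw [List.map_append, ← hlab]; simp [hl]

theorem phaseOne_iff [Finite V] : G.PhaseOne ↔ G.HasInfiniteRepeat := by
  refine ⟨?_, HasInfiniteRepeat.phaseOne⟩
  rintro ⟨q, hq, q', hq', h⟩
  obtain ⟨p, hp⟩ := h.exists_path
  obtain ⟨c, hc⟩ := exists_isCycleAt hq'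
  obtain ⟨_, h⟩ := isInfiniteRepeated_of_path_of_cycle hq hp hc
  exact ⟨_, h⟩

theorem hasUnboundedRepeats_of_replicate {R S : List A} (hR : R ≠ [])
    (h : ∀ m, G.IsRepeated ((List.replicate m R).flatten ++ S)) : G.HasUnboundedRepeats := by
  intro n
  refine ⟨_, h (n + 1), ?_⟩
  have : 1 ≤ R.length := List.length_pos_iff.2 hR
  simp only [List.length_append, List.length_flatten, List.map_replicate, List.sum_replicate,
    smul_eq_mul]
  nlinarith

theorem IsCycleAt.ne_nil {c : List V} {a : V} (h : G.IsCycleAt c a) : c ≠ [] := by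
  obtain ⟨b, hc, -⟩ := h
  obtain ⟨l, rfl⟩ := hc.exists_cons
  simp

theorem PhaseTwo.exists_output (h1 : ¬ G.PhaseOne) (h2 : G.PhaseTwo) :
    ∃ R S, G.AlgorithmOutput (.unbounded R S) := by
  obtain ⟨u, hu, q', hq', h⟩ := h2
  obtain ⟨v, x, rfl, hx⟩ := id hq'
  obtain ⟨p, hp⟩ := h.exists_path
  obtain ⟨c, hc⟩ := exists_isCycleAt hu
  exact ⟨_, _, .unbounded u v x p c h1 hu hq' hx hp hc⟩

theorem not_hasUnboundedRepeats [Finite V] (h1 : ¬ G.PhaseOne) (h2 : ¬ G.PhaseTwo) :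
    ¬ G.HasUnboundedRepeats := by
  intro h
  obtain ⟨S, hS, hlt⟩ := h (Nat.card G.SelfVertex)
  obtain ⟨p, hp, rfl⟩ := exists_isDagPath_of_isRepeated h1 h2 hS
  have := hp.length_le
  simp at hlt
  omega

theorem AlgorithmOutput.solvesLRSP [Finite V] {o : LRSPAnswer A} (h : G.AlgorithmOutput o) :
    G.SolvesLRSP o := by
  cases h with
  | infinite q q' p c hq hq' hp hc => exact isInfiniteRepeated_of_path_of_cycle hq hp hc
  | unbounded u v x p c h1 hu hv hx hp hc =>
    have hR : c.map G.self.label ≠ [] := by simpa using hc.ne_nil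
    have h := isRepeated_replicate_append hx hp hc
    exact ⟨fun hi => h1 hi.phaseOne, hasUnboundedRepeats_of_replicate hR h, hR, by simp,
      fun m _ => h m⟩
  | finite p h1 h2 hp hmax =>
    refine ⟨fun hi => h1 hi.phaseOne, not_hasUnboundedRepeats h1 h2, .inl hp.isRepeated, ?_⟩
    intro T hT
    obtain ⟨p', hp', rfl⟩ := exists_isDagPath_of_isRepeated h1 h2 hT
    simpa using hmax p' hp'
  | empty h1 h2 hd =>
    have hno : ∀ T, ¬ G.IsRepeated T := by
      intro T hT
      obtain ⟨r, -, ⟨q, -, hq⟩, -⟩ := isRepeated_iff.1 hT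
      rw [hd] at hq
      exact hq
    exact ⟨fun hi => h1 hi.phaseOne, not_hasUnboundedRepeats h1 h2, .inr ⟨hno, rfl⟩,
      fun T hT => absurd hT (hno T)⟩

theorem phaseTwo_iff [Finite V] (h : ¬ G.HasInfiniteRepeat) :
    G.PhaseTwo ↔ G.HasUnboundedRepeats := by
  have h1 : ¬ G.PhaseOne := fun h' => h (phaseOne_iff.1 h')
  refine ⟨fun h2 => ?_, fun hU => by_contra fun h2 => not_hasUnboundedRepeats h1 h2 hU⟩
  obtain ⟨R, S, ho⟩ := h2.exists_output h1
  exact ho.solvesLRSP.2.1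

theorem exists_algorithmOutput [Finite V] : ∃ o, G.AlgorithmOutput o := by
  by_cases h1 : G.PhaseOne
  · obtain ⟨q, hq, q', hq', h⟩ := h1
    obtain ⟨p, hp⟩ := h.exists_path
    obtain ⟨c, hc⟩ := exists_isCycleAt hq'
    exact ⟨_, .infinite q q' p c hq hq' hp hc⟩
  by_cases h2 : G.PhaseTwo
  · obtain ⟨R, S, ho⟩ := h2.exists_output h1
    exact ⟨_, ho⟩
  by_cases hd : G.Vdiff = ∅
  · exact ⟨_, .empty h1 h2 hd⟩
  obtain ⟨q, hq⟩ := Set.nonempty_iff_ne_empty.2 hd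
  have hq1 : G.IsDagPath [q] := by
    refine ⟨List.isChain_singleton q, by simp, ?_, q, by simp, hq⟩
    simpa using fun h => h1 ⟨q, hq, q, h, .refl⟩
  have hfin : {n | ∃ p, G.IsDagPath p ∧ p.length = n}.Finite :=
    (Set.finite_Iic (Nat.card G.SelfVertex)).subset
      (by rintro _ ⟨p, hp, rfl⟩; exact hp.length_le)
  obtain ⟨n, ⟨p, hp, rfl⟩, hmax⟩ := Set.exists_max_image _ id hfin ⟨_, _, hq1, rfl⟩
  exact ⟨_, .finite p h1 h2 hp fun p' hp' => hmax _ ⟨p', hp', rfl⟩⟩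

theorem not_transGen_dagAdj (q : G.SelfVertex) : ¬ Relation.TransGen G.dagAdj q q := by
  intro h
  obtain ⟨r, hqr, -⟩ := Relation.TransGen.head'_iff.1 h
  exact hqr.2.1 (Relation.TransGen.mono (r := G.dagAdj) (p := G.self.Adj)
    (fun _ _ h => h.1) q q h)

end LabeledDigraph

/-! ### Verifying word RAM programs -/

namespace WordRAM

/-- Every register and every cell holds a word. -/
def State.Bdd (W : ℕ) (σ : State) : Prop :=
  (∀ x, σ.reg x < W) ∧ ∀ a i, σ.arr a i < W

/-- What remains to be checked for `Term.Fits` in a state whose cells all hold words. -/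
def Term.Ok (W : ℕ) (σ : State) : Term → Prop
  | const k => k < W
  | reg _ => True
  | read _ i => i.Ok W σ
  | add e f => e.Ok W σ ∧ f.Ok W σ ∧ e.val σ + f.val σ < W
  | sub e f => e.Ok W σ ∧ f.Ok W σ
  | mul e f => e.Ok W σ ∧ f.Ok W σ ∧ e.val σ * f.val σ < W
  | lt e f => e.Ok W σ ∧ f.Ok W σ ∧ 1 < W
  | eq e f => e.Ok W σ ∧ f.Ok W σ ∧ 1 < W

theorem Term.Ok.fits {W : ℕ} {σ : State} (hσ : σ.Bdd W) : ∀ {e : Term}, e.Ok W σ → e.Fits W σ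
  | const _, h => h
  | reg x, _ => hσ.1 x
  | read a _, h => ⟨Ok.fits hσ h, hσ.2 a _⟩
  | add _ _, h => ⟨Ok.fits hσ h.1, Ok.fits hσ h.2.1, h.2.2⟩
  | sub _ _, h => ⟨Ok.fits hσ h.1, Ok.fits hσ h.2⟩
  | mul _ _, h => ⟨Ok.fits hσ h.1, Ok.fits hσ h.2.1, h.2.2⟩
  | lt _ _, h => ⟨Ok.fits hσ h.1, Ok.fits hσ h.2.1, h.2.2⟩
  | eq _ _, h => ⟨Ok.fits hσ h.1, Ok.fits hσ h.2.1, h.2.2⟩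

theorem Term.Fits.val_lt {W : ℕ} {σ : State} : ∀ {e : Term}, e.Fits W σ → e.val σ < W
  | const _, h => h
  | reg _, h => h
  | read _ _, h => h.2
  | add _ _, h => h.2.2
  | sub _ _, h => lt_of_le_of_lt (Nat.sub_le _ _) h.1.val_lt
  | mul _ _, h => h.2.2
  | lt _ _, h => by
    have := h.2.2
    simp only [val]
    split <;> omega
  | eq _ _, h => by
    have := h.2.2
    simp only [val]
    split <;> omega

theorem State.Bdd.setReg {W : ℕ} {σ : State} (hσ : σ.Bdd W) (x : ℕ) {v : ℕ} (hv : v < W) :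
    (σ.setReg x v).Bdd W := by
  refine ⟨fun y => ?_, hσ.2⟩
  simp only [State.setReg, Function.update_apply]
  split
  · exact hv
  · exact hσ.1 y

theorem State.Bdd.setArr {W : ℕ} {σ : State} (hσ : σ.Bdd W) (a i : ℕ) {v : ℕ} (hv : v < W) :
    (σ.setArr a i v).Bdd W := by
  refine ⟨hσ.1, fun b j => ?_⟩
  simp only [State.setArr, Function.update_apply]
  split
  · rw [Function.update_apply]
    split
    · exact hv
    · exact hσ.2 a j
  · exact hσ.2 b j

theorem Runs.bdd {W : ℕ} {P : Program} {σ τ : State} {t : ℕ} (h : Runs W P σ t τ)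
    (hσ : σ.Bdd W) : τ.Bdd W := by
  induction h with
  | skip => exact hσ
  | assign σ x e he => exact hσ.setReg x he.val_lt
  | write σ a i e _ he => exact hσ.setArr a _ he.val_lt
  | seq _ _ ih1 ih2 => exact ih2 (ih1 hσ)
  | ite_true _ _ _ _ ih => exact ih hσ
  | ite_false _ _ _ _ ih => exact ih hσ
  | loop_stop => exact hσ
  | loop_step _ _ _ _ ih1 ih2 => exact ih2 (ih1 hσ)

namespace Program

/-- The registers that a program may change. -/
def wregs : Program → List ℕ
  | skip => []
  | assign x _ => [x]
  | write _ _ _ => []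
  | seq P Q => P.wregs ++ Q.wregs
  | ite _ P Q => P.wregs ++ Q.wregs
  | loop _ P => P.wregs

/-- The arrays that a program may change. -/
def warrs : Program → List ℕ
  | skip => []
  | assign _ _ => []
  | write a _ _ => [a]
  | seq P Q => P.warrs ++ Q.warrs
  | ite _ P Q => P.warrs ++ Q.warrs
  | loop _ P => P.warrs

/-- The effect of a program without loops. -/
def exec : Program → State → State
  | skip, σ => σ
  | assign x e, σ => σ.setReg x (e.val σ)
  | write a i e, σ => σ.setArr a (i.val σ) (e.val σ)
  | seq P Q, σ => Q.exec (P.exec σ)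
  | ite e P Q, σ => if e.val σ = 0 then Q.exec σ else P.exec σ
  | loop _ _, σ => σ

/-- In a state whose cells all hold words, the run of the program computes words only. Programs
with loops are not safe in the sense of this definition. -/
def Safe (W : ℕ) : Program → State → Prop
  | skip, _ => True
  | assign _ e, σ => e.Ok W σ
  | write _ i e, σ => i.Ok W σ ∧ e.Ok W σ
  | seq P Q, σ => P.Safe W σ ∧ Q.Safe W (P.exec σ)
  | ite e P Q, σ => e.Ok W σ ∧ (e.val σ = 0 → Q.Safe W σ) ∧ (e.val σ ≠ 0 → P.Safe W σ)
  | loop _ _, _ => False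

/-- A coefficient for the running time: if the body of every loop of the program is executed at
most `S` times, `S ≥ 1`, and the bodies have no loops, then there are at most `bound * S` steps. -/
def bound : Program → ℕ
  | skip => 1
  | assign _ e => e.cost + 1
  | write _ i e => i.cost + e.cost + 1
  | seq P Q => P.bound + Q.bound
  | ite e P Q => e.cost + P.bound + Q.bound + 1
  | loop e P => 2 * (e.cost + P.bound + 1)

end Program

/-- `τ` agrees with `σ` except for the registers and arrays that `P` may change. -/
def Frame (P : Program) (σ τ : State) : Prop :=
  (∀ x, x ∉ P.wregs → τ.reg x = σ.reg x) ∧ ∀ a, a ∉ P.warrs → τ.arr a = σ.arr a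

theorem Runs.frame {W : ℕ} {P : Program} {σ τ : State} {t : ℕ} (h : Runs W P σ t τ) :
    Frame P σ τ := by
  induction h with
  | skip => exact ⟨fun _ _ => rfl, fun _ _ => rfl⟩
  | assign σ x e he =>
    refine ⟨fun y hy => ?_, fun _ _ => rfl⟩
    exact Function.update_of_ne (by simpa [Program.wregs] using hy) _ _
  | write σ a i e _ he =>
    refine ⟨fun _ _ => rfl, fun b hb => ?_⟩
    exact Function.update_of_ne (by simpa [Program.warrs] using hb) _ _
  | seq _ _ ih1 ih2 =>
    simp only [Frame, Program.wregs, Program.warrs, List.mem_append, not_or] at *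
    exact ⟨fun x hx => (ih2.1 x hx.2).trans (ih1.1 x hx.1),
      fun a ha => (ih2.2 a ha.2).trans (ih1.2 a ha.1)⟩
  | ite_true _ _ _ _ ih =>
    simp only [Frame, Program.wregs, Program.warrs, List.mem_append, not_or] at *
    exact ⟨fun x hx => ih.1 x hx.1, fun a ha => ih.2 a ha.1⟩
  | ite_false _ _ _ _ ih =>
    simp only [Frame, Program.wregs, Program.warrs, List.mem_append, not_or] at *
    exact ⟨fun x hx => ih.1 x hx.2, fun a ha => ih.2 a ha.2⟩
  | loop_stop => exact ⟨fun _ _ => rfl, fun _ _ => rfl⟩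
  | loop_step _ _ _ _ ih1 ih2 =>
    simp only [Frame, Program.wregs, Program.warrs] at *
    exact ⟨fun x hx => (ih2.1 x hx).trans (ih1.1 x hx),
      fun a ha => (ih2.2 a ha).trans (ih1.2 a ha)⟩

theorem Program.Safe.runs {W : ℕ} : ∀ {P : Program} {σ : State}, σ.Bdd W → P.Safe W σ →
    ∃ t ≤ P.bound, Runs W P σ t (P.exec σ)
  | .skip, σ, _, _ => ⟨1, le_rfl, .skip σ⟩
  | .assign x e, σ, hσ, h => ⟨_, le_rfl, .assign σ x e (h.fits hσ)⟩
  | .write a i e, σ, hσ, h => ⟨_, le_rfl, .write σ a i e (h.1.fits hσ) (h.2.fits hσ)⟩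
  | .seq P Q, σ, hσ, h => by
    obtain ⟨s, hs, hP⟩ := Program.Safe.runs hσ h.1
    obtain ⟨t, ht, hQ⟩ := Program.Safe.runs (hP.bdd hσ) h.2
    exact ⟨s + t, Nat.add_le_add hs ht, .seq hP hQ⟩
  | .ite e P Q, σ, hσ, h => by
    by_cases he : e.val σ = 0
    · obtain ⟨t, ht, hQ⟩ := Program.Safe.runs hσ (h.2.1 he)
      refine ⟨e.cost + t + 1, by simp only [bound]; omega, ?_⟩
      rw [exec, if_pos he]
      exact .ite_false P (h.1.fits hσ) he hQ
    · obtain ⟨t, ht, hP⟩ := Program.Safe.runs hσ (h.2.2 he)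
      refine ⟨e.cost + t + 1, by simp only [bound]; omega, ?_⟩
      rw [exec, if_neg he]
      exact .ite_true Q (h.1.fits hσ) he hP

/-- Total correctness with a running time: started in `σ`, the program `P` halts after at most
`P.bound * S` steps in a state that satisfies `Q`. -/
def HaltsWithin (W S : ℕ) (P : Program) (σ : State) (Q : State → Prop) : Prop :=
  ∃ t τ, Runs W P σ t τ ∧ t ≤ P.bound * S ∧ Q τ

theorem HaltsWithin.of_safe {W S : ℕ} {P : Program} {σ : State} {Q : State → Prop} (hS : 1 ≤ S)
    (hσ : σ.Bdd W) (h : P.Safe W σ) (hQ : Q (P.exec σ)) : HaltsWithin W S P σ Q := by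
  obtain ⟨t, ht, hP⟩ := h.runs hσ
  exact ⟨t, _, hP, ht.trans (Nat.le_mul_of_pos_right _ hS), hQ⟩

theorem HaltsWithin.mono {W S : ℕ} {P : Program} {σ : State} {Q Q' : State → Prop}
    (h : HaltsWithin W S P σ Q) (hσ : σ.Bdd W)
    (hQ : ∀ τ, τ.Bdd W → Frame P σ τ → Q τ → Q' τ) : HaltsWithin W S P σ Q' := by
  obtain ⟨t, τ, hr, ht, hq⟩ := h
  exact ⟨t, τ, hr, ht, hQ τ (hr.bdd hσ) hr.frame hq⟩

theorem HaltsWithin.seq {W S : ℕ} {P R : Program} {σ : State} {Q Q' : State → Prop}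
    (hσ : σ.Bdd W) (h : HaltsWithin W S P σ Q)
    (h' : ∀ τ, τ.Bdd W → Frame P σ τ → Q τ → HaltsWithin W S R τ Q') :
    HaltsWithin W S (.seq P R) σ Q' := by
  obtain ⟨s, τ, hr, hs, hq⟩ := h
  obtain ⟨t, ρ, hr', ht, hq'⟩ := h' τ (hr.bdd hσ) hr.frame hq
  refine ⟨s + t, ρ, .seq hr hr', ?_, hq'⟩
  rw [Program.bound, Nat.add_mul]
  exact Nat.add_le_add hs ht

theorem HaltsWithin.ite {W S : ℕ} {e : Term} {P R : Program} {σ : State} {Q : State → Prop}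
    (hS : 1 ≤ S) (hσ : σ.Bdd W) (he : e.Ok W σ) (hP : e.val σ ≠ 0 → HaltsWithin W S P σ Q)
    (hR : e.val σ = 0 → HaltsWithin W S R σ Q) : HaltsWithin W S (.ite e P R) σ Q := by
  have hc : e.cost + 1 ≤ (e.cost + 1) * S := Nat.le_mul_of_pos_right _ hS
  have hb : (Program.ite e P R).bound * S = (e.cost + 1) * S + P.bound * S + R.bound * S := by
    rw [Program.bound]; ring
  by_cases h : e.val σ = 0
  · obtain ⟨t, τ, hr, ht, hq⟩ := hR h
    exact ⟨_, τ, .ite_false P (he.fits hσ) h hr, by omega, hq⟩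
  · obtain ⟨t, τ, hr, ht, hq⟩ := hP h
    exact ⟨_, τ, .ite_true R (he.fits hσ) h hr, by omega, hq⟩

/-- The rule for a loop with a loop-free body, with an invariant `I` and a potential `μ` that every
execution of the body decreases. -/
theorem HaltsWithin.loop {W S : ℕ} {e : Term} {P : Program} {σ : State} (I : State → Prop)
    (μ : State → ℕ) (hσ : σ.Bdd W) (h0 : I σ) (hS : 1 ≤ S) (hμ : μ σ ≤ S)
    (hstep : ∀ τ, τ.Bdd W → Frame P σ τ → I τ → e.Ok W τ ∧ (e.val τ ≠ 0 →
      P.Safe W τ ∧ I (P.exec τ) ∧ μ (P.exec τ) < μ τ)) :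
    HaltsWithin W S (.loop e P) σ (fun τ => I τ ∧ e.val τ = 0) := by
  have key : ∀ n τ, μ τ = n → τ.Bdd W → Frame P σ τ → I τ → ∃ t ρ,
      Runs W (.loop e P) τ t ρ ∧ t ≤ (n + 1) * (e.cost + P.bound + 1) ∧ I ρ ∧ e.val ρ = 0 := by
    intro n
    induction n using Nat.strong_induction_on with
    | _ n ih =>
      intro τ hn hτ hf hI
      obtain ⟨hok, hs⟩ := hstep τ hτ hf hI
      by_cases he : e.val τ = 0
      · refine ⟨_, τ, Runs.loop_stop P (hok.fits hτ) he, ?_, hI, he⟩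
        nlinarith
      · obtain ⟨hsafe, hI', hlt⟩ := hs he
        obtain ⟨s, hsb, hr⟩ := hsafe.runs hτ
        have hf' := hr.frame
        obtain ⟨t, ρ, hr', ht, hq⟩ := ih _ (hn ▸ hlt) (P.exec τ) rfl (hr.bdd hτ)
          ⟨fun x hx => (hf'.1 x hx).trans (hf.1 x hx), fun a ha => (hf'.2 a ha).trans (hf.2 a ha)⟩
          hI'
        refine ⟨_, ρ, .loop_step (hok.fits hτ) he hr hr', ?_, hq⟩
        have : (μ (P.exec τ) + 1) * (e.cost + P.bound + 1) ≤ n * (e.cost + P.bound + 1) :=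
          Nat.mul_le_mul_right _ (hn ▸ hlt)
        rw [Nat.add_mul n]
        omega
  obtain ⟨t, ρ, hr, ht, hq⟩ := key _ σ rfl hσ ⟨fun _ _ => rfl, fun _ _ => rfl⟩ h0
  refine ⟨t, ρ, hr, ht.trans ?_, hq⟩
  rw [Program.bound]
  calc (μ σ + 1) * (e.cost + P.bound + 1) ≤ (2 * S) * (e.cost + P.bound + 1) :=
        Nat.mul_le_mul_right _ (by omega)
    _ = _ := by ring

/-- `for i := 0, …, n - 1 do P`, for a number of rounds that is held by register `n`. -/
def forLoop (i n : ℕ) (P : Program) : Program :=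
  .seq (.assign i (.const 0))
    (.loop (.lt (.reg i) (.reg n)) (.seq P (.assign i (.add (.reg i) (.const 1)))))

/-- The rule for `forLoop`: `I k` holds after `k` rounds. -/
theorem HaltsWithin.forLoop {W S : ℕ} {i n : ℕ} {P : Program} {σ : State} (I : ℕ → State → Prop)
    (hσ : σ.Bdd W) (hS : σ.reg n + 1 ≤ S) (hW : 1 < W) (hin : n ≠ i) (hi : i ∉ P.wregs)
    (hn : n ∉ P.wregs) (h0 : I 0 (σ.setReg i 0))
    (hstep : ∀ k τ, k < σ.reg n → τ.Bdd W → Frame P (σ.setReg i k) τ → τ.reg i = k → I k τ →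
      P.Safe W τ ∧ I (k + 1) ((P.exec τ).setReg i (k + 1))) :
    HaltsWithin W S (WordRAM.forLoop i n P) σ (I (σ.reg n)) := by
  have hn0 : (σ.setReg i 0).reg n = σ.reg n := Function.update_of_ne hin _ _
  have hn' : n ∉ (Program.seq P (.assign i (.add (.reg i) (.const 1)))).wregs := by
    simp [Program.wregs, hn, hin]
  refine HaltsWithin.seq (Q := fun τ => τ = σ.setReg i 0) hσ (.of_safe (by omega) hσ ?_ rfl) ?_
  · simp only [Program.Safe, Term.Ok]; omega
  rintro _ hτ - rfl
  refine (HaltsWithin.loop (fun τ => τ.reg i ≤ σ.reg n ∧ I (τ.reg i) τ) (fun τ => σ.reg n - τ.reg i)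
    hτ ?_ (by omega) ?_ ?_).mono hτ ?_
  · simpa [State.setReg] using h0
  · exact (Nat.sub_le _ _).trans (by omega)
  · intro τ hτ' hf hI
    have hnτ : τ.reg n = σ.reg n := (hf.1 n hn').trans hn0
    refine ⟨⟨trivial, trivial, hW⟩, fun he => ?_⟩
    have hlt : τ.reg i < σ.reg n := by
      by_contra h
      simp [Term.val, hnτ, h] at he
    have hf' : Frame P (σ.setReg i (τ.reg i)) τ := by
      refine ⟨fun x hx => ?_, fun a ha => ?_⟩
      · by_cases hxi : x = i
        · subst hxi; simp [State.setReg]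
        · rw [hf.1 x (by simp [Program.wregs, hx, hxi])]
          simp [State.setReg, hxi]
      · exact hf.2 a (by simpa [Program.warrs] using ha)
    obtain ⟨hs, hI'⟩ := hstep _ τ hlt hτ' hf' rfl hI.2
    obtain ⟨t, -, hr⟩ := hs.runs hτ'
    have hri : (P.exec τ).reg i = τ.reg i := hr.frame.1 i hi
    have hnW := hτ'.1 n
    have he1 : (Program.seq P (.assign i (.add (.reg i) (.const 1)))).exec τ
        = (P.exec τ).setReg i (τ.reg i + 1) := by
      simp [Program.exec, Term.val, hri]
    have he2 : ((P.exec τ).setReg i (τ.reg i + 1)).reg i = τ.reg i + 1 := by simp [State.setReg]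
    rw [he1, he2]
    refine ⟨⟨hs, trivial, hW, ?_⟩, ⟨hlt, hI'⟩, by omega⟩
    simp only [Term.val, hri]
    omega
  · rintro τ hτ' hf ⟨⟨hle, hI⟩, he⟩
    have hnτ : τ.reg n = σ.reg n := (hf.1 n hn').trans hn0
    have : τ.reg i = σ.reg n := by
      by_contra h
      simp only [Term.val, hnτ] at he
      rw [if_pos (by omega)] at he
      omega
    rwa [this] at hI

end WordRAM

/-! ### Peeling off the vertices that reach no cycle -/

namespace WordRAM

/-- Zero if no `j < k` has `t j = v`, and one more than the last such `j` otherwise. These are the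
pointers of the linked lists of edges with a given target. -/
def lastIn (t : ℕ → ℕ) (v : ℕ) : ℕ → ℕ
  | 0 => 0
  | k + 1 => if t k = v then k + 1 else lastIn t v k

theorem lastIn_le (t : ℕ → ℕ) (v k : ℕ) : lastIn t v k ≤ k := by
  induction k with
  | zero => exact le_rfl
  | succ k ih => simp only [lastIn]; split <;> omega

theorem ne_of_lastIn_le {t : ℕ → ℕ} {v k e : ℕ} (h : lastIn t v k ≤ e) (he : e < k) :
    t e ≠ v := by
  induction k with
  | zero => omega
  | succ k ih =>
    simp only [lastIn] at h
    split at h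
    · omega
    · rcases Nat.lt_succ_iff_lt_or_eq.1 he with h' | rfl
      · exact ih h h'
      · assumption

theorem lastIn_eq {t : ℕ → ℕ} {v k : ℕ} (h : lastIn t v k ≠ 0) : t (lastIn t v k - 1) = v := by
  induction k with
  | zero => exact absurd rfl h
  | succ k ih =>
    simp only [lastIn] at h ⊢
    split at h
    · rename_i h'
      simp [h']
    · rename_i h'
      simpa [h'] using ih h

/-- The edges that the peeling has not deleted: `queue i`, `i < qh`, are the vertices removed so
far, and of the last of them only the incoming edges `e ≥ p` are deleted. -/
noncomputable def undone (M : ℕ) (t queue : ℕ → ℕ) (qh p : ℕ) : Finset ℕ := by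
  classical
  exact (Finset.range M).filter fun e => ¬ ∃ i < qh, queue i = t e ∧ (i + 1 = qh → p ≤ e)

theorem mem_undone {M : ℕ} {t queue : ℕ → ℕ} {qh p e : ℕ} : e ∈ undone M t queue qh p ↔
    e < M ∧ ¬ ∃ i < qh, queue i = t e ∧ (i + 1 = qh → p ≤ e) := by
  simp [undone]

/-- The invariant of the peeling for the graph on `0, …, N - 1` with the edges `s e → t e`, `e < M`.
`U` is the set of edges not yet deleted and `deg` counts them by their sources; `queue` lists the
vertices with `deg v = 0`, and the first `qh` of them have been processed. Along deleted edges `h`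
is the length of a longest walk and `ptr` the second vertex of such a walk. -/
structure PeelInv (N M : ℕ) (s t deg queue h ptr : ℕ → ℕ) (qh qt : ℕ) (U : Finset ℕ) : Prop where
  qh_le : qh ≤ qt
  queue_lt : ∀ i < qt, queue i < N
  queue_inj : ∀ i < qt, ∀ j < qt, queue i = queue j → i = j
  deg_eq_zero : ∀ v < N, (deg v = 0 ↔ ∃ i < qt, queue i = v)
  deg_eq : ∀ v < N, deg v = (U.filter fun e => s e = v).card
  exists_of_notMem : ∀ e < M, e ∉ U → ∃ i < qh, queue i = t e
  h_edge : ∀ e < M, e ∉ U → h (t e) + 1 ≤ h (s e)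
  h_ptr : ∀ v < N, h v ≠ 0 → ∃ e < M, e ∉ U ∧ s e = v ∧ t e = ptr v ∧ h (ptr v) + 1 = h v
  h_le : ∀ v < N, h v ≤ qh
  h_queue : ∀ i < qt, h (queue i) ≤ i

/-- The result of the peeling: the vertices with `deg v ≠ 0` are those that reach a cycle, and for
the others `h` is the length of a longest walk from `v` and `ptr v` the second vertex of one. -/
structure PeelSpec (N M : ℕ) (s t deg h ptr : ℕ → ℕ) : Prop where
  stay : ∀ v < N, deg v ≠ 0 → ∃ e < M, s e = v ∧ deg (t e) ≠ 0
  gone : ∀ e < M, deg (s e) = 0 → deg (t e) = 0 ∧ h (t e) + 1 ≤ h (s e)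
  h_ptr : ∀ v < N, h v ≠ 0 → ∃ e < M, s e = v ∧ t e = ptr v ∧ h (ptr v) + 1 = h v
  h_le : ∀ v < N, h v ≤ N

section PeelInv

variable {N M : ℕ} {s t deg queue h ptr : ℕ → ℕ} {qh qt : ℕ} {U : Finset ℕ}

theorem PeelInv.qt_le (H : PeelInv N M s t deg queue h ptr qh qt U) : qt ≤ N := by
  simpa using Finset.card_le_card_of_injOn (s := Finset.range qt) (t := Finset.range N) queue
    (fun i hi => by simpa using H.queue_lt i (by simpa using hi))
    (fun i hi j hj hij => H.queue_inj i (by simpa using hi) j (by simpa using hj) hij)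

theorem PeelInv.pop (H : PeelInv N M s t deg queue h ptr qh qt U) (hq : qh < qt) :
    PeelInv N M s t deg queue h ptr (qh + 1) qt U where
  qh_le := hq
  queue_lt := H.queue_lt
  queue_inj := H.queue_inj
  deg_eq_zero := H.deg_eq_zero
  deg_eq := H.deg_eq
  exists_of_notMem e he hU := by
    obtain ⟨i, hi, h⟩ := H.exists_of_notMem e he hU
    exact ⟨i, by omega, h⟩
  h_edge := H.h_edge
  h_ptr := H.h_ptr
  h_le v hv := (H.h_le v hv).trans (by omega)
  h_queue := H.h_queue

/-- Deleting an edge `e` whose target has been removed. -/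
theorem PeelInv.edge (H : PeelInv N M s t deg queue h ptr qh qt U) {e : ℕ} (hs : s e < N)
    (heM : e < M) (heU : e ∈ U) (hqh : qh ≠ 0) (hcur : queue (qh - 1) = t e) :
    PeelInv N M s t (Function.update deg (s e) (deg (s e) - 1))
      (if deg (s e) - 1 = 0 then Function.update queue qt (s e) else queue)
      (if h (s e) < h (t e) + 1 then Function.update h (s e) (h (t e) + 1) else h)
      (if h (s e) < h (t e) + 1 then Function.update ptr (s e) (t e) else ptr)
      qh (if deg (s e) - 1 = 0 then qt + 1 else qt) (U.erase e) := by
  have hqt := H.qh_le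
  have hcard : (U.filter fun x => s x = s e).card ≠ 0 :=
    Finset.card_ne_zero.2 ⟨e, by simp [heU]⟩
  have hdeg : deg (s e) ≠ 0 := by rw [H.deg_eq _ hs]; exact hcard
  have hnq : ∀ i < qt, queue i ≠ s e := fun i hi hh => hdeg ((H.deg_eq_zero _ hs).2 ⟨i, hi, hh⟩)
  have hne : t e ≠ s e := fun h => hnq (qh - 1) (by omega) (hcur.trans h)
  have htdone : ∀ x < M, x ∉ U → t x ≠ s e := by
    intro x hx hxU hh
    obtain ⟨i, hi, h'⟩ := H.exists_of_notMem x hx hxU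
    exact hnq i (by omega) (h'.trans hh)
  -- the new values of `h`
  set h' := (if h (s e) < h (t e) + 1 then Function.update h (s e) (h (t e) + 1) else h) with hh'
  have h'u : h' (s e) = max (h (s e)) (h (t e) + 1) := by
    rw [hh']; split <;> simp <;> omega
  have h'v : ∀ v, v ≠ s e → h' v = h v := by
    intro v hv
    rw [hh']; split <;> simp [hv]
  set q' := (if deg (s e) - 1 = 0 then Function.update queue qt (s e) else queue) with hq'
  set qt' := (if deg (s e) - 1 = 0 then qt + 1 else qt) with hqt'
  have q'_old : ∀ i < qt, q' i = queue i := by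
    intro i hi
    rw [hq']; split
    · exact Function.update_of_ne (by omega) _ _
    · rfl
  have qt'_cases : ∀ i < qt', i < qt ∨ (i = qt ∧ deg (s e) - 1 = 0 ∧ q' i = s e) := by
    intro i hi
    rw [hqt'] at hi
    split at hi
    · rename_i hz
      rcases Nat.lt_succ_iff_lt_or_eq.1 hi with h1 | rfl
      · exact .inl h1
      · exact .inr ⟨rfl, hz, by rw [hq', if_pos hz]; simp⟩
    · exact .inl hi
  have hqt_le : qt ≤ qt' := by rw [hqt']; split <;> omega
  have hcurle : h (t e) + 1 ≤ qh := by
    have := H.h_queue (qh - 1) (by omega)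
    rw [hcur] at this
    omega
  refine ⟨by omega, ?_, ?_, ?_, ?_, ?_, ?_, ?_, ?_, ?_⟩
  · intro i hi
    rcases qt'_cases i hi with h1 | ⟨rfl, -, h1⟩
    · rw [q'_old i h1]; exact H.queue_lt i h1
    · rw [h1]; exact hs
  · intro i hi j hj hij
    rcases qt'_cases i hi with h1 | ⟨rfl, -, h1⟩ <;> rcases qt'_cases j hj with h2 | ⟨h3, -, h2⟩
    · rw [q'_old i h1, q'_old j h2] at hij
      exact H.queue_inj i h1 j h2 hij
    · rw [q'_old i h1, h2] at hij
      exact absurd hij (hnq i h1)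
    · rw [q'_old j h2, h1] at hij
      exact absurd hij.symm (hnq j h2)
    · exact h3.symm
  · intro v hv
    by_cases hvs : v = s e
    · subst hvs
      rw [Function.update_self]
      constructor
      · intro hz
        refine ⟨qt, ?_, ?_⟩
        · rw [hqt', if_pos hz]; omega
        · rw [hq', if_pos hz]; simp
      · rintro ⟨i, hi, hiv⟩
        rcases qt'_cases i hi with h1 | ⟨-, h1, -⟩
        · rw [q'_old i h1] at hiv
          exact absurd hiv (hnq i h1)
        · exact h1
    · rw [Function.update_of_ne hvs, H.deg_eq_zero v hv]
      constructor
      · rintro ⟨i, hi, rfl⟩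
        exact ⟨i, by omega, q'_old i hi⟩
      · rintro ⟨i, hi, rfl⟩
        rcases qt'_cases i hi with h1 | ⟨-, -, h1⟩
        · exact ⟨i, h1, (q'_old i h1).symm⟩
        · exact absurd h1 hvs
  · intro v hv
    rw [Finset.filter_erase]
    by_cases hvs : v = s e
    · subst hvs
      rw [Function.update_self, Finset.card_erase_of_mem (by simp [heU]), ← H.deg_eq _ hs]
    · rw [Function.update_of_ne hvs, H.deg_eq v hv, Finset.erase_eq_of_notMem]
      simp only [Finset.mem_filter, not_and]
      exact fun _ hh => hvs hh.symm
  · intro x hx hxU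
    by_cases hxe : x = e
    · subst hxe
      exact ⟨qh - 1, by omega, by rw [q'_old _ (by omega)]; exact hcur⟩
    · obtain ⟨i, hi, hiv⟩ := H.exists_of_notMem x hx (fun h => hxU (Finset.mem_erase.2 ⟨hxe, h⟩))
      exact ⟨i, hi, by rw [q'_old _ (by omega)]; exact hiv⟩
  · intro x hx hxU
    by_cases hxe : x = e
    · subst hxe
      rw [h'u, h'v _ hne]
      omega
    · have hxU' : x ∉ U := fun h => hxU (Finset.mem_erase.2 ⟨hxe, h⟩)
      rw [h'v _ (htdone x hx hxU')]
      have := H.h_edge x hx hxU'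
      by_cases hxs : s x = s e
      · rw [hxs, h'u]; rw [hxs] at this; omega
      · rw [h'v _ hxs]; exact this
  · intro v hv hv0
    by_cases hvs : v = s e
    · subst hvs
      by_cases hlt : h (s e) < h (t e) + 1
      · refine ⟨e, heM, by simp, rfl, by simp [hlt], ?_⟩
        rw [if_pos hlt, Function.update_self, h'v _ hne, h'u]
        omega
      · have h1 : h' (s e) = h (s e) := by rw [h'u]; omega
        rw [h1] at hv0
        obtain ⟨x, hx, hxU, hxs, hxt, hxh⟩ := H.h_ptr _ hs hv0
        refine ⟨x, hx, fun h => hxU (Finset.mem_of_mem_erase h), hxs,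
          by rw [if_neg hlt]; exact hxt, ?_⟩
        rw [if_neg hlt, h1, h'v _ (hxt ▸ htdone x hx hxU)]
        exact hxh
    · rw [h'v v hvs] at hv0 ⊢
      obtain ⟨x, hx, hxU, hxs, hxt, hxh⟩ := H.h_ptr _ hv hv0
      have hp : (if h (s e) < h (t e) + 1 then Function.update ptr (s e) (t e) else ptr) v
          = ptr v := by
        split
        · exact Function.update_of_ne hvs _ _
        · rfl
      rw [hp]
      refine ⟨x, hx, fun h => hxU (Finset.mem_of_mem_erase h), hxs, hxt, ?_⟩
      rw [h'v _ (hxt ▸ htdone x hx hxU)]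
      exact hxh
  · intro v hv
    have := H.h_le v hv
    by_cases hvs : v = s e
    · subst hvs; rw [h'u]; omega
    · rw [h'v v hvs]; exact this
  · intro i hi
    rcases qt'_cases i hi with h1 | ⟨rfl, -, h1⟩
    · rw [q'_old i h1, h'v _ (hnq i h1)]
      exact H.h_queue i h1
    · rw [h1, h'u]
      have := H.h_le _ hs
      omega

theorem PeelInv.spec {p : ℕ} (hp : p = 0) (hq : qh = qt) (ht : ∀ e < M, t e < N)
    (hst : ∀ e < M, s e < N)
    (H : PeelInv N M s t deg queue h ptr qh qt (undone M t queue qh p)) :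
    PeelSpec N M s t deg h ptr := by
  subst hp hq
  have hU : ∀ e < M, e ∈ undone M t queue qh 0 ↔ deg (t e) ≠ 0 := by
    intro e he
    rw [mem_undone, Ne, H.deg_eq_zero _ (ht e he)]
    simp [he]
  refine ⟨?_, ?_, ?_, fun v hv => (H.h_le v hv).trans H.qt_le⟩
  · intro v hv hd
    rw [H.deg_eq v hv] at hd
    obtain ⟨e, he⟩ := Finset.card_ne_zero.1 hd
    rw [Finset.mem_filter] at he
    have heM := (mem_undone.1 he.1).1
    exact ⟨e, heM, he.2, (hU e heM).1 he.1⟩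
  · intro e he hd
    have hn : e ∉ undone M t queue qh 0 := by
      intro hm
      rw [H.deg_eq _ (hst e he), Finset.card_eq_zero] at hd
      have : e ∈ (undone M t queue qh 0).filter fun x => s x = s e := by simp [hm]
      simp [hd] at this
    refine ⟨?_, H.h_edge e he hn⟩
    by_contra h
    exact hn ((hU e he).2 h)
  · intro v hv h0
    obtain ⟨e, he, -, h⟩ := H.h_ptr v hv h0
    exact ⟨e, he, h⟩

theorem undone_pop :
    undone M t queue (qh + 1) (lastIn t (queue qh) M) = undone M t queue qh 0 := by
  ext e
  simp only [mem_undone]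
  refine and_congr_right fun he => not_congr ⟨?_, ?_⟩
  · rintro ⟨i, hi, h1, h2⟩
    rcases Nat.lt_succ_iff_lt_or_eq.1 hi with h3 | rfl
    · exact ⟨i, h3, h1, fun _ => Nat.zero_le _⟩
    · exact absurd h1.symm (ne_of_lastIn_le (h2 rfl) he)
  · rintro ⟨i, hi, h1, -⟩
    exact ⟨i, by omega, h1, by omega⟩

theorem undone_edge {p : ℕ} {queue' : ℕ → ℕ} (hp : p ≠ 0) (hpM : p ≤ M) (hqh : qh ≠ 0)
    (hinj : ∀ i < qh, queue i = queue (qh - 1) → i = qh - 1)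
    (hcur : queue (qh - 1) = t (p - 1)) (hq : ∀ i < qh, queue' i = queue i) :
    undone M t queue' qh (lastIn t (t (p - 1)) (p - 1)) = (undone M t queue qh p).erase (p - 1) ∧
      p - 1 ∈ undone M t queue qh p := by
  constructor
  · ext e
    simp only [mem_undone, Finset.mem_erase]
    constructor
    · rintro ⟨he, h⟩
      refine ⟨?_, he, ?_⟩
      · rintro rfl
        refine h ⟨qh - 1, by omega, by rw [hq _ (by omega)]; exact hcur, fun _ => lastIn_le _ _ _⟩
      · rintro ⟨i, hi, h1, h2⟩
        refine h ⟨i, hi, by rw [hq i hi]; exact h1, fun h3 => ?_⟩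
        have := lastIn_le t (t (p - 1)) (p - 1)
        have := h2 h3
        omega
    · rintro ⟨hne, he, h⟩
      refine ⟨he, ?_⟩
      rintro ⟨i, hi, h1, h2⟩
      rw [hq i hi] at h1
      refine h ⟨i, hi, h1, fun h3 => ?_⟩
      by_contra h4
      have hi' : i = qh - 1 := by omega
      subst hi'
      exact ne_of_lastIn_le (h2 h3) (by omega) (h1.symm.trans hcur)
  · refine mem_undone.2 ⟨by omega, ?_⟩
    rintro ⟨i, hi, h1, h2⟩
    have := hinj i hi (h1.trans hcur.symm)
    have := h2 (by omega)
    omega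

end PeelInv

/-! ### The peeling program -/

open Program Term

infixr:30 " ;; " => Program.seq

/-- The linked lists of the edges by targets (array `b + 1` holds the heads and array `b + 2` the
links), and the numbers of edges by sources (array `b`). -/
def peelBuild (s t b : ℕ) : Program :=
  forLoop 12 11
    (write b (read s (reg 12)) (add (read b (read s (reg 12))) (const 1)) ;;
      write (b + 2) (reg 12) (read (b + 1) (read t (reg 12))) ;;
      write (b + 1) (read t (reg 12)) (add (reg 12) (const 1)))

/-- The vertices that are the source of no edge enter the queue. -/
def peelPush (b : ℕ) : Program :=
  assign 14 (const 0) ;;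
  forLoop 12 10
    (ite (read b (reg 12)) skip
      (write (b + 3) (reg 14) (reg 12) ;; assign 14 (add (reg 14) (const 1))))

/-- Take the next vertex from the queue, in register 17, and the list of the edges into it, in
register 15. -/
def peelPop (b : ℕ) : Program :=
  assign 17 (read (b + 3) (reg 13)) ;;
  assign 15 (read (b + 1) (reg 17)) ;;
  assign 13 (add (reg 13) (const 1))

/-- Remove the next edge into the vertex in register 17. Its source, in register 16, gets the length
of a longest walk so far (array `b + 4`) and the pointer to its next vertex (array `b + 5`), and
enters the queue if this was its last outgoing edge. -/
def peelEdge (s b : ℕ) : Program :=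
  assign 12 (sub (reg 15) (const 1)) ;;
  assign 16 (read s (reg 12)) ;;
  assign 15 (read (b + 2) (reg 12)) ;;
  ite (lt (read (b + 4) (reg 16)) (add (read (b + 4) (reg 17)) (const 1)))
    (write (b + 4) (reg 16) (add (read (b + 4) (reg 17)) (const 1)) ;;
      write (b + 5) (reg 16) (reg 17))
    skip ;;
  write b (reg 16) (sub (read b (reg 16)) (const 1)) ;;
  ite (read b (reg 16)) skip
    (write (b + 3) (reg 14) (reg 16) ;; assign 14 (add (reg 14) (const 1)))

/-- The main loop of the peeling. Register 15 points into the list of the edges into the vertex in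
register 17, which was taken from the queue last; registers 13 and 14 hold the number of vertices
taken from the queue, and its length. -/
def peelMain (s b : ℕ) : Program :=
  assign 13 (const 0) ;;
  assign 15 (const 0) ;;
  loop (add (reg 15) (lt (reg 13) (reg 14))) (ite (reg 15) (peelEdge s b) (peelPop b))

/-- Repeatedly remove a vertex without outgoing edges, in the graph with the edges
`arr s e → arr t e`. The arrays `b, …, b + 5` are used and must be empty. -/
def peel (s t b : ℕ) : Program :=
  peelBuild s t b ;; peelPush b ;; peelMain s b

variable {W S N M s t b : ℕ} {σ : State}

theorem peelBuild_halts (hσ : σ.Bdd W) (hM : σ.reg 11 = M) (hS : M + 1 ≤ S) (hW : M + 2 ≤ W)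
    (hsb : s < b) (htb : t < b) (h0 : ∀ k < 6, σ.arr (b + k) = fun _ => 0) :
    HaltsWithin W S (peelBuild s t b) σ (fun τ =>
      (∀ v, τ.arr b v = ((Finset.range M).filter fun e => σ.arr s e = v).card) ∧
      (∀ v, τ.arr (b + 1) v = lastIn (σ.arr t) v M) ∧
      ∀ e < M, τ.arr (b + 2) e = lastIn (σ.arr t) (σ.arr t e) e) := by
  have := HaltsWithin.forLoop (W := W) (S := S) (i := 12) (n := 11) (σ := σ)
    (P := write b (read s (reg 12)) (add (read b (read s (reg 12))) (const 1)) ;;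
      write (b + 2) (reg 12) (read (b + 1) (read t (reg 12))) ;;
      write (b + 1) (read t (reg 12)) (add (reg 12) (const 1)))
    (fun k τ => (∀ v, τ.arr b v = ((Finset.range k).filter fun e => σ.arr s e = v).card) ∧
      (∀ v, τ.arr (b + 1) v = lastIn (σ.arr t) v k) ∧
      ∀ e < k, τ.arr (b + 2) e = lastIn (σ.arr t) (σ.arr t e) e) hσ (by omega) (by omega)
    (by decide) (by simp [wregs]) (by simp [wregs]) ?_ ?_
  · rw [hM] at this
    exact this
  · have h1 := h0 0 (by omega)
    have h2 := h0 1 (by omega)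
    simp only [add_zero] at h1
    simp [State.setReg, h1, h2, lastIn]
  · rintro k τ hk hτ hf hi ⟨h1, h2, h3⟩
    have es : τ.arr s = σ.arr s := hf.2 s (by simp [warrs]; omega)
    have et : τ.arr t = σ.arr t := hf.2 t (by simp [warrs]; omega)
    have f1 : t ≠ b := by omega
    have f2 : t ≠ b + 2 := by omega
    have hcard : ∀ v, ((Finset.range k).filter fun e => σ.arr s e = v).card ≤ k := fun v =>
      (Finset.card_filter_le _ _).trans (by simp)
    have hcs := hcard (σ.arr s k)
    simp only [Safe, exec, Term.Ok, Term.val, State.setReg, State.setArr, hi, es, et,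
      Function.update_apply, f1, f2, h1]
    simp only [Nat.add_eq_left, Nat.left_eq_add, Nat.add_left_cancel_iff, if_true, if_false,
      true_and]
    simp [Function.update_apply, h1, h2]
    refine ⟨⟨by omega, by omega⟩, ?_, ?_, ?_⟩
    · intro v
      rw [Finset.range_add_one, Finset.filter_insert]
      by_cases hv : σ.arr s k = v
      · rw [if_pos hv.symm, if_pos hv, Finset.card_insert_of_notMem (by simp), hv]
      · rw [if_neg (Ne.symm hv), if_neg hv]
    · intro v
      simp only [lastIn, eq_comm]
    · intro e he
      by_cases hek : e = k
      · simp [hek]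
      · rw [if_neg hek, h3 e (by omega)]

theorem peelPush_halts (hσ : σ.Bdd W) (hN : σ.reg 10 = N) (hS : N + 1 ≤ S) (hW : N + 2 ≤ W) :
    HaltsWithin W S (peelPush b) σ (fun τ => τ.reg 14 ≤ N ∧
      (∀ i < τ.reg 14, τ.arr (b + 3) i < N) ∧
      (∀ i < τ.reg 14, ∀ j < τ.reg 14, τ.arr (b + 3) i = τ.arr (b + 3) j → i = j) ∧
      ∀ v < N, σ.arr b v = 0 ↔ ∃ i < τ.reg 14, τ.arr (b + 3) i = v) := by
  refine HaltsWithin.seq (Q := fun τ => τ = σ.setReg 14 0) hσ (.of_safe (by omega) hσ ?_ rfl) ?_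
  · simp only [Safe, Term.Ok]; omega
  rintro _ hτ - rfl
  have := HaltsWithin.forLoop (W := W) (S := S) (i := 12) (n := 10) (σ := σ.setReg 14 0)
    (P := ite (read b (reg 12)) skip
      (write (b + 3) (reg 14) (reg 12) ;; assign 14 (add (reg 14) (const 1))))
    (fun k τ => τ.reg 14 ≤ k ∧
      (∀ i < τ.reg 14, τ.arr (b + 3) i < k) ∧
      (∀ i < τ.reg 14, ∀ j < τ.reg 14, τ.arr (b + 3) i = τ.arr (b + 3) j → i = j) ∧
      ∀ v < k, σ.arr b v = 0 ↔ ∃ i < τ.reg 14, τ.arr (b + 3) i = v) hτ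
    (by simp [State.setReg]; omega) (by omega) (by decide) (by simp [wregs]) (by simp [wregs]) ?_ ?_
  · have e : (σ.setReg 14 0).reg 10 = N := by simp [State.setReg, hN]
    rw [e] at this
    exact this
  · simp [State.setReg]
  · rintro k τ hk hτ hf hi ⟨h1, h2, h3, h4⟩
    have hk' : k < N := by simpa [State.setReg, hN] using hk
    have eb : τ.arr b = σ.arr b := hf.2 b (by simp [warrs])
    by_cases hz : σ.arr b k = 0
    · simp [Safe, exec, Term.Ok, Term.val, State.setReg, State.setArr, hi, eb, hz]
      refine ⟨by omega, by omega, ?_, ?_, ?_⟩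
      · intro i hi
        rw [Function.update_apply]
        split
        · omega
        · have := h2 i (by omega)
          omega
      · intro i hi j hj hij
        simp only [Function.update_apply] at hij
        split at hij <;> split at hij
        · omega
        · have := h2 j (by omega)
          omega
        · have := h2 i (by omega)
          omega
        · exact h3 i (by omega) j (by omega) hij
      · intro v hv
        by_cases hvk : v = k
        · subst hvk
          exact iff_of_true hz ⟨τ.reg 14, by omega, by simp⟩
        · rw [h4 v (by omega)]
          constructor
          · rintro ⟨i, hi, hiv⟩
            exact ⟨i, by omega, by rw [Function.update_of_ne (by omega)]; exact hiv⟩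
          · rintro ⟨i, hi, hiv⟩
            rw [Function.update_apply] at hiv
            split at hiv
            · omega
            · exact ⟨i, by omega, hiv⟩
    · simp [Safe, exec, Term.Ok, Term.val, State.setReg, State.setArr, hi, eb, hz]
      refine ⟨by omega, fun i hi => (h2 i hi).le, h3, ?_⟩
      intro v hv
      by_cases hvk : v = k
      · subst hvk
        refine iff_of_false hz ?_
        rintro ⟨i, hi, hiv⟩
        have := h2 i hi
        omega
      · exact h4 v (by omega)

theorem peelMain_halts (hσ : σ.Bdd W) (hS : N + M + 1 ≤ S) (hW : N + M + 3 ≤ W)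
    (hsb : s < b) {t : ℕ → ℕ} (hs : ∀ e < M, σ.arr s e < N) (ht : ∀ e < M, t e < N)
    (hhead : ∀ v, σ.arr (b + 1) v = lastIn t v M)
    (hnext : ∀ e < M, σ.arr (b + 2) e = lastIn t (t e) e)
    (hinv : PeelInv N M (σ.arr s) t (σ.arr b) (σ.arr (b + 3)) (σ.arr (b + 4)) (σ.arr (b + 5)) 0
      (σ.reg 14) (Finset.range M)) :
    HaltsWithin W S (peelMain s b) σ (fun τ =>
      PeelSpec N M (σ.arr s) t (τ.arr b) (τ.arr (b + 4)) (τ.arr (b + 5))) := by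
  refine HaltsWithin.seq (Q := fun τ => τ = σ.setReg 13 0) hσ (.of_safe (by omega) hσ ?_ rfl) ?_
  · simp only [Safe, Term.Ok]; omega
  rintro _ hτ - rfl
  refine HaltsWithin.seq (Q := fun τ => τ = (σ.setReg 13 0).setReg 15 0) hτ
    (.of_safe (by omega) hτ ?_ rfl) ?_
  · simp only [Safe, Term.Ok]; omega
  clear hτ
  rintro _ hτ - rfl
  have hU0 : undone M t (σ.arr (b + 3)) 0 0 = Finset.range M := by
    ext e; simp [mem_undone]
  refine (HaltsWithin.loop (fun τ => τ.reg 15 ≤ M ∧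
      (τ.reg 15 ≠ 0 → τ.reg 13 ≠ 0 ∧ τ.arr (b + 3) (τ.reg 13 - 1) = t (τ.reg 15 - 1) ∧
        τ.reg 17 = t (τ.reg 15 - 1)) ∧
      PeelInv N M (σ.arr s) t (τ.arr b) (τ.arr (b + 3)) (τ.arr (b + 4)) (τ.arr (b + 5))
        (τ.reg 13) (τ.reg 14) (undone M t (τ.arr (b + 3)) (τ.reg 13) (τ.reg 15)))
    (fun τ => (undone M t (τ.arr (b + 3)) (τ.reg 13) (τ.reg 15)).card + (N - τ.reg 13))
    hτ ?_ (by omega) ?_ ?_).mono hτ ?_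
  · simp [State.setReg, hU0, hinv]
  · simp [State.setReg, hU0]; omega
  · rintro τ hτ' hf ⟨hp, hcur, H⟩
    have es : τ.arr s = σ.arr s := hf.2 s (by simp [warrs, peelEdge, peelPop]; omega)
    have e1 : τ.arr (b + 1) = σ.arr (b + 1) := hf.2 _ (by simp [warrs, peelEdge, peelPop])
    have e2 : τ.arr (b + 2) = σ.arr (b + 2) := hf.2 _ (by simp [warrs, peelEdge, peelPop])
    have hqt := H.qt_le
    have hqh := H.qh_le
    refine ⟨⟨trivial, ⟨trivial, trivial, by omega⟩, ?_⟩, fun he => ?_⟩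
    · by_cases hlt : τ.reg 13 < τ.reg 14 <;> simp [Term.val, hlt] <;> omega
    by_cases hp0 : τ.reg 15 = 0
    · have hlt : τ.reg 13 < τ.reg 14 := by
        by_contra h
        simp [Term.val, hp0, h] at he
      rw [hp0] at H
      have hpop := H.pop hlt
      rw [← undone_pop] at hpop
      have hx : (ite (reg 15) (peelEdge s b) (peelPop b)).exec τ =
          ((τ.setReg 17 (τ.arr (b + 3) (τ.reg 13))).setReg 15
            (lastIn t (τ.arr (b + 3) (τ.reg 13)) M)).setReg 13 (τ.reg 13 + 1) := by
        simp [exec, Term.val, hp0, peelPop, State.setReg, e1, hhead]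
      rw [hx]
      refine ⟨?_, ?_⟩
      · simp [Safe, exec, Term.Ok, Term.val, hp0, peelPop, State.setReg]
        omega
      simp only [State.setReg, Function.update_apply]
      simp [undone_pop, hp0]
      refine ⟨⟨lastIn_le _ _ _, ?_, ?_⟩, by omega⟩
      · intro h
        exact (lastIn_eq h).symm
      · rwa [undone_pop] at hpop
    · obtain ⟨hqh0, hc1, hc2⟩ := hcur hp0
      have heM : τ.reg 15 - 1 < M := by omega
      have htN := ht _ heM
      have hsN := hs _ heM
      have hU := undone_edge (queue' := if τ.arr b (σ.arr s (τ.reg 15 - 1)) - 1 = 0 then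
          Function.update (τ.arr (b + 3)) (τ.reg 14) (σ.arr s (τ.reg 15 - 1)) else τ.arr (b + 3))
        hp0 hp hqh0 (fun i hi hh => H.queue_inj i (by omega) _ (by omega) hh) hc1
        (by
          intro i hi
          split
          · exact Function.update_of_ne (by omega) _ _
          · rfl)
      have hnew := H.edge hsN heM hU.2 hqh0 hc1
      rw [← hU.1] at hnew
      have hcard := Finset.card_erase_lt_of_mem hU.2
      rw [← hU.1] at hcard
      have hnx := hnext _ heM
      have hhle := (H.h_le _ htN).trans (hqh.trans hqt)
      have f1 : s ≠ b := by omega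
      have f2 : s ≠ b + 3 := by omega
      have f3 : s ≠ b + 4 := by omega
      have f4 : s ≠ b + 5 := by omega
      have hle := lastIn_le t (t (τ.reg 15 - 1)) (τ.reg 15 - 1)
      have hlt' : τ.reg 14 < N ∨ τ.arr b (σ.arr s (τ.reg 15 - 1)) - 1 ≠ 0 := by
        by_contra! hcon
        have := hnew.qt_le
        rw [if_pos hcon.2] at this
        omega
      have hcur' : ∀ q' : ℕ → ℕ, (∀ i < τ.reg 13, q' i = τ.arr (b + 3) i) →
          lastIn t (t (τ.reg 15 - 1)) (τ.reg 15 - 1) ≠ 0 →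
          q' (τ.reg 13 - 1) = t (lastIn t (t (τ.reg 15 - 1)) (τ.reg 15 - 1) - 1) := by
        intro q' hq' h
        rw [hq' _ (by omega), hc1, lastIn_eq h]
      by_cases hh : τ.arr (b + 4) (σ.arr s (τ.reg 15 - 1)) < τ.arr (b + 4) (t (τ.reg 15 - 1)) + 1
        <;> by_cases hd : τ.arr b (σ.arr s (τ.reg 15 - 1)) - 1 = 0
      all_goals
        simp only [hh, hd, if_true, if_false] at hnew hcard
        simp [Safe, exec, Term.Ok, Term.val, hp0, peelEdge, State.setReg, State.setArr, es, e2,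
          hnx, hc2, hh, hd]
        try simp only [Nat.add_eq_left, Nat.left_eq_add, if_false, hd]
        refine ⟨?_, ⟨?_, ?_, ?_⟩, ?_⟩
        · omega
        · omega
        · intro h
          refine ⟨hqh0, hcur' _ ?_ h, (lastIn_eq h).symm⟩
          intro i hi
          first
          | rfl
          | exact Function.update_of_ne (by omega) _ _
        · convert hnew using 1
        · exact hcard
  · rintro τ hτ' hf ⟨⟨hp, hcur, H⟩, he⟩
    have hqh := H.qh_le
    have hq : τ.reg 13 = τ.reg 14 := by
      by_contra h
      have : τ.reg 13 < τ.reg 14 := by omega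
      simp [Term.val, this] at he
    have hp0 : τ.reg 15 = 0 := by
      simp [Term.val] at he; omega
    exact H.spec hp0 hq ht hs

theorem peel_halts (hσ : σ.Bdd W) (hN : σ.reg 10 = N) (hM : σ.reg 11 = M) (hS : N + M + 1 ≤ S)
    (hW : N + M + 3 ≤ W) (hsb : s < b) (htb : t < b) (hs : ∀ e < M, σ.arr s e < N)
    (ht : ∀ e < M, σ.arr t e < N) (h0 : ∀ k < 6, σ.arr (b + k) = fun _ => 0) :
    HaltsWithin W S (peel s t b) σ (fun τ =>
      PeelSpec N M (σ.arr s) (σ.arr t) (τ.arr b) (τ.arr (b + 4)) (τ.arr (b + 5))) := by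
  refine HaltsWithin.seq hσ (peelBuild_halts hσ hM (by omega) (by omega) hsb htb h0) ?_
  rintro σ₁ hσ₁ hf₁ ⟨hd, hh, hn⟩
  have e₁ : σ₁.reg 10 = N := by rw [hf₁.1 10 (by simp [peelBuild, forLoop, wregs]), hN]
  have es₁ : σ₁.arr s = σ.arr s :=
    hf₁.2 s (by simp [peelBuild, forLoop, warrs]; omega)
  have e3₁ : ∀ k, 3 ≤ k → σ₁.arr (b + k) = σ.arr (b + k) := fun k hk =>
    hf₁.2 _ (by simp [peelBuild, forLoop, warrs]; omega)
  refine HaltsWithin.seq hσ₁ (peelPush_halts (b := b) hσ₁ e₁ (by omega) (by omega)) ?_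
  rintro σ₂ hσ₂ hf₂ ⟨hqt, hqlt, hinj, hz⟩
  have hfa : ∀ a, a ≠ b + 3 → σ₂.arr a = σ₁.arr a := fun a ha =>
    hf₂.2 a (by simpa [peelPush, forLoop, warrs] using ha)
  have es₂ : σ₂.arr s = σ.arr s := (hfa s (by omega)).trans es₁
  have e4 : ∀ k, 4 ≤ k → k < 6 → σ₂.arr (b + k) = fun _ => 0 := fun k h1 h2 => by
    rw [hfa _ (by omega), e3₁ k (by omega), h0 k h2]
  rw [← es₂]
  refine peelMain_halts hσ₂ hS hW hsb (by rwa [es₂]) ht ?_ ?_ ?_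
  · rw [hfa _ (by omega)]; exact hh
  · rw [hfa _ (by omega)]; exact hn
  · rw [e4 4 (by omega) (by omega), e4 5 (by omega) (by omega), hfa b (by omega), es₂]
    refine ⟨Nat.zero_le _, hqlt, hinj, hz, fun v _ => hd v, ?_, ?_, ?_, ?_, ?_⟩
    · intro e he h
      exact absurd (Finset.mem_range.2 he) h
    · intro e he h
      exact absurd (Finset.mem_range.2 he) h
    · intro v _ h
      exact absurd rfl h
    · exact fun _ _ => le_rfl
    · exact fun _ _ => Nat.zero_le _

end WordRAM

/-! ### From peelings and pointers to outcomes of the algorithm -/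

namespace LabeledDigraph

variable {V A : Type*} {G : LabeledDigraph V A}

theorem isWalk_map_range {y : ℕ → V} {n : ℕ} (h : ∀ j, j + 1 < n → G.Adj (y j) (y (j + 1))) :
    G.IsWalk ((List.range n).map y) := by
  unfold IsWalk
  rw [List.isChain_iff_getElem]
  intro i hi
  simpa using h i (by simpa using hi)

theorem isPathFromTo_map_range {y : ℕ → V} {m : ℕ} (h : ∀ j < m, G.Adj (y j) (y (j + 1)))
    (hinj : ∀ i ≤ m, ∀ j ≤ m, y i = y j → i = j) :
    G.IsPathFromTo ((List.range (m + 1)).map y) (y 0) (y m) := by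
  refine ⟨isWalk_map_range fun j hj => h j (by omega), ?_, ?_, ?_⟩
  · refine List.Nodup.map_on ?_ List.nodup_range
    intro i hi j hj hij
    rw [List.mem_range] at hi hj
    exact hinj i (by omega) j (by omega) hij
  · simp [List.range_succ_eq_map]
  · simp [List.range_succ]

theorem isCycleAt_map_range {y : ℕ → V} {m : ℕ} (h : ∀ j < m, G.Adj (y j) (y (j + 1)))
    (hinj : ∀ i ≤ m, ∀ j ≤ m, y i = y j → i = j) (hc : G.Adj (y m) (y 0)) :
    G.IsCycleAt ((List.range (m + 1)).map y) (y 0) :=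
  ⟨y m, isPathFromTo_map_range h hinj, hc⟩

/-- A walk off the diagonal that returns to itself gives an outcome of the first phase. -/
theorem output_infinite_of_lasso {y : ℕ → G.SelfVertex} {i k : ℕ}
    (h : ∀ j < k, G.self.Adj (y j) (y (j + 1))) (hinj : ∀ a < k, ∀ b < k, y a = y b → a = b)
    (hik : i < k) (hy : y i = y k) (h0 : y 0 ∈ G.Vdiff) :
    G.AlgorithmOutput (.infinite ((List.range i).map fun j => G.self.label (y j))
      ((List.range (k - i)).map fun j => G.self.label (y (i + j)))) := by
  have hp := isPathFromTo_map_range (G := G.self) (y := y) (m := i) (fun j hj => h j (by omega))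
    (fun a ha b hb => hinj a (by omega) b (by omega))
  have hc := isCycleAt_map_range (G := G.self) (y := fun j => y (i + j)) (m := k - i - 1)
    (fun j hj => h (i + j) (by omega))
    (fun a ha b hb hab => by have := hinj _ (by omega) _ (by omega) hab; omega)
    (by
      have := h (i + (k - i - 1)) (by omega)
      rw [show i + (k - i - 1) + 1 = k by omega, ← hy] at this
      exact this)
  rw [show k - i - 1 + 1 = k - i by omega] at hc
  have := AlgorithmOutput.infinite (y 0) (y i) _ _ h0 hc.mem_cyclicVertices hp hc
  rw [List.range_succ, List.map_append, List.map_singleton, List.dropLast_concat, List.map_map,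
    List.map_map] at this
  exact this

/-- A backward walk that returns to itself, from a vertex where an edge leaves the diagonal, gives
an outcome of the second phase. -/
theorem output_unbounded_of_lasso {y : ℕ → G.SelfVertex} {r : G.SelfVertex} {i k : ℕ}
    (h1 : ¬ G.PhaseOne)
    (h : ∀ j < k, G.self.Adj (y (j + 1)) (y j)) (hinj : ∀ a < k, ∀ b < k, y a = y b → a = b)
    (hik : i < k) (hy : y i = y k) (h0 : y 0 ∉ G.Vdiff) (hr : r ∈ G.Vdiff)
    (hadj : G.self.Adj (y 0) r) :
    G.AlgorithmOutput (.unbounded ((List.range (k - i)).map fun j => G.self.label (y (k - 1 - j)))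
      (((List.range k).map fun j => G.self.label (y (k - 1 - j))) ++ [G.self.label r])) := by
  have hadj' : ∀ j < k - 1, G.self.Adj (y (k - 1 - j)) (y (k - 1 - (j + 1))) := by
    intro j hj
    have := h (k - 1 - (j + 1)) (by omega)
    rwa [show k - 1 - (j + 1) + 1 = k - 1 - j by omega] at this
  have hinj' : ∀ a ≤ k - 1, ∀ b ≤ k - 1, y (k - 1 - a) = y (k - 1 - b) → a = b := by
    intro a ha b hb hab
    have := hinj _ (by omega) _ (by omega) hab
    omega
  have hp := isPathFromTo_map_range (G := G.self) (y := fun j => y (k - 1 - j)) (m := k - 1)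
    hadj' hinj'
  have hc := isCycleAt_map_range (G := G.self) (y := fun j => y (k - 1 - j)) (m := k - 1 - i)
    (fun j hj => hadj' j (by omega)) (fun a ha b hb => hinj' a (by omega) b (by omega))
    (by
      have := h (k - 1) (by omega)
      rw [show k - 1 + 1 = k by omega, ← hy] at this
      rw [show k - 1 - (k - 1 - i) = i by omega]
      exact this)
  rw [show k - 1 - i + 1 = k - i by omega] at hc
  rw [show k - 1 + 1 = k by omega] at hp
  simp only [Nat.sub_zero, Nat.sub_self] at hp hc
  have hcyc := hc.mem_cyclicVertices
  obtain ⟨u, hu⟩ := eq_diag_of_notMem_Vdiff (q := y (k - 1))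
    fun hd => h1 ⟨_, hd, _, hcyc, .refl⟩
  obtain ⟨v, hv⟩ := eq_diag_of_notMem_Vdiff h0
  rw [hu] at hp hc hcyc
  rw [hv] at hp hadj
  have hx := hasTwin_of_adj hadj hr
  have := AlgorithmOutput.unbounded u v r.1.1 _ _ h1 hcyc ⟨v, _, rfl, hx⟩ hx hp hc
  rw [List.map_map, List.map_map] at this
  exact this

/-- A longest walk through a vertex off the diagonal gives an outcome of the third phase. -/
theorem output_finite_of_walk {y : ℕ → G.SelfVertex} {n : ℕ} (h1 : ¬ G.PhaseOne)
    (h2 : ¬ G.PhaseTwo) (h : ∀ j, j + 1 < n → G.self.Adj (y j) (y (j + 1)))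
    (hd : ∃ j < n, y j ∈ G.Vdiff) (hmax : ∀ p, G.IsDagPath p → p.length ≤ n) :
    G.AlgorithmOutput (.finite ((List.range n).map fun j => G.self.label (y j))) := by
  have hw := isWalk_map_range (G := G.self) h
  have hd' : ∃ q ∈ (List.range n).map y, q ∈ G.Vdiff := by
    obtain ⟨j, hj, h⟩ := hd
    exact ⟨y j, List.mem_map.2 ⟨j, List.mem_range.2 hj, rfl⟩, h⟩
  have hnot := notMem_Vcyc_of_walk h1 h2 hw hd'
  have := AlgorithmOutput.finite _ h1 h2 ⟨hw, hw.nodup hnot, hnot, hd'⟩ (by simpa using hmax)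
  rw [List.map_map] at this
  exact this

end LabeledDigraph

namespace WordRAM

/-- The numbers `0, …, N - 1` and the pairs `s e, t e` for `e < M` stand for the elements of a type
and a relation. -/
structure EncodesRel {Q : Type*} (adj : Q → Q → Prop) (N M : ℕ) (s t : ℕ → ℕ) (enc : Q → ℕ) :
    Prop where
  inj : enc.Injective
  lt : ∀ q, enc q < N
  surj : ∀ i < N, ∃ q, enc q = i
  s_lt : ∀ e < M, s e < N
  t_lt : ∀ e < M, t e < N
  adj_iff : ∀ q r, adj q r ↔ ∃ e < M, s e = enc q ∧ t e = enc r

section EncodesRel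

variable {Q : Type*} {adj : Q → Q → Prop} {N M : ℕ} {s t deg h ptr : ℕ → ℕ} {enc : Q → ℕ}

theorem EncodesRel.swap (E : EncodesRel adj N M s t enc) :
    EncodesRel (fun q r => adj r q) N M t s enc :=
  ⟨E.inj, E.lt, E.surj, E.t_lt, E.s_lt, fun q r => by
    rw [E.adj_iff]
    exact exists_congr fun e => and_congr_right fun _ => and_comm⟩

theorem EncodesRel.adj_of_lt (E : EncodesRel adj N M s t enc) {e : ℕ} {q r : Q} (he : e < M)
    (hs : s e = enc q) (ht : t e = enc r) : adj q r :=
  (E.adj_iff q r).2 ⟨e, he, hs, ht⟩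

theorem PeelSpec.exists_adj (H : PeelSpec N M s t deg h ptr) (E : EncodesRel adj N M s t enc)
    {q : Q} (hq : deg (enc q) ≠ 0) : ∃ r, adj q r ∧ deg (enc r) ≠ 0 := by
  obtain ⟨e, he, hs, ht⟩ := H.stay _ (E.lt q) hq
  obtain ⟨r, hr⟩ := E.surj _ (E.t_lt e he)
  exact ⟨r, E.adj_of_lt he hs hr.symm, by rwa [hr]⟩

theorem PeelSpec.of_adj (H : PeelSpec N M s t deg h ptr) (E : EncodesRel adj N M s t enc)
    {q r : Q} (hq : deg (enc q) = 0) (hqr : adj q r) :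
    deg (enc r) = 0 ∧ h (enc r) + 1 ≤ h (enc q) := by
  obtain ⟨e, he, hs, ht⟩ := (E.adj_iff q r).1 hqr
  have := H.gone e he (by rwa [hs])
  rwa [hs, ht] at this

theorem PeelSpec.of_transGen (H : PeelSpec N M s t deg h ptr) (E : EncodesRel adj N M s t enc)
    {q r : Q} (hq : deg (enc q) = 0) (hqr : Relation.TransGen adj q r) :
    deg (enc r) = 0 ∧ h (enc r) + 1 ≤ h (enc q) := by
  induction hqr with
  | single h => exact H.of_adj E hq h
  | tail _ h ih =>
    have := H.of_adj E ih.1 h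
    exact ⟨this.1, by omega⟩

/-- A vertex on a cycle is not removed, nor is a vertex that reaches it. -/
theorem PeelSpec.ne_zero_of_reaches (H : PeelSpec N M s t deg h ptr)
    (E : EncodesRel adj N M s t enc) {q r : Q} (hqr : Relation.ReflTransGen adj q r)
    (hr : Relation.TransGen adj r r) : deg (enc q) ≠ 0 := by
  intro hq
  have hr0 : deg (enc r) = 0 := by
    rcases Relation.reflTransGen_iff_eq_or_transGen.1 hqr with rfl | h
    · exact hq
    · exact (H.of_transGen E hq h).1
  have := (H.of_transGen E hr0 hr).2
  omega

theorem PeelSpec.length_le (H : PeelSpec N M s t deg h ptr) (E : EncodesRel adj N M s t enc)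
    {l : List Q} {q : Q} (hq : deg (enc q) = 0) (hl : (q :: l).IsChain adj) :
    l.length ≤ h (enc q) := by
  induction l generalizing q with
  | nil => exact Nat.zero_le _
  | cons r l ih =>
    rw [List.isChain_cons_cons] at hl
    have h1 := H.of_adj E hq hl.1
    have h2 := ih h1.1 hl.2
    simp only [List.length_cons]
    omega

/-- The pointers lead along a longest walk. -/
theorem PeelSpec.iterate_ptr (H : PeelSpec N M s t deg h ptr) (E : EncodesRel adj N M s t enc)
    (q : Q) : ∀ j ≤ h (enc q), ptr^[j] (enc q) < N ∧ h (ptr^[j] (enc q)) + j = h (enc q) ∧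
      (j < h (enc q) → ∃ e < M, s e = ptr^[j] (enc q) ∧ t e = ptr^[j + 1] (enc q)) := by
  have step : ∀ i < N, h i ≠ 0 → ∃ e < M, s e = i ∧ t e = ptr i ∧ h (ptr i) + 1 = h i :=
    fun i hi h0 => H.h_ptr i hi h0
  intro j
  induction j with
  | zero =>
    intro _
    refine ⟨E.lt q, rfl, fun h0 => ?_⟩
    obtain ⟨e, he, hs, ht, -⟩ := step _ (E.lt q) (by omega)
    exact ⟨e, he, hs, ht⟩
  | succ j ih =>
    intro hj
    obtain ⟨h1, h2, -⟩ := ih (by omega)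
    obtain ⟨e, he, -, ht, hh⟩ := step _ h1 (by omega)
    rw [Function.iterate_succ_apply']
    have h3 : ptr (ptr^[j] (enc q)) < N := ht ▸ E.t_lt e he
    refine ⟨h3, by omega, fun hj' => ?_⟩
    obtain ⟨e', he', hs', ht', -⟩ := step _ h3 (by omega)
    refine ⟨e', he', hs', ?_⟩
    rw [ht', Function.iterate_succ_apply', Function.iterate_succ_apply']

end EncodesRel

/-- The numbers `0, …, N - 1` stand for the vertices of `G ⊗ G`, `lab` for their labels, `c₁` and
`c₂` for their components, and the pairs `s e, t e` for `e < M` for the edges. The numbers `c₁ i`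
and `c₂ i` need not be the components themselves, they only have to tell whether these agree. -/
structure Encodes {V : Type*} (G : LabeledDigraph V ℕ) (N M : ℕ) (lab s t c₁ c₂ : ℕ → ℕ)
    (enc : G.SelfVertex → ℕ) : Prop extends EncodesRel G.self.Adj N M s t enc where
  lab_enc : ∀ q, lab (enc q) = G.self.label q
  diff_iff : ∀ q, c₁ (enc q) ≠ c₂ (enc q) ↔ q ∈ G.Vdiff

section Encodes

variable {V : Type*} {G : LabeledDigraph V ℕ} {N M : ℕ} {lab s t c₁ c₂ : ℕ → ℕ}
  {enc : G.SelfVertex → ℕ} {degF hF ptrF degB hB ptrB : ℕ → ℕ}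

theorem Encodes.not_phaseOne (E : Encodes G N M lab s t c₁ c₂ enc)
    (F : PeelSpec N M s t degF hF ptrF) (h1 : ∀ i < N, ¬ (c₁ i ≠ c₂ i ∧ degF i ≠ 0)) :
    ¬ G.PhaseOne := by
  rintro ⟨q, hq, r, hr, hqr⟩
  exact h1 _ (E.lt q) ⟨(E.diff_iff q).2 hq, F.ne_zero_of_reaches E.toEncodesRel hqr hr⟩

theorem Encodes.not_phaseTwo (E : Encodes G N M lab s t c₁ c₂ enc)
    (B : PeelSpec N M t s degB hB ptrB)
    (h2 : ∀ e < M, ¬ (degB (s e) ≠ 0 ∧ c₁ (s e) = c₂ (s e) ∧ c₁ (t e) ≠ c₂ (t e))) :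
    ¬ G.PhaseTwo := by
  rintro ⟨u, hu, q, hq, huq⟩
  obtain ⟨hqd, r, hr, hqr⟩ := LabeledDigraph.exists_adj_of_mem_Vndet hq
  obtain ⟨e, he, hs, ht⟩ := (E.adj_iff q r).1 hqr
  refine h2 e he ⟨?_, ?_, ?_⟩
  · rw [hs]
    refine B.ne_zero_of_reaches E.toEncodesRel.swap (r := G.diag u) ?_ ?_
    · exact Relation.reflTransGen_swap.1 huq
    · exact Relation.transGen_swap.1 hu
  · rw [hs]
    by_contra h
    exact hqd ((E.diff_iff q).1 h)
  · rw [ht]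
    exact (E.diff_iff r).2 hr

/-- If both checks fail, no cycle reaches a vertex off the diagonal: otherwise each such vertex
would have a predecessor of the same kind, while `hF` increases along predecessors. -/
theorem Encodes.degB_eq_zero (E : Encodes G N M lab s t c₁ c₂ enc)
    (F : PeelSpec N M s t degF hF ptrF) (B : PeelSpec N M t s degB hB ptrB)
    (h1 : ∀ i < N, ¬ (c₁ i ≠ c₂ i ∧ degF i ≠ 0))
    (h2 : ∀ e < M, ¬ (degB (s e) ≠ 0 ∧ c₁ (s e) = c₂ (s e) ∧ c₁ (t e) ≠ c₂ (t e)))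
    {q : G.SelfVertex} (hq : q ∈ G.Vdiff) : degB (enc q) = 0 := by
  have key : ∀ n, ∀ q ∈ G.Vdiff, N - hF (enc q) = n → degB (enc q) = 0 := by
    intro n
    induction n using Nat.strong_induction_on with
    | _ n ih =>
      intro q hq hn
      by_contra h0
      obtain ⟨r, hrq, hr0⟩ := B.exists_adj E.toEncodesRel.swap h0
      obtain ⟨e, he, hs, ht⟩ := (E.adj_iff r q).1 hrq
      have hr : c₁ (enc r) ≠ c₂ (enc r) := by
        intro hc
        refine h2 e he ⟨by rwa [hs], by rwa [hs], ?_⟩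
        rw [ht]
        exact (E.diff_iff q).2 hq
      have hr1 : degF (enc r) = 0 := by
        by_contra h
        exact h1 _ (E.lt r) ⟨hr, h⟩
      have := (F.of_adj E.toEncodesRel hr1 hrq).2
      have := F.h_le _ (E.lt r)
      exact hr0 (ih _ (by omega) r ((E.diff_iff r).1 hr) rfl)
  exact key _ q hq rfl

theorem Encodes.length_le (E : Encodes G N M lab s t c₁ c₂ enc)
    (F : PeelSpec N M s t degF hF ptrF) (B : PeelSpec N M t s degB hB ptrB)
    (h1 : ∀ i < N, ¬ (c₁ i ≠ c₂ i ∧ degF i ≠ 0))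
    (h2 : ∀ e < M, ¬ (degB (s e) ≠ 0 ∧ c₁ (s e) = c₂ (s e) ∧ c₁ (t e) ≠ c₂ (t e)))
    {L : ℕ} (hL : ∀ i < N, c₁ i ≠ c₂ i → hB i + hF i + 1 ≤ L) {p : List G.SelfVertex}
    (hp : G.IsDagPath p) : p.length ≤ L := by
  obtain ⟨hw, -, -, q, hqp, hq⟩ := hp
  obtain ⟨l₁, l₂, rfl⟩ := List.append_of_mem hqp
  have hqd := (E.diff_iff q).2 hq
  have hF0 : degF (enc q) = 0 := by
    by_contra h
    exact h1 _ (E.lt q) ⟨hqd, h⟩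
  have hB0 := E.degB_eq_zero F B h1 h2 hq
  have hl2 := F.length_le E.toEncodesRel hF0 hw.right_of_append
  have hw1 : (l₁ ++ [q]).IsChain G.self.Adj := by
    refine List.IsChain.prefix hw ⟨l₂, by simp⟩
  have hl1 := B.length_le E.toEncodesRel.swap (l := l₁.reverse) hB0 (by
    rw [← List.isChain_reverse] at hw1
    simpa using hw1)
  have := hL _ (E.lt q) hqd
  simp only [List.length_reverse] at hl1
  simp only [List.length_append, List.length_cons]
  omega

end Encodes


open Program Term

/-! ### Searching, following pointers and filling arrays -/

variable {W S N M : ℕ} {σ : State}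

variable {V : Type*} {G : LabeledDigraph V ℕ} {enc : G.SelfVertex → ℕ}

/-- Put `i + 1` into register 20 for the last `i` that satisfies `e`, or 0 if there is none. The
candidates `i` are the numbers below register `n`; the test `e` reads `i` from register 12. -/
def search (n : ℕ) (e : Term) : Program :=
  assign 20 (const 0) ;;
  forLoop 12 n (ite e (assign 20 (add (reg 12) (const 1))) skip)

/-- Array 40 gets, for each vertex, the target of an edge from it to a vertex that is not removed,
if there is one. -/
def follow (s t deg : ℕ) : Program :=
  forLoop 12 11
    (ite (read deg (read t (reg 12))) (write 40 (read s (reg 12)) (read t (reg 12))) skip)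

/-- Walk along the pointers in array 40, from the vertex in register 16, until a vertex is seen
twice. Array 42 gets the vertices in order, register 13 their number, and array 41 their positions,
counted from 1. -/
def lasso : Program :=
  assign 13 (const 0) ;;
  loop (eq (read 41 (reg 16)) (const 0))
    (write 42 (reg 13) (reg 16) ;;
      assign 13 (add (reg 13) (const 1)) ;;
      write 41 (reg 16) (reg 13) ;;
      assign 16 (read 40 (reg 16)))

/-- Array `a` gets the first terms, as many as register `n` tells, of the walk along the pointers in
array `ptr` from the vertex whose successor stands in register 20. -/
def trace (ptr a n : ℕ) : Program :=
  assign 16 (sub (reg 20) (const 1)) ;;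
  forLoop 12 n (write a (reg 12) (reg 16) ;; assign 16 (read ptr (reg 16)))

theorem search_halts {n : ℕ} {e : Term} (p : ℕ → Prop) (hσ : σ.Bdd W) (hS : σ.reg n + 1 ≤ S)
    (hW : 1 < W) (hn : n ≠ 12) (hn' : n ≠ 20)
    (he : ∀ k τ, k < σ.reg n → (∀ x, x ≠ 12 → x ≠ 20 → τ.reg x = σ.reg x) →
      (∀ a, τ.arr a = σ.arr a) → τ.reg 12 = k → e.Ok W τ ∧ (e.val τ ≠ 0 ↔ p k)) :
    HaltsWithin W S (search n e) σ (fun τ => (τ.reg 20 = 0 ∧ ∀ k < σ.reg n, ¬ p k) ∨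
      ∃ k < σ.reg n, p k ∧ τ.reg 20 = k + 1) := by
  refine HaltsWithin.seq (Q := fun τ => τ = σ.setReg 20 0) hσ (.of_safe (by omega) hσ ?_ rfl) ?_
  · simp only [Safe, Term.Ok]; omega
  rintro _ hτ - rfl
  have en : (σ.setReg 20 0).reg n = σ.reg n := by simp [State.setReg, hn']
  have := HaltsWithin.forLoop (W := W) (S := S) (i := 12) (n := n) (σ := σ.setReg 20 0)
    (P := ite e (assign 20 (add (reg 12) (const 1))) skip)
    (fun k τ => (τ.reg 20 = 0 ∧ ∀ j < k, ¬ p j) ∨ ∃ j < k, p j ∧ τ.reg 20 = j + 1) hτ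
    (by rw [en]; exact hS) hW hn (by simp [wregs]) (by simpa [wregs] using hn')
    (by simp [State.setReg]) ?_
  · rw [en] at this
    exact this
  · intro k τ hk hτ hf hi hI
    rw [en] at hk
    obtain ⟨hok, hp⟩ := he k τ hk
      (fun x h1 h2 => by rw [hf.1 x (by simp [wregs, h2])]; simp [State.setReg, h1, h2])
      (fun a => by rw [hf.2 a (by simp [warrs])]; simp [State.setReg]) hi
    have hkW := hτ.1 n
    rw [hf.1 n (by simp [wregs, hn'])] at hkW
    simp only [State.setReg, Function.update_apply, hn, hn', if_false] at hkW
    by_cases h0 : e.val τ = 0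
    · have hpk : ¬ p k := fun h => hp.2 h h0
      refine ⟨⟨hok, fun _ => trivial, fun h => absurd h0 h⟩, ?_⟩
      simp only [exec, h0, if_true, State.setReg]
      rcases hI with ⟨h1, h2⟩ | ⟨j, hj, h1, h2⟩
      · left
        refine ⟨by simpa using h1, fun j hj => ?_⟩
        rcases Nat.lt_succ_iff_lt_or_eq.1 hj with h | rfl
        · exact h2 j h
        · exact hpk
      · right
        exact ⟨j, by omega, h1, by simpa using h2⟩
    · refine ⟨⟨hok, fun h => absurd h h0, fun _ => ⟨trivial, hW, ?_⟩⟩, ?_⟩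
      · simp only [Term.val, hi]; omega
      · right
        exact ⟨k, by omega, hp.1 h0, by simp [exec, h0, State.setReg, Term.val, hi]⟩

theorem follow_halts {s t deg : ℕ} (hσ : σ.Bdd W) (hM : σ.reg 11 = M) (hS : M + 1 ≤ S)
    (hW : 1 < W) (hs : s < 40) (ht : t < 40) (hd : deg < 40) :
    HaltsWithin W S (follow s t deg) σ (fun τ => ∀ e < M, σ.arr deg (σ.arr t e) ≠ 0 →
      ∃ e' < M, σ.arr s e' = σ.arr s e ∧ σ.arr t e' = τ.arr 40 (σ.arr s e) ∧
        σ.arr deg (σ.arr t e') ≠ 0) := by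
  have := HaltsWithin.forLoop (W := W) (S := S) (i := 12) (n := 11) (σ := σ)
    (P := ite (read deg (read t (reg 12))) (write 40 (read s (reg 12)) (read t (reg 12))) skip)
    (fun k τ => ∀ e < k, σ.arr deg (σ.arr t e) ≠ 0 →
      ∃ e' < k, σ.arr s e' = σ.arr s e ∧ σ.arr t e' = τ.arr 40 (σ.arr s e) ∧
        σ.arr deg (σ.arr t e') ≠ 0) hσ (by omega) (by omega) (by decide) (by simp [wregs])
    (by simp [wregs]) (by simp) ?_
  · rw [hM] at this
    exact this
  · intro k τ hk hτ hf hi hI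
    have es : τ.arr s = σ.arr s := hf.2 s (by simp [warrs]; omega)
    have et : τ.arr t = σ.arr t := hf.2 t (by simp [warrs]; omega)
    have ed : τ.arr deg = σ.arr deg := hf.2 deg (by simp [warrs]; omega)
    refine ⟨by simp [Safe, Term.Ok], ?_⟩
    by_cases h0 : σ.arr deg (σ.arr t k) = 0
    · simp only [exec, Term.val, hi, et, ed, h0, if_true, State.setReg]
      intro e he h
      have hek : e ≠ k := by rintro rfl; exact h h0
      obtain ⟨e', he', h'⟩ := hI e (by omega) h
      exact ⟨e', by omega, h'⟩
    · simp only [exec, Term.val, hi, et, es, ed, h0, if_false, State.setReg, State.setArr,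
        Function.update_self]
      intro e he h
      by_cases hek : σ.arr s e = σ.arr s k
      · exact ⟨k, by omega, hek.symm, by simp [hek], h0⟩
      · have : e ≠ k := by rintro rfl; exact hek rfl
        obtain ⟨e', he', h1, h2, h3⟩ := hI e (by omega) h
        exact ⟨e', by omega, h1, by rw [Function.update_of_ne hek]; exact h2, h3⟩

theorem lasso_halts (hσ : σ.Bdd W) (hS : N + 1 ≤ S) (hW : N + 2 ≤ W)
    (h41 : σ.arr 41 = fun _ => 0) (hlt : ∀ j, (σ.arr 40)^[j] (σ.reg 16) < N) :
    HaltsWithin W S lasso σ (fun τ => τ.reg 13 ≤ N ∧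
      (∀ i < τ.reg 13, ∀ j < τ.reg 13,
        (σ.arr 40)^[i] (σ.reg 16) = (σ.arr 40)^[j] (σ.reg 16) → i = j) ∧
      (∀ j < τ.reg 13, τ.arr 42 j = (σ.arr 40)^[j] (σ.reg 16)) ∧
      ∃ i < τ.reg 13, τ.arr 41 (τ.reg 16) = i + 1 ∧
        (σ.arr 40)^[i] (σ.reg 16) = (σ.arr 40)^[τ.reg 13] (σ.reg 16)) := by
  refine HaltsWithin.seq (Q := fun τ => τ = σ.setReg 13 0) hσ (.of_safe (by omega) hσ ?_ rfl) ?_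
  · simp only [Safe, Term.Ok]; omega
  rintro _ hτ - rfl
  set y : ℕ → ℕ := fun j => (σ.arr 40)^[j] (σ.reg 16) with hy
  have hys : ∀ j, σ.arr 40 (y j) = y (j + 1) := fun j => (Function.iterate_succ_apply' _ _ _).symm
  have hcard : ∀ k, (∀ i < k, ∀ j < k, y i = y j → i = j) → k ≤ N := by
    intro k hk
    simpa using Finset.card_le_card_of_injOn (s := Finset.range k) (t := Finset.range N) y
      (fun i _ => by simpa using hlt i)
      (fun i hi j hj hij => hk i (by simpa using hi) j (by simpa using hj) hij)
  refine (HaltsWithin.loop (fun τ => τ.reg 16 = y (τ.reg 13) ∧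
      (∀ i < τ.reg 13, ∀ j < τ.reg 13, y i = y j → i = j) ∧
      (∀ j < τ.reg 13, τ.arr 42 j = y j) ∧
      ∀ v, (τ.arr 41 v = 0 ∧ ∀ j < τ.reg 13, y j ≠ v) ∨
        ∃ j < τ.reg 13, τ.arr 41 v = j + 1 ∧ y j = v)
    (fun τ => N - τ.reg 13) hτ ?_ (by omega) ((Nat.sub_le _ _).trans (by omega)) ?_).mono hτ ?_
  · simp [State.setReg, h41, hy]
  · rintro τ hτ' hf ⟨hx, hinj, hseq, hpos⟩
    have e40 : τ.arr 40 = σ.arr 40 := hf.2 40 (by simp [warrs])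
    refine ⟨⟨trivial, by simp only [Term.Ok]; omega, by omega⟩, fun he => ?_⟩
    have h0 : τ.arr 41 (τ.reg 16) = 0 := by
      by_contra h
      simp [Term.val, h] at he
    have hnew : ∀ j < τ.reg 13, y j ≠ y (τ.reg 13) := by
      rcases hpos (τ.reg 16) with ⟨-, h⟩ | ⟨j, -, h, -⟩
      · rw [← hx]; exact h
      · omega
    have hinj' : ∀ i < τ.reg 13 + 1, ∀ j < τ.reg 13 + 1, y i = y j → i = j := by
      intro i hi j hj hij
      rcases Nat.lt_succ_iff_lt_or_eq.1 hi with hi | rfl <;>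
        rcases Nat.lt_succ_iff_lt_or_eq.1 hj with hj | rfl
      · exact hinj i hi j hj hij
      · exact absurd hij (hnew i hi)
      · exact absurd hij.symm (hnew j hj)
      · rfl
    have hle := hcard _ hinj'
    simp [Safe, exec, Term.Ok, Term.val, State.setReg, State.setArr, e40, hx, hys]
    refine ⟨⟨by omega, by omega⟩, ⟨?_, ?_, ?_⟩, by omega⟩
    · exact fun i hi j hj => hinj' i (by omega) j (by omega)
    · intro j hj
      rw [Function.update_apply]
      split
      · rename_i h
        rw [h]
      · exact hseq j (by omega)
    · intro v
      by_cases hv : v = y (τ.reg 13)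
      · subst hv
        right
        exact ⟨τ.reg 13, by omega, by simp, rfl⟩
      · rw [Function.update_of_ne hv]
        rcases hpos v with ⟨h1, h2⟩ | ⟨j, hj, h1, h2⟩
        · left
          refine ⟨h1, fun j hj => ?_⟩
          rcases Nat.lt_succ_iff_lt_or_eq.1 (Nat.lt_succ_of_le hj) with hj | rfl
          · exact h2 j hj
          · exact fun h => hv h.symm
        · right
          exact ⟨j, by omega, h1, h2⟩
  · rintro τ hτ' hf ⟨⟨hx, hinj, hseq, hpos⟩, he⟩
    refine ⟨hcard _ hinj, hinj, hseq, ?_⟩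
    have h0 : τ.arr 41 (τ.reg 16) ≠ 0 := by
      intro h
      simp [Term.val, h] at he
    rcases hpos (τ.reg 16) with ⟨h, -⟩ | ⟨j, hj, h1, h2⟩
    · exact absurd h h0
    · exact ⟨j, hj, h1, h2.trans hx⟩

theorem trace_halts {ptr a n : ℕ} (hσ : σ.Bdd W) (hS : σ.reg n + 1 ≤ S) (hW : 1 < W)
    (hpa : ptr ≠ a) (hn : n ≠ 12) (hn' : n ≠ 16) :
    HaltsWithin W S (trace ptr a n) σ (fun τ => ∀ k < σ.reg n,
      τ.arr a k = (σ.arr ptr)^[k] (σ.reg 20 - 1)) := by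
  refine HaltsWithin.seq (Q := fun τ => τ = σ.setReg 16 (σ.reg 20 - 1)) hσ
    (.of_safe (by omega) hσ ?_ rfl) ?_
  · simp only [Safe, Term.Ok, true_and]; omega
  rintro _ hτ - rfl
  have en : (σ.setReg 16 (σ.reg 20 - 1)).reg n = σ.reg n := by simp [State.setReg, hn']
  have := HaltsWithin.forLoop (W := W) (S := S) (i := 12) (n := n) (σ := σ.setReg 16 (σ.reg 20 - 1))
    (P := write a (reg 12) (reg 16) ;; assign 16 (read ptr (reg 16)))
    (fun k τ => τ.reg 16 = (σ.arr ptr)^[k] (σ.reg 20 - 1) ∧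
      ∀ j < k, τ.arr a j = (σ.arr ptr)^[j] (σ.reg 20 - 1)) hτ
    (by rw [en]; exact hS) hW hn (by simp [wregs]) (by simpa [wregs] using hn')
    (by simp [State.setReg]) ?_
  · rw [en] at this
    exact this.mono hτ fun τ _ _ h => h.2
  · rintro k τ hk hτ hf hi ⟨h1, h2⟩
    have ep : τ.arr ptr = σ.arr ptr := hf.2 ptr (by simpa [warrs] using hpa)
    simp [Safe, exec, Term.Ok, Term.val, State.setReg, State.setArr, hi, hpa, h1, ep,
      ← Function.iterate_succ_apply']
    intro j hj
    rw [Function.update_apply]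
    split
    · rename_i h
      rw [h]
    · exact h2 j (by omega)

/-- A loop that fills the first cells of an array. -/
theorem fill_halts {P : Program} {a n : ℕ} (g : ℕ → ℕ) (hσ : σ.Bdd W) (hS : σ.reg n + 1 ≤ S)
    (hW : 1 < W) (hn : n ≠ 12) (hP : P.wregs = [])
    (he : ∀ k τ, k < σ.reg n → Frame P (σ.setReg 12 k) τ → τ.reg 12 = k →
      P.Safe W τ ∧ P.exec τ = τ.setArr a k (g k)) :
    HaltsWithin W S (forLoop 12 n P) σ (fun τ => ∀ k < σ.reg n, τ.arr a k = g k) := by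
  refine HaltsWithin.forLoop (fun k τ => ∀ j < k, τ.arr a j = g j) hσ hS hW hn (by simp [hP])
    (by simp [hP]) (by simp) ?_
  intro k τ hk hτ hf hi hI
  obtain ⟨h1, h2⟩ := he k τ hk hf hi
  refine ⟨h1, ?_⟩
  rw [h2]
  intro j hj
  simp only [State.setReg, State.setArr, Function.update_self]
  rw [Function.update_apply]
  split
  · rename_i h
    rw [h]
  · exact hI j (by omega)

/-! ### The program for a given self-product -/

/-- Walk along edges `arr s e → arr t e` between vertices that are not removed, from the vertex
`start`, until a vertex is seen twice. Array 42 gets the vertices in order, register 13 their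
number, register 18 the position of the first one on the cycle, and register 19 the length of the
cycle. -/
def findLasso (s t deg : ℕ) (start : Term) : Program :=
  follow s t deg ;;
  assign 16 start ;;
  lasso ;;
  assign 18 (sub (read 41 (reg 16)) (const 1)) ;;
  assign 19 (sub (reg 13) (reg 18))

/-- The outcome of the first phase, for a start vertex whose successor stands in register 20. -/
def phaseOne : Program :=
  findLasso 11 12 20 (sub (reg 20) (const 1)) ;;
  forLoop 12 18 (write 0 (reg 12) (read 10 (read 42 (reg 12)))) ;;
  forLoop 12 19 (write 1 (reg 12) (read 10 (read 42 (add (reg 18) (reg 12))))) ;;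
  assign 1 (reg 18) ;;
  assign 2 (reg 19) ;;
  assign 0 (const 0)

/-- The outcome of the second phase, for an edge that leaves the diagonal and whose successor stands
in register 20. -/
def phaseTwo : Program :=
  findLasso 12 11 30 (read 11 (sub (reg 20) (const 1))) ;;
  forLoop 12 19 (write 0 (reg 12) (read 10 (read 42 (sub (sub (reg 13) (const 1)) (reg 12))))) ;;
  forLoop 12 13 (write 1 (reg 12) (read 10 (read 42 (sub (sub (reg 13) (const 1)) (reg 12))))) ;;
  write 1 (reg 13) (read 10 (read 12 (sub (reg 20) (const 1)))) ;;
  assign 1 (reg 19) ;;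
  assign 2 (add (reg 13) (const 1)) ;;
  assign 0 (const 1)

/-- Find a vertex off the diagonal on a longest walk: register 20 gets the successor of this vertex,
or 0 if there is none, and register 21 the number of vertices of the walk. -/
def findLongest : Program :=
  assign 20 (const 0) ;;
  assign 21 (const 0) ;;
  forLoop 12 10
    (ite (eq (read 13 (reg 12)) (read 14 (reg 12))) skip
      (ite (lt (reg 21) (add (add (read 34 (reg 12)) (read 24 (reg 12))) (const 1)))
        (assign 21 (add (add (read 34 (reg 12)) (read 24 (reg 12))) (const 1)) ;;
          assign 20 (add (reg 12) (const 1)))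
        skip))

/-- The outcome of the third phase. -/
def phaseThree : Program :=
  findLongest ;;
  ite (reg 20)
    (assign 18 (add (read 34 (sub (reg 20) (const 1))) (const 1)) ;;
      assign 19 (add (read 24 (sub (reg 20) (const 1))) (const 1)) ;;
      trace 35 43 18 ;;
      trace 25 44 19 ;;
      forLoop 12 21
        (ite (lt (reg 12) (reg 18))
          (write 0 (reg 12) (read 10 (read 43 (sub (sub (reg 18) (const 1)) (reg 12)))))
          (write 0 (reg 12) (read 10 (read 44 (sub (add (reg 12) (const 1)) (reg 18)))))) ;;
      assign 1 (reg 21) ;;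
      assign 0 (const 2))
    (assign 1 (const 0) ;; assign 0 (const 2))

/-- The algorithm for a given self-product, with its numbers of vertices and edges in registers 10
and 11, the labels in array 10, the sources and targets of the edges in arrays 11 and 12, and the
two components of the vertices in arrays 13 and 14. Arrays 20 to 25 belong to the peeling, arrays 30
to 35 to the peeling of the reversed graph, and arrays 40 to 44 to the search for walks. Numbers
that may be missing are stored as successors, with 0 for a missing one, and a conjunction of tests
is written as their product. -/
def solve : Program :=
  peel 11 12 20 ;;
  peel 12 11 30 ;;
  search 10 (mul (eq (eq (read 13 (reg 12)) (read 14 (reg 12))) (const 0))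
    (lt (const 0) (read 20 (reg 12)))) ;;
  ite (reg 20) phaseOne
    (search 11 (mul (lt (const 0) (read 30 (read 11 (reg 12))))
        (mul (eq (read 13 (read 11 (reg 12))) (read 14 (read 11 (reg 12))))
          (eq (eq (read 13 (read 12 (reg 12))) (read 14 (read 12 (reg 12)))) (const 0)))) ;;
      ite (reg 20) phaseTwo phaseThree)

theorem holdsList_map_range {τ : State} {r a n : ℕ} {g : ℕ → ℕ} (hr : τ.reg r = n)
    (ha : ∀ k < n, τ.arr a k = g k) : τ.HoldsList r a ((List.range n).map g) := by
  refine ⟨by simpa using hr, fun i hi => ?_⟩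
  simpa using ha i (by simpa using hi)

theorem holdsList_map_range_append {τ : State} {r a n z : ℕ} {g : ℕ → ℕ} (hr : τ.reg r = n + 1)
    (ha : ∀ k < n, τ.arr a k = g k) (hz : τ.arr a n = z) :
    τ.HoldsList r a ((List.range n).map g ++ [z]) := by
  refine ⟨by simpa using hr, fun i hi => ?_⟩
  have hi' : i < n + 1 := by simpa using hi
  rcases Nat.lt_succ_iff_lt_or_eq.1 hi' with h | rfl
  · rw [List.getElem_append_left (by simpa using h)]
    simpa using ha i h
  · simp [hz]

theorem findLasso_halts {Q : Type*} {adj : Q → Q → Prop} {enc : Q → ℕ} {s t deg : ℕ}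
    {h ptr : ℕ → ℕ} {start : Term} {q : Q} (hσ : σ.Bdd W) (hM : σ.reg 11 = M)
    (hS : N + M + 1 ≤ S) (hW : N + M + 3 ≤ W) (hs : s < 40) (ht : t < 40) (hd : deg < 40)
    (h41 : σ.arr 41 = fun _ => 0) (E : EncodesRel adj N M (σ.arr s) (σ.arr t) enc)
    (H : PeelSpec N M (σ.arr s) (σ.arr t) (σ.arr deg) h ptr) (hq : σ.arr deg (enc q) ≠ 0)
    (hstart : ∀ τ, Frame (follow s t deg) σ τ → start.Ok W τ ∧ start.val τ = enc q) :
    HaltsWithin W S (findLasso s t deg start) σ (fun τ => ∃ y : ℕ → Q, y 0 = q ∧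
      (∀ j, adj (y j) (y (j + 1))) ∧ (∀ i < τ.reg 13, ∀ j < τ.reg 13, y i = y j → i = j) ∧
      (∀ j < τ.reg 13, τ.arr 42 j = enc (y j)) ∧ τ.reg 18 < τ.reg 13 ∧
      y (τ.reg 18) = y (τ.reg 13) ∧ τ.reg 19 = τ.reg 13 - τ.reg 18 ∧ τ.reg 13 ≤ N) := by
  have : Nonempty Q := ⟨q⟩
  refine HaltsWithin.seq hσ (follow_halts hσ hM (by omega) (by omega) hs ht hd) ?_
  intro σ₁ hσ₁ hf₁ hnx
  obtain ⟨hok, hval⟩ := hstart σ₁ hf₁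
  have e41 : σ₁.arr 41 = fun _ => 0 := by
    rw [hf₁.2 41 (by simp [follow, forLoop, warrs]), h41]
  refine HaltsWithin.seq (Q := fun τ => τ = σ₁.setReg 16 (enc q)) hσ₁
    (.of_safe (by omega) hσ₁ hok (by simp [exec, hval])) ?_
  rintro _ hσ₂ - rfl
  -- the pointers lead from vertices that are not removed to such vertices
  have hgood : ∀ r, σ.arr deg (enc r) ≠ 0 → ∃ r', enc r' = σ₁.arr 40 (enc r) ∧ adj r r' ∧
      σ.arr deg (enc r') ≠ 0 := by
    intro r hr
    obtain ⟨e, he, hes, het⟩ := H.stay _ (E.lt r) hr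
    obtain ⟨e', he', h1, h2, h3⟩ := hnx e he het
    obtain ⟨r', hr'⟩ := E.surj _ (E.t_lt e' he')
    rw [hes] at h1 h2
    exact ⟨r', hr'.trans h2, E.adj_of_lt he' h1 hr'.symm, by rwa [hr']⟩
  choose! nx hnx1 hnx2 hnx3 using hgood
  have hy : ∀ j, enc (nx^[j] q) = (σ₁.arr 40)^[j] (enc q) ∧ σ.arr deg (enc (nx^[j] q)) ≠ 0 := by
    intro j
    induction j with
    | zero => exact ⟨rfl, hq⟩
    | succ j ih =>
      rw [Function.iterate_succ_apply', Function.iterate_succ_apply', ← ih.1]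
      exact ⟨hnx1 _ ih.2, hnx3 _ ih.2⟩
  have e16 : (σ₁.setReg 16 (enc q)).reg 16 = enc q := by simp [State.setReg]
  have e40 : (σ₁.setReg 16 (enc q)).arr 40 = σ₁.arr 40 := rfl
  refine HaltsWithin.seq hσ₂ (lasso_halts (N := N) hσ₂ (by omega) (by omega) e41 ?_) ?_
  · intro j
    rw [e16, e40, ← (hy j).1]
    exact E.lt _
  rintro σ₃ hσ₃ hf₃ ⟨h13, hinj, hseq, i, hi, hpos, hyi⟩
  simp only [e16, e40, ← (hy _).1] at hinj hseq hyi
  refine .of_safe (by omega) hσ₃ ?_ ?_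
  · simp [Safe, Term.Ok]; omega
  · simp only [exec, Term.val, State.setReg, Function.update_apply]
    simp only [hpos, Nat.add_sub_cancel]
    refine ⟨fun j => nx^[j] q, rfl, ?_, ?_, ?_, ?_, ?_, ?_, ?_⟩
    · intro j
      simp only [Function.iterate_succ_apply']
      exact hnx2 _ (hy j).2
    · intro a ha b hb hab
      exact hinj a (by simpa using ha) b (by simpa using hb) (congrArg enc hab)
    · intro j hj
      exact hseq j (by simpa using hj)
    · simpa using hi
    · simpa using E.inj hyi
    · simp
    · simpa using h13

theorem phaseOne_halts {h ptr : ℕ → ℕ} {q : G.SelfVertex} (hσ : σ.Bdd W) (hM : σ.reg 11 = M)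
    (hS : N + M + 1 ≤ S) (hW : N + M + 3 ≤ W) (h41 : σ.arr 41 = fun _ => 0)
    (E : Encodes G N M (σ.arr 10) (σ.arr 11) (σ.arr 12) (σ.arr 13) (σ.arr 14) enc)
    (F : PeelSpec N M (σ.arr 11) (σ.arr 12) (σ.arr 20) h ptr)
    (hq : q ∈ G.Vdiff) (hdeg : σ.arr 20 (enc q) ≠ 0) (h20 : σ.reg 20 = enc q + 1) :
    HaltsWithin W S phaseOne σ (fun τ => ∃ o, τ.Holds o ∧ G.AlgorithmOutput o) := by
  refine HaltsWithin.seq hσ (findLasso_halts hσ hM hS hW (by omega) (by omega) (by omega) h41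
    E.toEncodesRel F hdeg ?_) ?_
  · intro τ hf
    have e20 : τ.reg 20 = enc q + 1 := by
      rw [hf.1 20 (by simp [follow, forLoop, wregs]), h20]
    simp [Term.Ok, Term.val, e20]
    omega
  rintro σ₁ hσ₁ hf₁ ⟨y, hy0, hadj, hinj, hseq, hik, hyik, h19, h13⟩
  have e10 : σ₁.arr 10 = σ.arr 10 := hf₁.2 10 (by decide)
  have hlab : ∀ j < σ₁.reg 13, σ₁.arr 10 (σ₁.arr 42 j) = G.self.label (y j) := by
    intro j hj
    rw [hseq j hj, e10, E.lab_enc]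
  refine HaltsWithin.seq hσ₁ (fill_halts (a := 0) (fun j => G.self.label (y j)) hσ₁ (by omega)
    (by omega) (by decide) rfl ?_) ?_
  · intro k τ hk hf hi
    have f10 : τ.arr 10 = σ₁.arr 10 := hf.2 10 (by decide)
    have f42 : τ.arr 42 = σ₁.arr 42 := hf.2 42 (by decide)
    simp [Safe, exec, Term.Ok, Term.val, hi, f10, f42, hlab k (by omega)]
  intro σ₂ hσ₂ hf₂ hR
  have g : ∀ x, x ≠ 12 → σ₂.reg x = σ₁.reg x := fun x hx =>
    hf₂.1 x (by simpa [forLoop, wregs] using hx)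
  have ga : ∀ a, a ≠ 0 → σ₂.arr a = σ₁.arr a := fun a ha =>
    hf₂.2 a (by simpa [forLoop, warrs] using ha)
  have hn : σ₂.reg 19 = σ₁.reg 13 - σ₁.reg 18 := by rw [g 19 (by decide), h19]
  refine HaltsWithin.seq hσ₂ (fill_halts (a := 1)
    (fun j => G.self.label (y (σ₁.reg 18 + j))) hσ₂ (by omega)
    (by omega) (by decide) rfl ?_) ?_
  · intro k τ hk hf hi
    have f10 : τ.arr 10 = σ₁.arr 10 := (hf.2 10 (by decide)).trans (ga 10 (by decide))
    have f42 : τ.arr 42 = σ₁.arr 42 := (hf.2 42 (by decide)).trans (ga 42 (by decide))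
    have f18 : τ.reg 18 = σ₁.reg 18 := (hf.1 18 (by decide)).trans (g 18 (by decide))
    simp [Safe, exec, Term.Ok, Term.val, hi, f10, f42, f18, hlab (σ₁.reg 18 + k) (by omega)]
    omega
  intro σ₃ hσ₃ hf₃ hS'
  have k18 : σ₃.reg 18 = σ₁.reg 18 := (hf₃.1 18 (by decide)).trans (g 18 (by decide))
  have k19 : σ₃.reg 19 = σ₁.reg 13 - σ₁.reg 18 := (hf₃.1 19 (by decide)).trans hn
  have k0 : σ₃.arr 0 = σ₂.arr 0 := hf₃.2 0 (by decide)
  rw [hn] at hS'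
  refine .of_safe (by omega) hσ₃ ?_ ?_
  · simp [Safe, Term.Ok]; omega
  · refine ⟨_, ?_, LabeledDigraph.output_infinite_of_lasso (fun j _ => hadj j) hinj hik hyik
      (by rwa [hy0])⟩
    refine ⟨?_, ?_, ?_⟩
    · simp [exec, State.setReg, Term.val]
    · refine holdsList_map_range ?_ ?_
      · simp [exec, State.setReg, Term.val, k18]
      · simpa [exec, State.setReg, k0] using hR
    · refine holdsList_map_range ?_ ?_
      · simp [exec, State.setReg, Term.val, k19]
      · simpa [exec, State.setReg] using hS'

theorem phaseTwo_halts {h ptr : ℕ → ℕ} {e : ℕ} (hσ : σ.Bdd W) (hM : σ.reg 11 = M)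
    (hS : N + M + 1 ≤ S) (hW : N + M + 3 ≤ W) (h41 : σ.arr 41 = fun _ => 0)
    (E : Encodes G N M (σ.arr 10) (σ.arr 11) (σ.arr 12) (σ.arr 13) (σ.arr 14) enc)
    (B : PeelSpec N M (σ.arr 12) (σ.arr 11) (σ.arr 30) h ptr) (h1 : ¬ G.PhaseOne) (he : e < M)
    (hdeg : σ.arr 30 (σ.arr 11 e) ≠ 0) (hsrc : σ.arr 13 (σ.arr 11 e) = σ.arr 14 (σ.arr 11 e))
    (htgt : σ.arr 13 (σ.arr 12 e) ≠ σ.arr 14 (σ.arr 12 e)) (h20 : σ.reg 20 = e + 1) :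
    HaltsWithin W S phaseTwo σ (fun τ => ∃ o, τ.Holds o ∧ G.AlgorithmOutput o) := by
  obtain ⟨q, hq⟩ := E.surj _ (E.s_lt e he)
  obtain ⟨r, hr⟩ := E.surj _ (E.t_lt e he)
  rw [← hq] at hdeg hsrc
  rw [← hr] at htgt
  have hqr : G.self.Adj q r := E.adj_of_lt he hq.symm hr.symm
  refine HaltsWithin.seq hσ (findLasso_halts hσ hM hS hW (by omega) (by omega) (by omega) h41
    E.toEncodesRel.swap B hdeg ?_) ?_
  · intro τ hf
    have e20 : τ.reg 20 = e + 1 := by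
      rw [hf.1 20 (by simp [follow, forLoop, wregs]), h20]
    have e11 : τ.arr 11 = σ.arr 11 := hf.2 11 (by simp [follow, forLoop, warrs])
    simp [Term.Ok, Term.val, e20, e11, hq]
    omega
  rintro σ₁ hσ₁ hf₁ ⟨y, hy0, hadj, hinj, hseq, hik, hyik, h19, h13⟩
  have e10 : σ₁.arr 10 = σ.arr 10 := hf₁.2 10 (by decide)
  have e12 : σ₁.arr 12 = σ.arr 12 := hf₁.2 12 (by decide)
  have e20 : σ₁.reg 20 = e + 1 := (hf₁.1 20 (by decide)).trans h20
  have hlab : ∀ j < σ₁.reg 13, σ₁.arr 10 (σ₁.arr 42 j) = G.self.label (y j) := by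
    intro j hj
    rw [hseq j hj, e10, E.lab_enc]
  refine HaltsWithin.seq hσ₁ (fill_halts (a := 0)
    (fun j => G.self.label (y (σ₁.reg 13 - 1 - j))) hσ₁ (by omega) (by omega) (by decide) rfl ?_) ?_
  · intro k τ hk hf hi
    have f10 : τ.arr 10 = σ₁.arr 10 := hf.2 10 (by decide)
    have f42 : τ.arr 42 = σ₁.arr 42 := hf.2 42 (by decide)
    have f13 : τ.reg 13 = σ₁.reg 13 := hf.1 13 (by decide)
    simp [Safe, exec, Term.Ok, Term.val, hi, f10, f42, f13, hlab (σ₁.reg 13 - 1 - k) (by omega)]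
    omega
  intro σ₂ hσ₂ hf₂ hR
  have g : ∀ x, x ≠ 12 → σ₂.reg x = σ₁.reg x := fun x hx =>
    hf₂.1 x (by simpa [forLoop, wregs] using hx)
  have ga : ∀ a, a ≠ 0 → σ₂.arr a = σ₁.arr a := fun a ha =>
    hf₂.2 a (by simpa [forLoop, warrs] using ha)
  have hn : σ₂.reg 13 = σ₁.reg 13 := g 13 (by decide)
  refine HaltsWithin.seq hσ₂ (fill_halts (a := 1)
    (fun j => G.self.label (y (σ₁.reg 13 - 1 - j))) hσ₂ (by omega)
    (by omega) (by decide) rfl ?_) ?_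
  · intro k τ hk hf hi
    have f10 : τ.arr 10 = σ₁.arr 10 := (hf.2 10 (by decide)).trans (ga 10 (by decide))
    have f42 : τ.arr 42 = σ₁.arr 42 := (hf.2 42 (by decide)).trans (ga 42 (by decide))
    have f13 : τ.reg 13 = σ₁.reg 13 := (hf.1 13 (by decide)).trans hn
    simp [Safe, exec, Term.Ok, Term.val, hi, f10, f42, f13, hlab (σ₁.reg 13 - 1 - k) (by omega)]
    omega
  intro σ₃ hσ₃ hf₃ hS'
  have k : ∀ x, x ≠ 12 → σ₃.reg x = σ₁.reg x := fun x hx =>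
    (hf₃.1 x (by simpa [forLoop, wregs] using hx)).trans (g x hx)
  have ka : ∀ a, a ≠ 0 → a ≠ 1 → σ₃.arr a = σ₁.arr a := fun a ha ha' =>
    (hf₃.2 a (by simpa [forLoop, warrs] using ha')).trans (ga a ha)
  have k0 : σ₃.arr 0 = σ₂.arr 0 := hf₃.2 0 (by decide)
  have k13 := k 13 (by decide)
  have k19 : σ₃.reg 19 = σ₁.reg 13 - σ₁.reg 18 := by rw [k 19 (by decide), h19]
  have k20 : σ₃.reg 20 = e + 1 := by rw [k 20 (by decide), e20]
  have k10 : σ₃.arr 10 (σ₃.arr 12 e) = G.self.label r := by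
    rw [ka 10 (by decide) (by decide), ka 12 (by decide) (by decide), e10, e12, ← hr, E.lab_enc]
  rw [hn] at hS'
  rw [h19] at hR
  refine .of_safe (by omega) hσ₃ ?_ ?_
  · simp [Safe, Term.Ok, exec, State.setReg, State.setArr, Term.val, k13]; omega
  · have h0 : y 0 ∉ G.Vdiff := by
      rw [hy0, ← E.diff_iff]
      exact fun h => h hsrc
    refine ⟨_, ?_, LabeledDigraph.output_unbounded_of_lasso h1 (fun j _ => hadj j) hinj hik
      hyik h0 ((E.diff_iff r).1 htgt) (by rwa [hy0])⟩
    refine ⟨?_, ?_, ?_⟩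
    · simp [exec, State.setReg, Term.val]
    · refine holdsList_map_range ?_ ?_
      · simp [exec, State.setReg, State.setArr, Term.val, k19]
      · simpa [exec, State.setReg, State.setArr, k0] using hR
    · refine holdsList_map_range_append ?_ ?_ ?_
      · simp [exec, State.setReg, State.setArr, Term.val, k13]
      · intro j hj
        have : j ≠ σ₁.reg 13 := by omega
        simpa [exec, State.setReg, State.setArr, Term.val, k13, this] using hS' j hj
      · simp [exec, State.setReg, State.setArr, Term.val, k13, k20, k10]

theorem findLongest_halts (hσ : σ.Bdd W) (hN : σ.reg 10 = N) (hS : N + M + 1 ≤ S)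
    (hW : 3 * (N + M + 1) ≤ W) (hF : ∀ k < N, σ.arr 24 k ≤ N) (hB : ∀ k < N, σ.arr 34 k ≤ N) :
    HaltsWithin W S findLongest σ (fun τ =>
      (τ.reg 20 = 0 ∧ ∀ k < N, σ.arr 13 k = σ.arr 14 k) ∨
      ∃ q < N, τ.reg 20 = q + 1 ∧ σ.arr 13 q ≠ σ.arr 14 q ∧
        τ.reg 21 = σ.arr 34 q + σ.arr 24 q + 1 ∧
        ∀ k < N, σ.arr 13 k ≠ σ.arr 14 k → σ.arr 34 k + σ.arr 24 k + 1 ≤ τ.reg 21) := by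
  refine HaltsWithin.seq (Q := fun τ => τ = σ.setReg 20 0) hσ (.of_safe (by omega) hσ ?_ rfl) ?_
  · simp only [Safe, Term.Ok]; omega
  rintro _ hτ - rfl
  refine HaltsWithin.seq (Q := fun τ => τ = (σ.setReg 20 0).setReg 21 0) hτ
    (.of_safe (by omega) hτ ?_ rfl) ?_
  · simp only [Safe, Term.Ok]; omega
  clear hτ
  rintro _ hτ - rfl
  have en : ((σ.setReg 20 0).setReg 21 0).reg 10 = N := by simp [State.setReg, hN]
  refine (HaltsWithin.forLoop (fun k τ => (τ.reg 20 = 0 ∧ τ.reg 21 = 0 ∧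
      ∀ j < k, σ.arr 13 j = σ.arr 14 j) ∨
      ∃ q < k, τ.reg 20 = q + 1 ∧ σ.arr 13 q ≠ σ.arr 14 q ∧
        τ.reg 21 = σ.arr 34 q + σ.arr 24 q + 1 ∧
        ∀ j < k, σ.arr 13 j ≠ σ.arr 14 j → σ.arr 34 j + σ.arr 24 j + 1 ≤ τ.reg 21)
    hτ (by omega) (by omega) (by decide) (by decide) (by decide) ?_ ?_).mono hτ ?_
  · simp [State.setReg]
  · intro k τ hk hτ' hf hi hI
    rw [en] at hk
    have e13 : τ.arr 13 = σ.arr 13 := hf.2 13 (by decide)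
    have e14 : τ.arr 14 = σ.arr 14 := hf.2 14 (by decide)
    have e24 : τ.arr 24 = σ.arr 24 := hf.2 24 (by decide)
    have e34 : τ.arr 34 = σ.arr 34 := hf.2 34 (by decide)
    have hFk := hF k hk
    have hBk := hB k hk
    refine ⟨?_, ?_⟩
    · simp [Safe, Term.Ok, Term.val, exec, hi, e24, e34, State.setReg]; omega
    by_cases hd : σ.arr 13 k = σ.arr 14 k
    · simp only [exec, Term.val, hi, e13, e14, hd, if_true, State.setReg]
      simp
      rcases hI with ⟨h1, h2, h3⟩ | ⟨q, hq, h1, h2, h3, h4⟩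
      · left
        refine ⟨h1, h2, fun j hj => ?_⟩
        rcases Nat.lt_succ_iff_lt_or_eq.1 (Nat.lt_succ_of_le hj) with h | rfl
        · exact h3 j h
        · exact hd
      · right
        refine ⟨q, by omega, h1, h2, h3, fun j hj hjd => ?_⟩
        rcases Nat.lt_succ_iff_lt_or_eq.1 (Nat.lt_succ_of_le hj) with h | rfl
        · exact h4 j h hjd
        · exact absurd hd hjd
    · right
      by_cases hlt : τ.reg 21 < σ.arr 34 k + σ.arr 24 k + 1
      · simp [exec, Term.val, hi, e13, e14, e24, e34, hd, hlt, State.setReg]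
        intro j hj hjd
        rcases Nat.lt_succ_iff_lt_or_eq.1 (Nat.lt_succ_of_le hj) with h | rfl
        · rcases hI with ⟨-, -, h3⟩ | ⟨q, -, -, -, -, h4⟩
          · exact absurd (h3 j h) hjd
          · have := h4 j h hjd
            omega
        · exact le_rfl
      · simp [exec, Term.val, hi, e13, e14, e24, e34, hd, hlt, State.setReg]
        rcases hI with ⟨-, h2, -⟩ | ⟨q, hq, h1, h2, h3, h4⟩
        · omega
        · refine ⟨q, by omega, h1, h2, h3, fun j hj hjd => ?_⟩
          rcases Nat.lt_succ_iff_lt_or_eq.1 (Nat.lt_succ_of_le hj) with h | rfl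
          · have := h4 j h hjd
            omega
          · omega
  · intro τ _ _ h
    rw [en] at h
    rcases h with ⟨h1, -, h3⟩ | h
    · exact .inl ⟨h1, h3⟩
    · exact .inr h

/-- The walks along the two kinds of pointers from the same vertex, put together. -/
theorem exists_walk_of_peelSpecs {lab s t c₁ c₂ degF hF ptrF degB hB ptrB : ℕ → ℕ}
    (E : Encodes G N M lab s t c₁ c₂ enc) (F : PeelSpec N M s t degF hF ptrF)
    (B : PeelSpec N M t s degB hB ptrB) (q : G.SelfVertex) :
    ∃ y : ℕ → G.SelfVertex, y (hB (enc q)) = q ∧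
      (∀ j, j + 1 < hB (enc q) + hF (enc q) + 1 → G.self.Adj (y j) (y (j + 1))) ∧
      (∀ j ≤ hB (enc q), enc (y j) = ptrB^[hB (enc q) - j] (enc q)) ∧
      ∀ j ≤ hF (enc q), enc (y (hB (enc q) + j)) = ptrF^[j] (enc q) := by
  have : Nonempty G.SelfVertex := ⟨q⟩
  have hsurj : ∀ i, ∃ r, i < N → enc r = i := fun i => by
    by_cases h : i < N
    · obtain ⟨r, hr⟩ := E.surj i h
      exact ⟨r, fun _ => hr⟩
    · exact ⟨q, fun h' => absurd h' h⟩
  choose dec hdec using hsurj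
  have hb := B.iterate_ptr E.toEncodesRel.swap q
  have hf := F.iterate_ptr E.toEncodesRel q
  set b := hB (enc q)
  let x : ℕ → ℕ := fun j => if j ≤ b then ptrB^[b - j] (enc q) else ptrF^[j - b] (enc q)
  have hx1 : ∀ j ≤ b, x j = ptrB^[b - j] (enc q) := fun j hj => if_pos hj
  have hx2 : ∀ j, x (b + j) = ptrF^[j] (enc q) := by
    intro j
    rcases Nat.eq_zero_or_pos j with rfl | hj
    · simp [x]
    · simp [x, show ¬ b + j ≤ b by omega]
  have hxlt : ∀ j < b + hF (enc q) + 1, x j < N := by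
    intro j hj
    by_cases h : j ≤ b
    · rw [hx1 j h]
      exact (hb _ (Nat.sub_le _ _)).1
    · rw [show j = b + (j - b) by omega, hx2]
      exact (hf _ (by omega)).1
  refine ⟨fun j => dec (x j), ?_, ?_, ?_, ?_⟩
  · apply E.inj
    change enc (dec (x b)) = enc q
    rw [hdec _ (hxlt b (by omega)), hx1 b le_rfl]
    simp
  · intro j hj
    have h1 := hdec _ (hxlt j (by omega))
    have h2 := hdec _ (hxlt (j + 1) hj)
    by_cases h : j + 1 ≤ b
    · obtain ⟨e, he, hs, ht⟩ := (hb (b - (j + 1)) (by omega)).2.2 (by omega)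
      rw [show b - (j + 1) + 1 = b - j by omega] at ht
      exact E.adj_of_lt he (ht.trans (h1.trans (hx1 j (by omega))).symm)
        (hs.trans (h2.trans (hx1 (j + 1) h)).symm)
    · obtain ⟨i, rfl⟩ := Nat.exists_eq_add_of_le (show b ≤ j by omega)
      obtain ⟨e, he, hs, ht⟩ := (hf i (by omega)).2.2 (by omega)
      exact E.adj_of_lt he (hs.trans (h1.trans (hx2 i)).symm)
        (ht.trans (h2.trans (hx2 (i + 1))).symm)
  · intro j hj
    change enc (dec (x j)) = _
    rw [hdec _ (hxlt j (by omega)), hx1 j hj]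
  · intro j hj
    change enc (dec (x (b + j))) = _
    rw [hdec _ (hxlt _ (by omega)), hx2]

theorem phaseThree_halts (hσ : σ.Bdd W) (hN : σ.reg 10 = N)
    (hS : 2 * (N + M + 1) ≤ S) (hW : 3 * (N + M + 1) ≤ W)
    (E : Encodes G N M (σ.arr 10) (σ.arr 11) (σ.arr 12) (σ.arr 13) (σ.arr 14) enc)
    (F : PeelSpec N M (σ.arr 11) (σ.arr 12) (σ.arr 20) (σ.arr 24) (σ.arr 25))
    (B : PeelSpec N M (σ.arr 12) (σ.arr 11) (σ.arr 30) (σ.arr 34) (σ.arr 35))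
    (h1 : ∀ i < N, ¬ (σ.arr 13 i ≠ σ.arr 14 i ∧ σ.arr 20 i ≠ 0))
    (h2 : ∀ e < M, ¬ (σ.arr 30 (σ.arr 11 e) ≠ 0 ∧ σ.arr 13 (σ.arr 11 e) = σ.arr 14 (σ.arr 11 e) ∧
      σ.arr 13 (σ.arr 12 e) ≠ σ.arr 14 (σ.arr 12 e))) :
    HaltsWithin W S phaseThree σ (fun τ => ∃ o, τ.Holds o ∧ G.AlgorithmOutput o) := by
  have hp1 := E.not_phaseOne F h1
  have hp2 := E.not_phaseTwo B h2
  refine HaltsWithin.seq hσ (findLongest_halts hσ hN (by omega) hW F.h_le B.h_le) ?_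
  intro σ₁ hσ₁ hf₁ hpost
  have g : ∀ x, x ≠ 12 → x ≠ 20 → x ≠ 21 → σ₁.reg x = σ.reg x := fun x _ _ _ =>
    hf₁.1 x (by simp [findLongest, forLoop, wregs]; omega)
  have ga : ∀ a, σ₁.arr a = σ.arr a := fun a =>
    hf₁.2 a (by simp [findLongest, forLoop, warrs])
  refine HaltsWithin.ite (by omega) hσ₁ trivial ?_ ?_
  · intro h20
    rcases hpost with ⟨h, -⟩ | ⟨i, hi, hi20, hid, hL, hmax⟩
    · exact absurd h h20
    obtain ⟨q, rfl⟩ := E.surj i hi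
    obtain ⟨y, hyq, hadj, hyB, hyF⟩ := exists_walk_of_peelSpecs E F B q
    have hB := B.h_le _ hi
    have hF := F.h_le _ hi
    set b := σ.arr 34 (enc q)
    set f := σ.arr 24 (enc q)
    refine HaltsWithin.seq (Q := fun τ => τ = σ₁.setReg 18 (b + 1)) hσ₁
      (.of_safe (by omega) hσ₁ ?_ ?_) ?_
    · simp [Safe, Term.Ok, Term.val, hi20, ga]; omega
    · simp [exec, Term.val, hi20, ga, b]
    rintro _ hσ₂ - rfl
    refine HaltsWithin.seq (Q := fun τ => τ = (σ₁.setReg 18 (b + 1)).setReg 19 (f + 1)) hσ₂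
      (.of_safe (by omega) hσ₂ ?_ ?_) ?_
    · simp [Safe, Term.Ok, Term.val, hi20, State.setReg, ga]; omega
    · simp [exec, Term.val, hi20, ga, f, State.setReg]
    clear hσ₂
    rintro _ hσ₂ - rfl
    set σ₂ := (σ₁.setReg 18 (b + 1)).setReg 19 (f + 1) with hσ₂'
    have e18 : σ₂.reg 18 = b + 1 := by simp [hσ₂', State.setReg]
    have e19 : σ₂.reg 19 = f + 1 := by simp [hσ₂', State.setReg]
    have e20 : σ₂.reg 20 = enc q + 1 := by simp [hσ₂', State.setReg, hi20]
    have e21 : σ₂.reg 21 = b + f + 1 := by simp [hσ₂', State.setReg, hL]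
    have ea : ∀ a, σ₂.arr a = σ.arr a := fun a => ga a
    refine HaltsWithin.seq hσ₂ (trace_halts (ptr := 35) (a := 43) hσ₂ (by omega) (by omega)
      (by decide) (by decide) (by decide)) ?_
    intro σ₃ hσ₃ hf₃ ht₃
    have g₃ : ∀ x, x ≠ 12 → x ≠ 16 → σ₃.reg x = σ₂.reg x := fun x _ _ =>
      hf₃.1 x (by simp [trace, forLoop, wregs]; omega)
    have ga₃ : ∀ a, a ≠ 43 → σ₃.arr a = σ.arr a := fun a ha =>
      (hf₃.2 a (by simpa [trace, forLoop, warrs] using ha)).trans (ea a)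
    have k19 : σ₃.reg 19 = f + 1 := by rw [g₃ 19 (by decide) (by decide), e19]
    refine HaltsWithin.seq hσ₃ (trace_halts (ptr := 25) (a := 44) hσ₃ (by omega) (by omega)
      (by decide) (by decide) (by decide)) ?_
    intro σ₄ hσ₄ hf₄ ht₄
    have g₄ : ∀ x, x ≠ 12 → x ≠ 16 → σ₄.reg x = σ₂.reg x := fun x h h' =>
      (hf₄.1 x (by simp [trace, forLoop, wregs]; omega)).trans (g₃ x h h')
    have ga₄ : ∀ a, a ≠ 44 → σ₄.arr a = σ₃.arr a := fun a ha =>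
      hf₄.2 a (by simpa [trace, forLoop, warrs] using ha)
    have l18 : σ₄.reg 18 = b + 1 := by rw [g₄ 18 (by decide) (by decide), e18]
    have l21 : σ₄.reg 21 = b + f + 1 := by rw [g₄ 21 (by decide) (by decide), e21]
    have l10 : σ₄.arr 10 = σ.arr 10 := by rw [ga₄ 10 (by decide), ga₃ 10 (by decide)]
    -- arrays 43 and 44 hold the two halves of the walk `y`
    have hleft : ∀ k ≤ b, σ₄.arr 10 (σ₄.arr 43 (b - k)) = G.self.label (y k) := by
      intro k hk
      rw [l10, ga₄ 43 (by decide), ht₃ (b - k) (by omega), ea, e20, Nat.add_sub_cancel,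
        ← hyB k hk, E.lab_enc]
    have hright : ∀ k ≤ f, σ₄.arr 10 (σ₄.arr 44 k) = G.self.label (y (b + k)) := by
      intro k hk
      rw [l10, ht₄ k (by omega), ga₃ 25 (by decide), g₃ 20 (by decide) (by decide), e20,
        Nat.add_sub_cancel, ← hyF k hk, E.lab_enc]
    refine HaltsWithin.seq hσ₄ (fill_halts (a := 0) (fun j => G.self.label (y j)) hσ₄ (by omega)
      (by omega) (by decide) rfl ?_) ?_
    · intro k τ hk hf hi
      have f10 : τ.arr 10 = σ₄.arr 10 := hf.2 10 (by decide)
      have f43 : τ.arr 43 = σ₄.arr 43 := hf.2 43 (by decide)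
      have f44 : τ.arr 44 = σ₄.arr 44 := hf.2 44 (by decide)
      have f18 : τ.reg 18 = b + 1 := (hf.1 18 (by decide)).trans l18
      refine ⟨?_, ?_⟩
      · simp [Safe, Term.Ok, Term.val, hi]
        omega
      · by_cases hkb : k < b + 1
        · simp [exec, Term.val, hi, f18, hkb, f10, f43, hleft k (by omega)]
        · have := hright (k - b) (by omega)
          rw [show b + (k - b) = k by omega] at this
          simp [exec, Term.val, hi, f18, hkb, f10, f44, this]
    intro σ₅ hσ₅ hf₅ hout
    have m21 : σ₅.reg 21 = b + f + 1 := (hf₅.1 21 (by decide)).trans l21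
    rw [l21] at hout
    refine .of_safe (by omega) hσ₅ ?_ ?_
    · simp [Safe, Term.Ok]; omega
    · refine ⟨_, ?_, LabeledDigraph.output_finite_of_walk hp1 hp2 hadj
        ⟨b, by omega, by rw [hyq]; exact (E.diff_iff q).1 hid⟩
        (fun p hp => E.length_le F B h1 h2 (L := b + f + 1) ?_ hp)⟩
      · refine ⟨?_, holdsList_map_range ?_ ?_⟩
        · simp [exec, State.setReg, Term.val]
        · simp [exec, State.setReg, Term.val, m21]
        · simpa [exec, State.setReg] using hout
      · intro i hi hd
        rw [← hL]
        exact hmax i hi hd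
  · intro h20
    rcases hpost with ⟨-, hall⟩ | ⟨i, -, hi, -⟩
    · refine .of_safe (by omega) hσ₁ ?_ ⟨.finite [], ?_, .empty hp1 hp2 ?_⟩
      · simp [Safe, Term.Ok]; omega
      · simp [State.Holds, State.HoldsList, exec, State.setReg, Term.val]
      · ext q
        rw [← E.diff_iff]
        simpa using hall _ (E.lt q)
    · simp only [Term.val] at h20
      omega

/-- The algorithm for a given self-product, with a running time linear in its size. The factor 2 in
the number of rounds comes from the third phase, whose output is put together from two walks with at
most `N` edges each. -/
theorem solve_halts (hσ : σ.Bdd W) (hN : σ.reg 10 = N) (hM : σ.reg 11 = M)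
    (hS : 2 * (N + M + 1) ≤ S) (hW : 3 * (N + M + 1) ≤ W)
    (h0 : ∀ a, 20 ≤ a → a < 50 → σ.arr a = fun _ => 0)
    (E : Encodes G N M (σ.arr 10) (σ.arr 11) (σ.arr 12) (σ.arr 13) (σ.arr 14) enc) :
    HaltsWithin W S solve σ (fun τ => ∃ o, τ.Holds o ∧ G.AlgorithmOutput o) := by
  refine HaltsWithin.seq hσ (peel_halts hσ hN hM (by omega) (by omega) (by omega) (by omega)
    E.s_lt E.t_lt fun k hk => h0 _ (by omega) (by omega)) ?_
  intro σ₁ hσ₁ hf₁ F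
  have g₁ : ∀ x, x ∉ (peel 11 12 20).wregs → σ₁.reg x = σ.reg x := hf₁.1
  have ga₁ : ∀ a, a < 20 ∨ 26 ≤ a → σ₁.arr a = σ.arr a := fun a ha =>
    hf₁.2 a (by
      simp [peel, peelBuild, peelPush, peelMain, peelEdge, peelPop, forLoop, warrs]; omega)
  rw [← ga₁ 11 (by omega), ← ga₁ 12 (by omega)] at F
  rw [← ga₁ 10 (by omega), ← ga₁ 11 (by omega), ← ga₁ 12 (by omega), ← ga₁ 13 (by omega),
    ← ga₁ 14 (by omega)] at E
  refine HaltsWithin.seq hσ₁ (peel_halts (N := N) (M := M) hσ₁ ((g₁ 10 (by decide)).trans hN)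
    ((g₁ 11 (by decide)).trans hM) (by omega) (by omega) (by omega) (by omega)
    E.t_lt E.s_lt fun k hk => (ga₁ _ (by omega)).trans (h0 _ (by omega) (by omega))) ?_
  intro σ₂ hσ₂ hf₂ B
  have g₂ : ∀ x, x ∉ (peel 11 12 20).wregs → σ₂.reg x = σ.reg x := fun x hx =>
    (hf₂.1 x hx).trans (g₁ x hx)
  have ga₂ : ∀ a, a < 30 ∨ 36 ≤ a → σ₂.arr a = σ₁.arr a := fun a ha =>
    hf₂.2 a (by
      simp [peel, peelBuild, peelPush, peelMain, peelEdge, peelPop, forLoop, warrs]; omega)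
  rw [← ga₂ 11 (by omega), ← ga₂ 12 (by omega)] at B
  rw [← ga₂ 11 (by omega), ← ga₂ 12 (by omega), ← ga₂ 20 (by omega), ← ga₂ 24 (by omega),
    ← ga₂ 25 (by omega)] at F
  rw [← ga₂ 10 (by omega), ← ga₂ 11 (by omega), ← ga₂ 12 (by omega), ← ga₂ 13 (by omega),
    ← ga₂ 14 (by omega)] at E
  have hN₂ : σ₂.reg 10 = N := (g₂ 10 (by decide)).trans hN
  have hM₂ : σ₂.reg 11 = M := (g₂ 11 (by decide)).trans hM
  refine HaltsWithin.seq hσ₂ (search_halts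
    (fun i => σ₂.arr 13 i ≠ σ₂.arr 14 i ∧ σ₂.arr 20 i ≠ 0) hσ₂ (by omega) (by omega) (by decide)
    (by decide) ?_) ?_
  · intro k τ hk hr ha hi
    refine ⟨?_, ?_⟩
    · by_cases h : τ.arr 13 (τ.reg 12) = τ.arr 14 (τ.reg 12) <;>
        by_cases h' : τ.arr 20 (τ.reg 12) = 0 <;>
        simp [Term.Ok, Term.val, h, h', Nat.pos_iff_ne_zero] <;> omega
    · by_cases h : σ₂.arr 13 k = σ₂.arr 14 k <;> by_cases h' : σ₂.arr 20 k = 0 <;>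
        simp [Term.val, hi, ha, h, h', Nat.pos_iff_ne_zero]
  intro σ₃ hσ₃ hf₃ hs
  have ga₃ : ∀ a, σ₃.arr a = σ₂.arr a := fun a => hf₃.2 a (by simp [search, forLoop, warrs])
  have hN₃ : σ₃.reg 10 = N := (hf₃.1 10 (by decide)).trans hN₂
  have hM₃ : σ₃.reg 11 = M := (hf₃.1 11 (by decide)).trans hM₂
  simp only [← ga₃] at hs E F B
  have h41 : σ₃.arr 41 = fun _ => 0 := by
    rw [ga₃, ga₂ 41 (by omega), ga₁ 41 (by omega), h0 41 (by omega) (by omega)]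
  rw [hN₂] at hs
  refine HaltsWithin.ite (by omega) hσ₃ trivial ?_ ?_
  · intro h20
    rcases hs with ⟨h, -⟩ | ⟨i, hi, ⟨hd, hdeg⟩, hi20⟩
    · exact absurd h h20
    obtain ⟨q, rfl⟩ := E.surj i hi
    exact phaseOne_halts hσ₃ hM₃ (by omega) (by omega) h41 E F ((E.diff_iff q).1 hd) hdeg hi20
  · intro h20
    rcases hs with ⟨-, h1⟩ | ⟨i, -, -, hi⟩
    swap
    · simp only [Term.val] at h20
      omega
    refine HaltsWithin.seq hσ₃ (search_halts (fun e => σ₃.arr 30 (σ₃.arr 11 e) ≠ 0 ∧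
      σ₃.arr 13 (σ₃.arr 11 e) = σ₃.arr 14 (σ₃.arr 11 e) ∧
      σ₃.arr 13 (σ₃.arr 12 e) ≠ σ₃.arr 14 (σ₃.arr 12 e)) hσ₃ (by omega) (by omega) (by decide)
      (by decide) ?_) ?_
    · intro k τ hk hr ha hi
      refine ⟨?_, ?_⟩
      · by_cases h : τ.arr 13 (τ.arr 11 (τ.reg 12)) = τ.arr 14 (τ.arr 11 (τ.reg 12)) <;>
          by_cases h' : τ.arr 30 (τ.arr 11 (τ.reg 12)) = 0 <;>
          by_cases h'' : τ.arr 13 (τ.arr 12 (τ.reg 12)) = τ.arr 14 (τ.arr 12 (τ.reg 12)) <;>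
          simp [Term.Ok, Term.val, h, h', h'', Nat.pos_iff_ne_zero] <;> omega
      · by_cases h : σ₃.arr 13 (σ₃.arr 11 k) = σ₃.arr 14 (σ₃.arr 11 k) <;>
          by_cases h' : σ₃.arr 30 (σ₃.arr 11 k) = 0 <;>
          by_cases h'' : σ₃.arr 13 (σ₃.arr 12 k) = σ₃.arr 14 (σ₃.arr 12 k) <;>
          simp [Term.val, hi, ha, h, h', h'', Nat.pos_iff_ne_zero]
    intro σ₄ hσ₄ hf₄ hs
    have ga₄ : ∀ a, σ₄.arr a = σ₃.arr a := fun a => hf₄.2 a (by simp [search, forLoop, warrs])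
    have hN₄ : σ₄.reg 10 = N := (hf₄.1 10 (by decide)).trans hN₃
    have hM₄ : σ₄.reg 11 = M := (hf₄.1 11 (by decide)).trans hM₃
    simp only [← ga₄] at hs E F B h1 h41
    rw [hM₃] at hs
    refine HaltsWithin.ite (by omega) hσ₄ trivial ?_ ?_
    · intro h20
      rcases hs with ⟨h, -⟩ | ⟨e, he, ⟨hdeg, hsrc, htgt⟩, he20⟩
      · exact absurd h h20
      exact phaseTwo_halts hσ₄ hM₄ (by omega) (by omega) h41 E B (E.not_phaseOne F h1) he hdeg
        hsrc htgt he20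
    · intro h20
      rcases hs with ⟨-, h2⟩ | ⟨e, -, -, he⟩
      · exact phaseThree_halts hσ₄ hN₄ hS hW E F B h1 h2
      · simp only [Term.val] at h20
        omega

/-! ### Linear time from the self-product -/

theorem inputState_bdd {regs : List ℕ} {arrs : List (List ℕ)} (hW : 0 < W)
    (hr : ∀ x ∈ regs, x < W) (ha : ∀ l ∈ arrs, ∀ x ∈ l, x < W) :
    (inputState regs arrs).Bdd W := by
  have key : ∀ (l : List ℕ) (i : ℕ), (∀ x ∈ l, x < W) → l.getD i 0 < W := by
    intro l i hl
    rw [List.getD_eq_getElem?_getD]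
    rcases lt_or_ge i l.length with h | h
    · rw [List.getElem?_eq_getElem h]
      exact hl _ (List.getElem_mem h)
    · rw [List.getElem?_eq_none h]
      exact hW
  refine ⟨fun x => key regs x hr, fun a i => key _ i ?_⟩
  rw [List.getD_eq_getElem?_getD]
  rcases lt_or_ge a arrs.length with h | h
  · rw [List.getElem?_eq_getElem h]
    exact ha _ (List.getElem_mem h)
  · rw [List.getElem?_eq_none h]
    simp

/-- Copy the first cells of array `a`, as many as register `n` tells, to array `b`. -/
def copy (a b n : ℕ) : Program :=
  forLoop 12 n (write b (reg 12) (read a (reg 12)))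

theorem copy_halts {a b n : ℕ} (hσ : σ.Bdd W) (hS : σ.reg n + 1 ≤ S)
    (hW : 1 < W) (hab : a ≠ b) (hn : n ≠ 12) :
    HaltsWithin W S (copy a b n) σ (fun τ => ∀ k < σ.reg n, τ.arr b k = σ.arr a k) := by
  refine fill_halts (σ.arr a) hσ hS hW hn rfl ?_
  intro k τ hk hf hi
  have ea : τ.arr a = σ.arr a := hf.2 a (by simpa [warrs] using hab)
  simp [Safe, exec, Term.Ok, Term.val, hi, ea]

/-- The algorithm on a list of the vertices and a list of the edges of the self-product. -/
def solveProduct : Program :=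
  assign 10 (reg 0) ;;
  assign 11 (reg 1) ;;
  copy 0 10 10 ;;
  copy 1 11 11 ;;
  copy 2 12 11 ;;
  copy 3 13 10 ;;
  copy 4 14 10 ;;
  solve

theorem encodes_of_lists {n : ℕ} {G : LabeledDigraph (Fin n) ℕ} {vs : List G.SelfVertex}
    {es : List (Fin vs.length × Fin vs.length)} (H : Lists G.self vs es)
    {lab s t c₁ c₂ : ℕ → ℕ} (hlab : ∀ i (h : i < vs.length), lab i = G.self.label vs[i])
    (hs : ∀ e (h : e < es.length), s e = es[e].1) (ht : ∀ e (h : e < es.length), t e = es[e].2)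
    (h₁ : ∀ i (h : i < vs.length), c₁ i = vs[i].1.1)
    (h₂ : ∀ i (h : i < vs.length), c₂ i = vs[i].1.2) :
    Encodes G vs.length es.length lab s t c₁ c₂ (fun q => vs.idxOf q) := by
  have hlt : ∀ q, vs.idxOf q < vs.length := fun q => List.idxOf_lt_length_of_mem (H.mem_vs q)
  have hget : ∀ q, vs[vs.idxOf q]'(hlt q) = q := fun q => List.getElem_idxOf (hlt q)
  refine ⟨⟨?_, hlt, ?_, ?_, ?_, ?_⟩, ?_, ?_⟩
  · intro q r h
    have h' : vs.idxOf q = vs.idxOf r := h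
    rw [← hget q, ← hget r]
    simp only [h']
  · intro i hi
    exact ⟨vs[i], H.nodup_vs.idxOf_getElem i hi⟩
  · intro e he
    rw [hs e he]
    exact es[e].1.2
  · intro e he
    rw [ht e he]
    exact es[e].2.2
  · intro q r
    have := H.mem_es ⟨_, hlt q⟩ ⟨_, hlt r⟩
    simp only [List.get_eq_getElem, hget] at this
    rw [← this, List.mem_iff_getElem]
    constructor
    · rintro ⟨e, he, h⟩
      exact ⟨e, he, by rw [hs e he, h], by rw [ht e he, h]⟩
    · rintro ⟨e, he, h, h'⟩
      rw [hs e he] at h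
      rw [ht e he] at h'
      exact ⟨e, he, Prod.ext (Fin.ext h) (Fin.ext h')⟩
  · intro q
    rw [hlab _ (hlt q), hget]
  · intro q
    rw [h₁ _ (hlt q), h₂ _ (hlt q), hget]
    simp [LabeledDigraph.Vdiff, Fin.ext_iff]

theorem solveProduct_halts {n : ℕ} {G : LabeledDigraph (Fin n) ℕ} {vs : List G.SelfVertex}
    {es : List (Fin vs.length × Fin vs.length)} (H : Lists G.self vs es)
    (hW : 3 * (vs.length + es.length + 1) ≤ W) (hl : ∀ v, G.label v < W) :
    HaltsWithin W (2 * (vs.length + es.length + 1)) solveProduct (productInput G vs es)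
      (fun τ => ∃ o, τ.Holds o ∧ G.AlgorithmOutput o) := by
  set σ := productInput G vs es with hσd
  -- The components are words because the diagonal alone has `n` vertices.
  have hn : n ≤ vs.length := by
    have := Fintype.card_le_of_injective
      (fun v : Fin n => (⟨vs.idxOf (G.diag v), List.idxOf_lt_length_of_mem (H.mem_vs _)⟩ :
        Fin vs.length))
      (by
        intro u v h
        have h' := (List.idxOf_inj (H.mem_vs _)).1 (Fin.ext_iff.1 h)
        exact congrArg (fun q => q.1.1) h')
    simpa using this
  have hσ : σ.Bdd W := by
    refine inputState_bdd (by omega) ?_ ?_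
    · simp; omega
    · simp only [List.mem_cons, List.not_mem_nil, or_false]
      rintro l (rfl | rfl | rfl | rfl | rfl) x hx <;> rw [List.mem_map] at hx <;>
        obtain ⟨q, -, rfl⟩ := hx
      · exact hl _
      · exact lt_of_lt_of_le q.1.2 (by omega)
      · exact lt_of_lt_of_le q.2.2 (by omega)
      · exact lt_of_lt_of_le q.1.1.2 (by omega)
      · exact lt_of_lt_of_le q.1.2.2 (by omega)
  have r0 : σ.reg 0 = vs.length := rfl
  have r1 : σ.reg 1 = es.length := rfl
  refine HaltsWithin.seq (Q := fun τ => τ = σ.setReg 10 vs.length) hσ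
    (.of_safe (by omega) hσ (by simp [Safe, Term.Ok]) (by simp [exec, Term.val, r0])) ?_
  rintro _ hσ₁ - rfl
  refine HaltsWithin.seq (Q := fun τ => τ = (σ.setReg 10 vs.length).setReg 11 es.length) hσ₁
    (.of_safe (by omega) hσ₁ (by simp [Safe, Term.Ok])
      (by simp [exec, Term.val, State.setReg, r1])) ?_
  rintro _ hσ₂ - rfl
  set σ₀ := (σ.setReg 10 vs.length).setReg 11 es.length with hσ₀
  have e10 : σ₀.reg 10 = vs.length := by simp [hσ₀, State.setReg]
  have e11 : σ₀.reg 11 = es.length := by simp [hσ₀, State.setReg]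
  have ea : ∀ a, σ₀.arr a = σ.arr a := fun _ => rfl
  refine HaltsWithin.seq hσ₂ (copy_halts hσ₂ (by omega) (by omega) (by decide) (by decide)) ?_
  intro τ₁ hτ₁ f₁ p₁
  have a10 : τ₁.reg 10 = vs.length := (f₁.1 10 (by decide)).trans e10
  have a11 : τ₁.reg 11 = es.length := (f₁.1 11 (by decide)).trans e11
  refine HaltsWithin.seq hτ₁ (copy_halts hτ₁ (by omega) (by omega) (by decide) (by decide)) ?_
  intro τ₂ hτ₂ f₂ p₂
  have b10 : τ₂.reg 10 = vs.length := (f₂.1 10 (by decide)).trans a10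
  have b11 : τ₂.reg 11 = es.length := (f₂.1 11 (by decide)).trans a11
  refine HaltsWithin.seq hτ₂ (copy_halts hτ₂ (by omega) (by omega) (by decide) (by decide)) ?_
  intro τ₃ hτ₃ f₃ p₃
  have c10 : τ₃.reg 10 = vs.length := (f₃.1 10 (by decide)).trans b10
  have c11 : τ₃.reg 11 = es.length := (f₃.1 11 (by decide)).trans b11
  refine HaltsWithin.seq hτ₃ (copy_halts hτ₃ (by omega) (by omega) (by decide) (by decide)) ?_
  intro τ₄ hτ₄ f₄ p₄
  have d10 : τ₄.reg 10 = vs.length := (f₄.1 10 (by decide)).trans c10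
  have d11 : τ₄.reg 11 = es.length := (f₄.1 11 (by decide)).trans c11
  refine HaltsWithin.seq hτ₄ (copy_halts hτ₄ (by omega) (by omega) (by decide) (by decide)) ?_
  intro τ₅ hτ₅ f₅ p₅
  rw [e10] at p₁
  rw [a11] at p₂
  rw [b11] at p₃
  rw [c10] at p₄
  rw [d10] at p₅
  have g₁ : ∀ a, a ≠ 10 → τ₁.arr a = σ.arr a := fun a h =>
    f₁.2 a (by simpa [copy, forLoop, warrs] using h)
  have g₂ : ∀ a, a ≠ 11 → τ₂.arr a = τ₁.arr a := fun a h =>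
    f₂.2 a (by simpa [copy, forLoop, warrs] using h)
  have g₃ : ∀ a, a ≠ 12 → τ₃.arr a = τ₂.arr a := fun a h =>
    f₃.2 a (by simpa [copy, forLoop, warrs] using h)
  have g₄ : ∀ a, a ≠ 13 → τ₄.arr a = τ₃.arr a := fun a h =>
    f₄.2 a (by simpa [copy, forLoop, warrs] using h)
  have g₅ : ∀ a, a ≠ 14 → τ₅.arr a = τ₄.arr a := fun a h =>
    f₅.2 a (by simpa [copy, forLoop, warrs] using h)
  refine solve_halts hτ₅ ((f₅.1 10 (by decide)).trans d10)
    ((f₅.1 11 (by decide)).trans d11) le_rfl hW ?_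
    (encodes_of_lists H ?_ ?_ ?_ ?_ ?_)
  · intro a ha _
    rw [g₅ _ (by omega), g₄ _ (by omega), g₃ _ (by omega), g₂ _ (by omega), g₁ _ (by omega)]
    funext i
    have : ¬ a < 5 := by omega
    simp [hσd, productInput, inputState, List.getD_eq_getElem?_getD, this]
  · intro i hi
    rw [g₅ _ (by omega), g₄ _ (by omega), g₃ _ (by omega), g₂ _ (by omega), p₁ i hi, ea]
    simp [hσd, productInput, inputState, hi]
  · intro i hi
    rw [g₅ _ (by omega), g₄ _ (by omega), g₃ _ (by omega), p₂ i hi, g₁ _ (by omega)]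
    simp [hσd, productInput, inputState, hi]
  · intro i hi
    rw [g₅ _ (by omega), g₄ _ (by omega), p₃ i hi, g₂ _ (by omega), g₁ _ (by omega)]
    simp [hσd, productInput, inputState, hi]
  · intro i hi
    rw [g₅ _ (by omega), p₄ i hi, g₃ _ (by omega), g₂ _ (by omega), g₁ _ (by omega)]
    simp [hσd, productInput, inputState, hi]
  · intro i hi
    rw [p₅ i hi, g₄ _ (by omega), g₃ _ (by omega), g₂ _ (by omega), g₁ _ (by omega)]
    simp [hσd, productInput, inputState, hi]

/-! ### Quadratic time from the graph -/

/-- Run `P` for all pairs of numbers below register `n`: the pair stands in registers 13 and 14, and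
register 12 counts the rounds. -/
def pairLoop (n : ℕ) (P : Program) : Program :=
  assign 13 (const 0) ;;
  assign 14 (const 0) ;;
  assign 15 (mul (reg n) (reg n)) ;;
  forLoop 12 15
    (P ;;
      assign 14 (add (reg 14) (const 1)) ;;
      ite (eq (reg 14) (reg n)) (assign 14 (const 0) ;; assign 13 (add (reg 13) (const 1))) skip)

theorem pairLoop_halts {n d : ℕ} {P : Program} (I : ℕ → State → Prop) (hσ : σ.Bdd W)
    (hd : σ.reg n = d) (hS : d * d + 1 ≤ S) (hW : d * d + 2 ≤ W) (hn : n < 12)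
    (hP : ∀ x ∈ P.wregs, x < 12) (hnP : n ∉ P.wregs)
    (hI : ∀ k τ τ', (∀ x, x < 12 → τ.reg x = τ'.reg x) → τ.arr = τ'.arr → I k τ → I k τ')
    (h0 : I 0 σ)
    (hstep : ∀ k τ, k < d * d → τ.Bdd W →
      (∀ x, x < 12 → x ∉ P.wregs → τ.reg x = σ.reg x) → (∀ a, a ∉ P.warrs → τ.arr a = σ.arr a) →
      τ.reg 12 = k → τ.reg 13 = k / d → τ.reg 14 = k % d → I k τ →
      P.Safe W τ ∧ I (k + 1) (P.exec τ)) :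
    HaltsWithin W S (pairLoop n P) σ (I (d * d)) := by
  have hW0 : 0 < W := by omega
  refine HaltsWithin.seq (Q := fun τ => τ = σ.setReg 13 0) hσ
    (.of_safe (by omega) hσ (by simpa [Safe, Term.Ok] using hW0) rfl) ?_
  rintro _ hσ₁ - rfl
  refine HaltsWithin.seq (Q := fun τ => τ = (σ.setReg 13 0).setReg 14 0) hσ₁
    (.of_safe (by omega) hσ₁ (by simpa [Safe, Term.Ok] using hW0) rfl) ?_
  clear hσ₁
  rintro _ hσ₂ - rfl
  have hn0 : ∀ y, 12 ≤ y → n ≠ y := fun y hy => by omega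
  refine HaltsWithin.seq (Q := fun τ => τ = ((σ.setReg 13 0).setReg 14 0).setReg 15 (d * d)) hσ₂
    (.of_safe (by omega) hσ₂ ?_ ?_) ?_
  · simp [Safe, Term.Ok, Term.val, State.setReg, hn0, hd]; omega
  · simp [exec, Term.val, State.setReg, hn0, hd]
  clear hσ₂
  rintro _ hσ₃ - rfl
  set σ₃ := ((σ.setReg 13 0).setReg 14 0).setReg 15 (d * d) with hσ₃d
  have e15 : σ₃.reg 15 = d * d := by simp [hσ₃d, State.setReg]
  have elt : ∀ x, x < 12 → σ₃.reg x = σ.reg x := fun x hx => by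
    simp [hσ₃d, State.setReg, show x ≠ 13 by omega, show x ≠ 14 by omega, show x ≠ 15 by omega]
  have := HaltsWithin.forLoop (W := W) (S := S) (i := 12) (n := 15) (σ := σ₃)
    (P := P ;; assign 14 (add (reg 14) (const 1)) ;;
      ite (eq (reg 14) (reg n)) (assign 14 (const 0) ;; assign 13 (add (reg 13) (const 1))) skip)
    (fun k τ => τ.reg 13 = k / d ∧ τ.reg 14 = k % d ∧ I k τ) hσ₃ (by omega) (by omega) (by decide)
    (by simpa [wregs] using fun h => absurd (hP _ h) (by decide))
    (by simpa [wregs] using fun h => absurd (hP _ h) (by decide)) ?_ ?_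
  · rw [e15] at this
    exact this.mono hσ₃ fun τ _ _ h => h.2.2
  · refine ⟨by simp [hσ₃d, State.setReg], by simp [hσ₃d, State.setReg], hI 0 σ _ ?_ rfl h0⟩
    intro x hx
    rw [← elt x hx]
    simp [State.setReg, show x ≠ 12 by omega]
  · rintro k τ hk hτ hf hi ⟨h13, h14, hIk⟩
    rw [e15] at hk
    have hdpos : 0 < d := Nat.pos_of_ne_zero (by rintro rfl; simp at hk)
    have hmod : k % d < d := Nat.mod_lt _ hdpos
    have hdiv : k / d < d := Nat.div_lt_of_lt_mul hk
    have hreg : ∀ x, x < 12 → x ∉ P.wregs → τ.reg x = σ.reg x := by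
      intro x hx hxP
      rw [hf.1 x (by simp [wregs, hxP]; omega), ← elt x hx]
      simp [State.setReg, show x ≠ 12 by omega]
    obtain ⟨hs, hI'⟩ := hstep k τ hk hτ hreg
      (fun a ha => hf.2 a (by simpa [warrs] using ha)) hi h13 h14 hIk
    obtain ⟨_, _, hr⟩ := hs.runs hτ
    have q13 : (P.exec τ).reg 13 = k / d :=
      (hr.frame.1 13 fun h => absurd (hP _ h) (by decide)).trans h13
    have q14 : (P.exec τ).reg 14 = k % d :=
      (hr.frame.1 14 fun h => absurd (hP _ h) (by decide)).trans h14
    have qn : (P.exec τ).reg n = d := (hr.frame.1 n hnP).trans ((hreg n hn hnP).trans hd)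
    have hdd : d ≤ d * d := Nat.le_mul_self d
    have hk1 : k + 1 = d * (k / d) + (k % d + 1) := by
      have := Nat.div_add_mod k d
      omega
    by_cases hwrap : k % d + 1 = d
    · have hx : (P ;; assign 14 (add (reg 14) (const 1)) ;;
          ite (eq (reg 14) (reg n)) (assign 14 (const 0) ;; assign 13 (add (reg 13) (const 1)))
            skip).exec τ =
          (((P.exec τ).setReg 14 d).setReg 14 0).setReg 13 (k / d + 1) := by
        simp [exec, Term.val, State.setReg, q13, q14, qn, hn0, hwrap]
      have h1 : (k + 1) / d = k / d + 1 := by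
        rw [hk1, hwrap, ← Nat.mul_succ, Nat.mul_div_cancel_left _ hdpos]
      have h2 : (k + 1) % d = 0 := by
        rw [hk1, hwrap, ← Nat.mul_succ, Nat.mul_mod_right]
      rw [hx, h1, h2]
      refine ⟨⟨hs, ?_⟩, ?_, ?_, hI _ (P.exec τ) _ ?_ rfl hI'⟩
      · simp [Safe, Term.Ok, Term.val, exec, State.setReg, q13, q14, qn, hn0, hwrap]
        omega
      · simp [State.setReg]
      · simp [State.setReg]
      · intro x hx
        simp [State.setReg, show x ≠ 12 by omega, show x ≠ 13 by omega, show x ≠ 14 by omega]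
    · have hx : (P ;; assign 14 (add (reg 14) (const 1)) ;;
          ite (eq (reg 14) (reg n)) (assign 14 (const 0) ;; assign 13 (add (reg 13) (const 1)))
            skip).exec τ = (P.exec τ).setReg 14 (k % d + 1) := by
        simp [exec, Term.val, State.setReg, q14, qn, hn0, hwrap]
      have h1 : (k + 1) / d = k / d := by
        rw [hk1, Nat.mul_add_div hdpos, Nat.div_eq_of_lt (show k % d + 1 < d by omega),
          Nat.add_zero]
      have h2 : (k + 1) % d = k % d + 1 := by
        rw [hk1, Nat.mul_add_mod, Nat.mod_eq_of_lt (show k % d + 1 < d by omega)]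
      rw [hx, h1, h2]
      refine ⟨⟨hs, ?_⟩, ?_, ?_, hI _ (P.exec τ) _ ?_ rfl hI'⟩
      · simp [Safe, Term.Ok, Term.val, exec, State.setReg, q14, qn, hn0, hwrap]
        omega
      · simp [State.setReg, q13]
      · simp [State.setReg]
      · intro x hx
        simp [State.setReg, show x ≠ 12 by omega, show x ≠ 14 by omega]

/-- The two vertices in registers 13 and 14 become the next vertex of the self-product if they have
the same label. Register 10 counts these vertices, and array 50 gets their numbers. -/
def addVertex : Program :=
  ite (eq (read 0 (reg 13)) (read 0 (reg 14)))
    (write 50 (reg 12) (reg 10) ;;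
      write 13 (reg 10) (reg 13) ;;
      write 14 (reg 10) (reg 14) ;;
      write 10 (reg 10) (read 0 (reg 13)) ;;
      assign 10 (add (reg 10) (const 1)))
    skip

/-- The two edges in registers 13 and 14 become the next edge of the self-product if their sources
have the same label and so have their targets. Register 11 counts these edges. -/
def addEdge : Program :=
  ite (eq (read 0 (read 1 (reg 13))) (read 0 (read 1 (reg 14))))
    (ite (eq (read 0 (read 2 (reg 13))) (read 0 (read 2 (reg 14))))
      (write 11 (reg 11) (read 50 (add (mul (read 1 (reg 13)) (reg 0)) (read 1 (reg 14)))) ;;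
        write 12 (reg 11) (read 50 (add (mul (read 2 (reg 13)) (reg 0)) (read 2 (reg 14)))) ;;
        assign 11 (add (reg 11) (const 1)))
      skip)
    skip

/-- List the vertices of the self-product. Array 50 becomes a square matrix with the numbers of the
pairs of vertices that have the same label. -/
def buildVertices : Program :=
  assign 10 (const 0) ;; pairLoop 0 addVertex

/-- List the edges of the self-product. -/
def buildEdges : Program :=
  assign 11 (const 0) ;; pairLoop 1 addEdge

/-- The algorithm on a list of the vertices and a list of the edges of the graph. -/
def solveGraph : Program :=
  buildVertices ;; buildEdges ;; solve

theorem buildVertices_halts {n : ℕ} (hσ : σ.Bdd W) (hn : σ.reg 0 = n) (hS : n * n + 1 ≤ S)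
    (hW : n * n + 2 ≤ W) :
    HaltsWithin W S buildVertices σ (fun τ => τ.reg 10 ≤ n * n ∧
      (∀ k < n * n, σ.arr 0 (k / n) = σ.arr 0 (k % n) → τ.arr 50 k < τ.reg 10 ∧
        τ.arr 13 (τ.arr 50 k) = k / n ∧ τ.arr 14 (τ.arr 50 k) = k % n ∧
        τ.arr 10 (τ.arr 50 k) = σ.arr 0 (k / n)) ∧
      ∀ i < τ.reg 10, ∃ k < n * n, σ.arr 0 (k / n) = σ.arr 0 (k % n) ∧ τ.arr 50 k = i) := by
  have hW0 : 0 < W := by omega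
  refine HaltsWithin.seq (Q := fun τ => τ = σ.setReg 10 0) hσ
    (.of_safe (by omega) hσ (by simpa [Safe, Term.Ok] using hW0) rfl) ?_
  rintro _ hσ₁ - rfl
  refine pairLoop_halts (d := n) (fun k τ => τ.reg 10 ≤ k ∧
      (∀ j < k, σ.arr 0 (j / n) = σ.arr 0 (j % n) → τ.arr 50 j < τ.reg 10 ∧
        τ.arr 13 (τ.arr 50 j) = j / n ∧ τ.arr 14 (τ.arr 50 j) = j % n ∧
        τ.arr 10 (τ.arr 50 j) = σ.arr 0 (j / n)) ∧
      ∀ i < τ.reg 10, ∃ j < k, σ.arr 0 (j / n) = σ.arr 0 (j % n) ∧ τ.arr 50 j = i)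
    hσ₁ (by simp [State.setReg, hn]) hS hW (by decide) (by decide) (by decide) ?_ ?_ ?_
  · intro k τ τ' hr ha h
    rw [← ha, ← hr 10 (by decide)]
    exact h
  · simp [State.setReg]
  · rintro k τ hk hτ hr ha h12 h13 h14 ⟨hle, h1, h2⟩
    have e0 : τ.arr 0 = σ.arr 0 := ha 0 (by decide)
    by_cases hl : σ.arr 0 (k / n) = σ.arr 0 (k % n)
    · simp [addVertex, Safe, exec, Term.Ok, Term.val, State.setReg, State.setArr, h12, h13, h14, e0,
        hl]
      refine ⟨⟨by omega, by omega⟩, by omega, ?_, ?_⟩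
      · intro j hj hjl
        by_cases hjk : j = k
        · subst hjk
          simp [hl]
        · obtain ⟨g1, g2, g3, g4⟩ := h1 j (by omega) hjl
          have : τ.arr 50 j ≠ τ.reg 10 := by omega
          simp only [Function.update_of_ne hjk, Function.update_of_ne this]
          exact ⟨by omega, g2, g3, g4⟩
      · intro i hi
        rcases Nat.lt_succ_iff_lt_or_eq.1 (Nat.lt_succ_of_le hi) with hi | rfl
        · obtain ⟨j, hj, hjl, hji⟩ := h2 i hi
          exact ⟨j, by omega, hjl, by rw [Function.update_of_ne (by omega)]; exact hji⟩
        · exact ⟨k, by omega, hl, by simp⟩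
    · simp [addVertex, Safe, exec, Term.Ok, Term.val, h13, h14, e0, hl]
      refine ⟨by omega, by omega, ?_, ?_⟩
      · intro j hj hjl
        have : j ≠ k := by rintro rfl; exact hl hjl
        exact h1 j (by omega) hjl
      · intro i hi
        obtain ⟨j, hj, h⟩ := h2 i hi
        exact ⟨j, by omega, h⟩

theorem buildEdges_halts {n m : ℕ} (hσ : σ.Bdd W) (hn : σ.reg 0 = n) (hm : σ.reg 1 = m)
    (hS : m * m + 1 ≤ S) (hW : m * m + 2 ≤ W) (hWn : n * n < W) (hs : ∀ e < m, σ.arr 1 e < n)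
    (ht : ∀ e < m, σ.arr 2 e < n) :
    HaltsWithin W S buildEdges σ (fun τ => τ.reg 11 ≤ m * m ∧
      (∀ e < m, ∀ f < m, σ.arr 0 (σ.arr 1 e) = σ.arr 0 (σ.arr 1 f) →
        σ.arr 0 (σ.arr 2 e) = σ.arr 0 (σ.arr 2 f) → ∃ g < τ.reg 11,
          τ.arr 11 g = σ.arr 50 (σ.arr 1 e * n + σ.arr 1 f) ∧
          τ.arr 12 g = σ.arr 50 (σ.arr 2 e * n + σ.arr 2 f)) ∧
      ∀ g < τ.reg 11, ∃ e < m, ∃ f < m, σ.arr 0 (σ.arr 1 e) = σ.arr 0 (σ.arr 1 f) ∧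
        σ.arr 0 (σ.arr 2 e) = σ.arr 0 (σ.arr 2 f) ∧
          τ.arr 11 g = σ.arr 50 (σ.arr 1 e * n + σ.arr 1 f) ∧
          τ.arr 12 g = σ.arr 50 (σ.arr 2 e * n + σ.arr 2 f)) := by
  have hW0 : 0 < W := by omega
  refine HaltsWithin.seq (Q := fun τ => τ = σ.setReg 11 0) hσ
    (.of_safe (by omega) hσ (by simpa [Safe, Term.Ok] using hW0) rfl) ?_
  rintro _ hσ₁ - rfl
  -- what the invariant says about the edge `g` of the product that comes from round `k`
  let R : ℕ → State → ℕ → Prop := fun k τ g =>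
    τ.arr 11 g = σ.arr 50 (σ.arr 1 (k / m) * n + σ.arr 1 (k % m)) ∧
      τ.arr 12 g = σ.arr 50 (σ.arr 2 (k / m) * n + σ.arr 2 (k % m))
  let C : ℕ → Prop := fun k => σ.arr 0 (σ.arr 1 (k / m)) = σ.arr 0 (σ.arr 1 (k % m)) ∧
    σ.arr 0 (σ.arr 2 (k / m)) = σ.arr 0 (σ.arr 2 (k % m))
  refine (pairLoop_halts (d := m) (fun k τ => τ.reg 11 ≤ k ∧
      (∀ j < k, C j → ∃ g < τ.reg 11, R j τ g) ∧ ∀ g < τ.reg 11, ∃ j < k, C j ∧ R j τ g)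
    hσ₁ (by simp [State.setReg, hm]) hS hW (by decide) (by decide) (by decide) ?_ ?_ ?_).mono hσ₁ ?_
  · intro k τ τ' hr ha h
    simp only [R] at h ⊢
    rw [← ha, ← hr 11 (by decide)]
    exact h
  · simp [State.setReg]
  · rintro k τ hk hτ hr ha h12 h13 h14 ⟨hle, h1, h2⟩
    have hmpos : 0 < m := Nat.pos_of_ne_zero (by rintro rfl; simp at hk)
    have hmod : k % m < m := Nat.mod_lt _ hmpos
    have hdiv : k / m < m := Nat.div_lt_of_lt_mul hk
    have e0 : τ.arr 0 = σ.arr 0 := ha 0 (by decide)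
    have e1 : τ.arr 1 = σ.arr 1 := ha 1 (by decide)
    have e2 : τ.arr 2 = σ.arr 2 := ha 2 (by decide)
    have e50 : τ.arr 50 = σ.arr 50 := ha 50 (by decide)
    have er0 : τ.reg 0 = n := (hr 0 (by decide) (by decide)).trans (by simp [State.setReg, hn])
    have hidx : ∀ a b, a < n → b < n → a * n < W ∧ a * n + b < W := by
      intro a b ha hb
      have : a * n + n ≤ n * n := by
        rw [← Nat.succ_mul]
        exact Nat.mul_le_mul_right _ ha
      omega
    have hi1 := hidx _ _ (hs _ hdiv) (hs _ hmod)
    have hi2 := hidx _ _ (ht _ hdiv) (ht _ hmod)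
    have hno : ¬ C k → (τ.reg 11 ≤ k + 1 ∧ (∀ j < k + 1, C j → ∃ g < τ.reg 11, R j τ g) ∧
        ∀ g < τ.reg 11, ∃ j < k + 1, C j ∧ R j τ g) := by
      intro hC
      refine ⟨by omega, ?_, ?_⟩
      · intro j hj hjC
        have : j ≠ k := by rintro rfl; exact hC hjC
        exact h1 j (by omega) hjC
      · intro g hg
        obtain ⟨j, hj, h⟩ := h2 g hg
        exact ⟨j, by omega, h⟩
    refine ⟨?_, ?_⟩
    · simp [addEdge, Safe, exec, Term.Ok, Term.val, State.setArr, h13, h14, e0, e1, e2, er0]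
      omega
    by_cases hl : σ.arr 0 (σ.arr 1 (k / m)) = σ.arr 0 (σ.arr 1 (k % m))
    · by_cases hl' : σ.arr 0 (σ.arr 2 (k / m)) = σ.arr 0 (σ.arr 2 (k % m))
      · have hx : addEdge.exec τ = ((τ.setArr 11 (τ.reg 11)
            (σ.arr 50 (σ.arr 1 (k / m) * n + σ.arr 1 (k % m)))).setArr 12 (τ.reg 11)
            (σ.arr 50 (σ.arr 2 (k / m) * n + σ.arr 2 (k % m)))).setReg 11 (τ.reg 11 + 1) := by
          simp [addEdge, exec, Term.val, h13, h14, e0, e1, e2, er0, e50, hl, hl', State.setReg,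
            State.setArr]
        rw [hx]
        have hold : ∀ j g, g < τ.reg 11 → R j τ g → R j (((τ.setArr 11 (τ.reg 11)
            (σ.arr 50 (σ.arr 1 (k / m) * n + σ.arr 1 (k % m)))).setArr 12 (τ.reg 11)
            (σ.arr 50 (σ.arr 2 (k / m) * n + σ.arr 2 (k % m)))).setReg 11 (τ.reg 11 + 1)) g := by
          intro j g hg h
          have : g ≠ τ.reg 11 := by omega
          simpa [R, State.setReg, State.setArr, this] using h
        have hnew : R k (((τ.setArr 11 (τ.reg 11)
            (σ.arr 50 (σ.arr 1 (k / m) * n + σ.arr 1 (k % m)))).setArr 12 (τ.reg 11)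
            (σ.arr 50 (σ.arr 2 (k / m) * n + σ.arr 2 (k % m)))).setReg 11 (τ.reg 11 + 1))
            (τ.reg 11) := by
          simp [R, State.setReg, State.setArr]
        have hreg : (((τ.setArr 11 (τ.reg 11)
            (σ.arr 50 (σ.arr 1 (k / m) * n + σ.arr 1 (k % m)))).setArr 12 (τ.reg 11)
            (σ.arr 50 (σ.arr 2 (k / m) * n + σ.arr 2 (k % m)))).setReg 11 (τ.reg 11 + 1)).reg 11 =
            τ.reg 11 + 1 := by simp [State.setReg]
        rw [hreg]
        refine ⟨by omega, ?_, ?_⟩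
        · intro j hj hjC
          by_cases hjk : j = k
          · subst hjk
            exact ⟨_, by omega, hnew⟩
          · obtain ⟨g, hg, h⟩ := h1 j (by omega) hjC
            exact ⟨g, by omega, hold j g hg h⟩
        · intro g hg
          rcases Nat.lt_succ_iff_lt_or_eq.1 hg with hg | rfl
          · obtain ⟨j, hj, hjC, h⟩ := h2 g hg
            exact ⟨j, by omega, hjC, hold j g hg h⟩
          · exact ⟨k, by omega, ⟨hl, hl'⟩, hnew⟩
      · have := hno fun h => hl' h.2
        simpa [addEdge, exec, Term.val, h13, h14, e0, e1, e2, hl, hl'] using this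
    · have := hno fun h => hl h.1
      simpa [addEdge, exec, Term.val, h13, h14, e0, e1, e2, hl] using this
  · rintro τ - - ⟨hle, h1, h2⟩
    refine ⟨hle, ?_, ?_⟩
    · intro e he f hf hl hl'
      have hlt : m * e + f < m * m := by
        have := Nat.mul_le_mul_left m (Nat.succ_le_of_lt he)
        rw [Nat.mul_succ] at this
        omega
      have q1 : (m * e + f) / m = e := by
        rw [Nat.mul_add_div (by omega), Nat.div_eq_of_lt hf, Nat.add_zero]
      have q2 : (m * e + f) % m = f := by rw [Nat.mul_add_mod, Nat.mod_eq_of_lt hf]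
      have := h1 (m * e + f) hlt
      simp only [C, R, q1, q2] at this
      exact this ⟨hl, hl'⟩
    · intro g hg
      obtain ⟨j, hj, hC, hR⟩ := h2 g hg
      have hmpos : 0 < m := Nat.pos_of_ne_zero (by rintro rfl; simp at hj)
      exact ⟨j / m, Nat.div_lt_of_lt_mul hj, j % m, Nat.mod_lt _ hmpos, hC.1, hC.2, hR⟩

theorem encodes_of_build {n : ℕ} {G : LabeledDigraph (Fin n) ℕ} {vs : List (Fin n)}
    {es : List (Fin vs.length × Fin vs.length)} (H : Lists G vs es) {d N M : ℕ}
    (hd : d = vs.length) {L s t idx lab s' t' c₁ c₂ : ℕ → ℕ}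
    (hL : ∀ i (h : i < vs.length), L i = G.label vs[i])
    (hs : ∀ e (h : e < es.length), s e = es[e].1) (ht : ∀ e (h : e < es.length), t e = es[e].2)
    (hV : ∀ k < d * d, L (k / d) = L (k % d) → idx k < N ∧ c₁ (idx k) = k / d ∧
      c₂ (idx k) = k % d ∧ lab (idx k) = L (k / d))
    (hV' : ∀ i < N, ∃ k < d * d, L (k / d) = L (k % d) ∧ idx k = i)
    (hE : ∀ e < es.length, ∀ f < es.length, L (s e) = L (s f) → L (t e) = L (t f) →
      ∃ g < M, s' g = idx (s e * d + s f) ∧ t' g = idx (t e * d + t f))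
    (hE' : ∀ g < M, ∃ e < es.length, ∃ f < es.length, L (s e) = L (s f) ∧ L (t e) = L (t f) ∧
      s' g = idx (s e * d + s f) ∧ t' g = idx (t e * d + t f)) :
    Encodes G N M lab s' t' c₁ c₂
      (fun q => idx (vs.idxOf q.1.1 * d + vs.idxOf q.1.2)) := by
  have hp : ∀ v, vs.idxOf v < d := fun v => hd ▸ List.idxOf_lt_length_of_mem (H.mem_vs v)
  have hget : ∀ v, vs[vs.idxOf v]'(hd ▸ hp v) = v := fun v => List.getElem_idxOf _
  have hLp : ∀ v, L (vs.idxOf v) = G.label v := fun v => by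
    rw [hL _ (hd ▸ hp v), hget]
  have hinj : ∀ u v, vs.idxOf u = vs.idxOf v → u = v := fun u v h =>
    (List.idxOf_inj (H.mem_vs u)).1 h
  have hsl : ∀ e < es.length, s e < d := fun e he => by rw [hs e he, hd]; exact es[e].1.2
  have htl : ∀ e < es.length, t e < d := fun e he => by rw [ht e he, hd]; exact es[e].2.2
  have hP : ∀ a < d, ∀ b < d, L a = L b → idx (a * d + b) < N ∧ c₁ (idx (a * d + b)) = a ∧
      c₂ (idx (a * d + b)) = b ∧ lab (idx (a * d + b)) = L a := by
    intro a ha b hb hab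
    have hlt : a * d + b < d * d := by
      have := Nat.mul_le_mul_right d (Nat.succ_le_of_lt ha)
      rw [Nat.succ_mul] at this
      omega
    have q1 : (a * d + b) / d = a := by
      rw [mul_comm, Nat.mul_add_div (by omega), Nat.div_eq_of_lt hb, Nat.add_zero]
    have q2 : (a * d + b) % d = b := by rw [mul_comm, Nat.mul_add_mod, Nat.mod_eq_of_lt hb]
    have := hV _ hlt
    rw [q1, q2] at this
    exact this hab
  have hPinj : ∀ a < d, ∀ b < d, ∀ a' < d, ∀ b' < d, L a = L b → L a' = L b' →
      idx (a * d + b) = idx (a' * d + b') → a = a' ∧ b = b' := by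
    intro a ha b hb a' ha' b' hb' h h' he
    have h1 := hP a ha b hb h
    have h2 := hP a' ha' b' hb' h'
    rw [he] at h1
    exact ⟨h1.2.1.symm.trans h2.2.1, h1.2.2.1.symm.trans h2.2.2.1⟩
  have hLq : ∀ q : G.SelfVertex, L (vs.idxOf q.1.1) = L (vs.idxOf q.1.2) := fun q => by
    rw [hLp, hLp]; exact q.2
  have hq := fun q : G.SelfVertex => hP _ (hp q.1.1) _ (hp q.1.2) (hLq q)
  have hadj : ∀ u v, G.Adj u v ↔ ∃ e < es.length, s e = vs.idxOf u ∧ t e = vs.idxOf v := by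
    intro u v
    have := H.mem_es ⟨_, hd ▸ hp u⟩ ⟨_, hd ▸ hp v⟩
    simp only [List.get_eq_getElem, hget] at this
    rw [← this, List.mem_iff_getElem]
    constructor
    · rintro ⟨e, he, h⟩
      exact ⟨e, he, by rw [hs e he, h], by rw [ht e he, h]⟩
    · rintro ⟨e, he, h, h'⟩
      rw [hs e he] at h
      rw [ht e he] at h'
      exact ⟨e, he, Prod.ext (Fin.ext h) (Fin.ext h')⟩
  refine ⟨⟨?_, fun q => (hq q).1, ?_, ?_, ?_, ?_⟩, ?_, ?_⟩
  · intro q r h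
    obtain ⟨h1, h2⟩ := hPinj _ (hp _) _ (hp _) _ (hp _) _ (hp _) (hLq q) (hLq r) h
    exact Subtype.ext (Prod.ext (hinj _ _ h1) (hinj _ _ h2))
  · intro i hi
    obtain ⟨k, hk, hkl, rfl⟩ := hV' i hi
    have hdpos : 0 < d := Nat.pos_of_ne_zero (by rintro rfl; simp at hk)
    have k1 : k / d < vs.length := hd ▸ Nat.div_lt_of_lt_mul hk
    have k2 : k % d < vs.length := hd ▸ Nat.mod_lt _ hdpos
    refine ⟨⟨(vs[k / d], vs[k % d]), ?_⟩, ?_⟩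
    · rw [← hL _ k1, ← hL _ k2, hkl]
    · simp only [H.nodup_vs.idxOf_getElem]
      rw [mul_comm, Nat.div_add_mod]
  · intro g hg
    obtain ⟨e, he, f, hf, h1, -, h3, -⟩ := hE' g hg
    rw [h3]
    exact (hP _ (hsl e he) _ (hsl f hf) h1).1
  · intro g hg
    obtain ⟨e, he, f, hf, -, h2, -, h4⟩ := hE' g hg
    rw [h4]
    exact (hP _ (htl e he) _ (htl f hf) h2).1
  · intro q r
    change G.Adj _ _ ∧ G.Adj _ _ ↔ _
    rw [hadj, hadj]
    constructor
    · rintro ⟨⟨e, he, h1, h2⟩, f, hf, h3, h4⟩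
      have := hE e he f hf (by rw [h1, h3]; exact hLq q) (by rw [h2, h4]; exact hLq r)
      rwa [h1, h2, h3, h4] at this
    · rintro ⟨g, hg, h1, h2⟩
      obtain ⟨e, he, f, hf, l1, l2, h3, h4⟩ := hE' g hg
      obtain ⟨a1, a2⟩ := hPinj _ (hsl e he) _ (hsl f hf) _ (hp _) _ (hp _) l1 (hLq q)
        (h3.symm.trans h1)
      obtain ⟨b1, b2⟩ := hPinj _ (htl e he) _ (htl f hf) _ (hp _) _ (hp _) l2 (hLq r)
        (h4.symm.trans h2)
      exact ⟨⟨e, he, a1, b1⟩, f, hf, a2, b2⟩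
  · intro q
    rw [(hq q).2.2.2, hLp]
    rfl
  · intro q
    rw [(hq q).2.1, (hq q).2.2.1]
    exact not_congr ⟨hinj _ _, fun h => by rw [h]⟩

/-- A graph without isolated vertices has at most twice as many vertices as edges. -/
theorem length_le_two_mul {n : ℕ} {G : LabeledDigraph (Fin n) ℕ} {vs : List (Fin n)}
    {es : List (Fin vs.length × Fin vs.length)} (H : Lists G vs es)
    (hG : ∀ v, ∃ u, G.Adj u v ∨ G.Adj v u) : vs.length ≤ 2 * es.length := by
  have hsub : (Finset.univ : Finset (Fin vs.length)) ⊆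
      (es.map Prod.fst ++ es.map Prod.snd).toFinset := by
    intro i _
    obtain ⟨u, hu⟩ := hG (vs.get i)
    obtain ⟨j, rfl⟩ := List.get_of_mem (H.mem_vs u)
    rw [List.mem_toFinset, List.mem_append]
    rcases hu with h | h
    · exact .inr (List.mem_map.2 ⟨_, (H.mem_es j i).2 h, rfl⟩)
    · exact .inl (List.mem_map.2 ⟨_, (H.mem_es i j).2 h, rfl⟩)
  have h1 := Finset.card_le_card hsub
  have h2 := List.toFinset_card_le (es.map Prod.fst ++ es.map Prod.snd)
  simp only [Finset.card_univ, Fintype.card_fin, List.length_append, List.length_map] at h1 h2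
  omega

theorem solveGraph_halts {n : ℕ} {G : LabeledDigraph (Fin n) ℕ} {vs : List (Fin n)}
    {es : List (Fin vs.length × Fin vs.length)} (H : Lists G vs es)
    (hG : ∀ v, ∃ u, G.Adj u v ∨ G.Adj v u) (hW : 20 * (es.length ^ 2 + 1) ≤ W)
    (hl : ∀ v, G.label v < W) :
    HaltsWithin W (10 * (es.length ^ 2 + 1)) solveGraph (graphInput G vs es)
      (fun τ => ∃ o, τ.Holds o ∧ G.AlgorithmOutput o) := by
  set σ := graphInput G vs es with hσd
  have hle := length_le_two_mul H hG
  have hmm : es.length ≤ es.length ^ 2 := Nat.le_self_pow (by decide) _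
  have hm2 : es.length ^ 2 = es.length * es.length := sq _
  -- With `m` edges, the self-product has at most `4 * m ^ 2` vertices and `m ^ 2` edges: twice and
  -- three times `5 * m ^ 2 + 1` are the bounds for `solve_halts`, below `10 * (m ^ 2 + 1)` and
  -- `20 * (m ^ 2 + 1)`.
  have hn2 : vs.length * vs.length ≤ 4 * es.length ^ 2 := by nlinarith
  have hσ : σ.Bdd W := by
    refine inputState_bdd (by omega) ?_ ?_
    · simp; omega
    · simp only [List.mem_cons, List.not_mem_nil, or_false]
      rintro l (rfl | rfl | rfl) x hx <;> rw [List.mem_map] at hx <;>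
        obtain ⟨q, -, rfl⟩ := hx
      · exact hl _
      · exact lt_of_lt_of_le q.1.2 (by omega)
      · exact lt_of_lt_of_le q.2.2 (by omega)
  have hL : ∀ i (h : i < vs.length), σ.arr 0 i = G.label vs[i] := fun i h => by
    simp [hσd, graphInput, inputState, h]
  have hs : ∀ e (h : e < es.length), σ.arr 1 e = es[e].1 := fun i h => by
    simp [hσd, graphInput, inputState, h]
  have ht : ∀ e (h : e < es.length), σ.arr 2 e = es[e].2 := fun i h => by
    simp [hσd, graphInput, inputState, h]
  refine HaltsWithin.seq hσ (buildVertices_halts (n := vs.length) hσ rfl (by omega) (by omega)) ?_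
  rintro σ₁ hσ₁ f₁ ⟨hN, hV, hV'⟩
  have a : ∀ x, x < 3 → σ₁.arr x = σ.arr x := fun x hx =>
    f₁.2 x (by simp [buildVertices, pairLoop, addVertex, forLoop, warrs]; omega)
  refine HaltsWithin.seq hσ₁ (buildEdges_halts (n := vs.length) (m := es.length) hσ₁
    (f₁.1 0 (by decide)) (f₁.1 1 (by decide)) (by omega) (by omega) (by omega) ?_ ?_) ?_
  · intro e he
    rw [a 1 (by decide), hs e he]
    exact es[e].1.2
  · intro e he
    rw [a 2 (by decide), ht e he]
    exact es[e].2.2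
  rintro σ₂ hσ₂ f₂ ⟨hM, hE, hE'⟩
  have b : ∀ x, x ≠ 11 → x ≠ 12 → σ₂.arr x = σ₁.arr x := fun x h h' =>
    f₂.2 x (by simp [buildEdges, pairLoop, addEdge, forLoop, warrs, h, h'])
  have b10 : σ₂.reg 10 = σ₁.reg 10 := f₂.1 10 (by decide)
  rw [a 0 (by decide), a 1 (by decide), a 2 (by decide)] at hE hE'
  refine solve_halts hσ₂ rfl rfl (by omega) (by omega) ?_ (encodes_of_build H rfl hL hs ht
    (idx := σ₁.arr 50) ?_ ?_ hE hE')
  · intro x hx hx'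
    rw [b x (by omega) (by omega),
      f₁.2 x (by simp [buildVertices, pairLoop, addVertex, forLoop, warrs]; omega)]
    funext i
    simp [hσd, graphInput, inputState, List.getD_eq_getElem?_getD,
      show 3 ≤ x by omega]
  · rw [b10, b 13 (by decide) (by decide), b 14 (by decide) (by decide),
      b 10 (by decide) (by decide)]
    exact hV
  · rw [b10]
    exact hV'

end WordRAM

theorem mainTheorem1 :
    -- correctness on every finite labeled directed graph
    (∀ (V A : Type*) [Finite V] (G : LabeledDigraph V A),
      (G.PhaseOne ↔ G.HasInfiniteRepeat) ∧
      (¬ G.HasInfiniteRepeat → (G.PhaseTwo ↔ G.HasUnboundedRepeats)) ∧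
      (∀ q, ¬ Relation.TransGen G.dagAdj q q) ∧
      (∃ o, G.AlgorithmOutput o) ∧
      (∀ o, G.AlgorithmOutput o → G.SolvesLRSP o)) ∧
    -- linear time if the labeled self-product is given
    (∃ (P : WordRAM.Program) (C K : ℕ),
      ∀ (n : ℕ) (G : LabeledDigraph (Fin n) ℕ) (vs : List G.SelfVertex)
        (es : List (Fin vs.length × Fin vs.length)), WordRAM.Lists G.self vs es →
      ∀ W : ℕ, K * (vs.length + es.length + 1) ≤ W → (∀ v, G.label v < W) →
      ∃ (t : ℕ) (τ : WordRAM.State) (o : LRSPAnswer ℕ),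
        WordRAM.Runs W P (WordRAM.productInput G vs es) t τ ∧
        t ≤ C * (vs.length + es.length + 1) ∧
        τ.Holds o ∧ G.AlgorithmOutput o) ∧
    -- quadratic time if only the graph is given, without isolated vertices
    (∃ (P : WordRAM.Program) (C K : ℕ),
      ∀ (n : ℕ) (G : LabeledDigraph (Fin n) ℕ) (vs : List (Fin n))
        (es : List (Fin vs.length × Fin vs.length)), WordRAM.Lists G vs es →
      (∀ v, ∃ u, G.Adj u v ∨ G.Adj v u) →
      ∀ W : ℕ, K * (es.length ^ 2 + 1) ≤ W → (∀ v, G.label v < W) →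
      ∃ (t : ℕ) (τ : WordRAM.State) (o : LRSPAnswer ℕ),
        WordRAM.Runs W P (WordRAM.graphInput G vs es) t τ ∧
        t ≤ C * (es.length ^ 2 + 1) ∧
        τ.Holds o ∧ G.AlgorithmOutput o) := by
  refine ⟨fun V A _ G => ⟨LabeledDigraph.phaseOne_iff, LabeledDigraph.phaseTwo_iff,
    LabeledDigraph.not_transGen_dagAdj, LabeledDigraph.exists_algorithmOutput,
    fun _ h => h.solvesLRSP⟩, ?_, ?_⟩
  · refine ⟨WordRAM.solveProduct, WordRAM.solveProduct.bound * 2, 3, ?_⟩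
    intro n G vs es H W hW hl
    obtain ⟨t, τ, hr, ht, o, ho, hout⟩ := WordRAM.solveProduct_halts H hW hl
    exact ⟨t, τ, o, hr, by rwa [← mul_assoc] at ht, ho, hout⟩
  · refine ⟨WordRAM.solveGraph, WordRAM.solveGraph.bound * 10, 20, ?_⟩
    intro n G vs es H hG W hW hl
    obtain ⟨t, τ, hr, ht, o, ho, hout⟩ := WordRAM.solveGraph_halts H hG hW hl
    exact ⟨t, τ, o, hr, by rwa [← mul_assoc] at ht, ho, hout⟩
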